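/- **Setting.** Let $1<\alpha<2$, $\beta=\alpha/2$, $L,T>0$, $\Omega=[0,L]$, and let $\|\cdot\|$ be the norm of $L^2(\Omega)$. Let $\lambda_k=(k\pi/L)^2$, $\varphi_k(x)=\sqrt{2/L}\,\sin(k\pi x/L)$ $(k\ge 1)$ be the Dirichlet eigenpairs of $-\Delta=-d^2/dx^2$ on $\Omega$, let $D((-\Delta)^{s})=\{\psi\in L^2(\Omega):\|\psi\|_s^2:=\sum_k|\lambda_k^{s}(\psi,\varphi_k)|^2<\infty\}$, and let $\omega_\mu(t)=t^{\mu-1}/\Gamma(\mu)$. The Caputo derivative is $\partial_t^\beta w(t)=\int_0^t\omega_{1-\beta}(t-s)\,w'(s)\,ds$. Given $a_0,a_1,f\in L^2(\Omega)$, a solution of the continuous problem is a pair $u,z\in C([0,T];L^2(\Omega))\cap C^1((0,T);L^2(\Omega))$, with $u',z'$ integrable on $(0,T)$, such that for $0<t<T$ one has $u(t)\in H^2(\Omega)\cap H_0^1(\Omega)$, $z(t)\in H_0^1(\Omega)$, $$\partial_t^\beta z-u_{xx}=0,\qquad z=\partial_t^\beta u-[a_1+\Gamma(2-\alpha)f]\,\omega_{2-\beta}(t),$$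 and $u(0)=a_0$, $z(0)=0$. **Schemes.** For $r\ge 1$, $N\ge1$, let $t_k=T(k/N)^r$ $(0\le k\le N)$, $\tau_k=t_k-t_{k-1}$, $\rho_k=\tau_k/\tau_{k+1}$. For $\theta\in[0,1)$ write $t_{n-\theta}=\theta t_{n-1}+(1-\theta)t_n$, and $V^{n-\theta}=\theta V^{n-1}+(1-\theta)V^n$, $(\bar\partial_t^\beta V)^{n-\theta}=\sum_{k=1}^nA^{(n)}_{n-k}(V^k-V^{k-1})$ for a grid function $V$. The two choices are: * $L1$: $\theta=0$ and $A^{(n)}_{n-k}=\frac1{\tau_k}\int_{t_{k-1}}^{t_k}\omega_{1-\beta}(t_n-s)\,ds$. * $L2$-$1_\sigma$: $\theta=\beta/2$, with $a^{(n)}_{0}=\frac1{\tau_n}\int_{t_{n-1}}^{t_{n-\theta}}\omega_{1-\beta}(t_{n-\theta}-s)\,ds$ and, for $1\le k\le n-1$, $a^{(n)}_{n-k}=\frac1{\tau_k}\int_{t_{k-1}}^{t_k}\omega_{1-\beta}(t_{n-\theta}-s)\,ds$, $b^{(n)}_{n-k}=\frac{2}{\tau_k(\tau_k+\tau_{k+1})}\int_{t_{k-1}}^{t_k}\big(s-\tfrac{t_{k-1}+t_k}{2}\big)\omega_{1-\beta}(t_{n-\theta}-s)\,ds$;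 then $A^{(1)}_0=a^{(1)}_0$, and for $n\ge2$: $A^{(n)}_0=a^{(n)}_0+\rho_{n-1}b^{(n)}_1$, $A^{(n)}_{n-k}=a^{(n)}_{n-k}+\rho_{k-1}b^{(n)}_{n-k+1}-b^{(n)}_{n-k}$ $(2\le k\le n-1)$, $A^{(n)}_{n-1}=a^{(n)}_{n-1}-b^{(n)}_{n-1}$. The time-semidiscrete scheme seeks $U^n,Z^n\in H^1_0(\Omega)$ $(1\le n\le N)$ with $U^{n-\theta}\in H^2(\Omega)\cap H^1_0(\Omega)$ and $$(\bar\partial_t^\beta Z)^{n-\theta}-\Delta U^{n-\theta}=0,\qquad Z^{n-\theta}=(\bar\partial_t^\beta U)^{n-\theta}-[a_1+\Gamma(2-\alpha)f]\,\omega_{2-\beta}(t_{n-\theta}),\qquad 1\le n\le N,$$ where $U^0=a_0$, $Z^0=0$. The errors are $\bar u^n=u(t_n)-U^n$ and $\bar z^n=z(t_n)-Z^n$. **Theorem.** Let $\gamma_1\in(\frac1\alpha+\frac14,\frac32]$, $\gamma_2\in(\frac14,1]$, $\varepsilon>0$, and put $s_0=\max\{\gamma_1+\varepsilon,1\}$,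 $s_1=\max\{\gamma_2+\varepsilon,\frac12\}$. For every $r\ge1$ there is a constant $C$, depending only on $\alpha,L,T,r,\gamma_1,\gamma_2,\varepsilon$, such that, for all data and solutions of the continuous problem and of the scheme, for all $N\ge1$ and $1\le n\le N$ (with no restriction on the time steps): 1. ($L1$) If $a_0\in D((-\Delta)^{s_0})$ and $a_1,f\in D((-\Delta)^{s_1})$, then $$\|\bar z^n\|+\|\nabla\bar u^n\|\le C M\big(N^{-\min\{r\beta,\,2-\beta\}}+N^{-\min\{r(1-\beta/2),\,2-\beta\}}\big),\quad M=\|a_0\|_{s_0}+\|a_1\|_{s_1}+\|f\|_{s_1}.$$ 2. ($L2$-$1_\sigma$) If $a_0\in D((-\Delta)^{s_0+1/2})$ and $a_1,f\in D((-\Delta)^{s_1+1/2})$, then $$\|\bar z^n\|+\|\nabla\bar u^n\|\le C M\big(N^{-\min\{r\beta,\,2\}}+N^{-\min\{r(1-\beta/2),\,2\}}\big),\quad M=\|a_0\|_{s_0+1/2}+\|a_1\|_{s_1+1/2}+\|f\|_{s_1+1/2}.$$ Consequently, under the respective hypotheses, the $L1$ scheme with $r=\max\{\frac{4-\alpha}{\alpha},2\}$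 satisfies $\|\bar z^n\|+\|\nabla\bar u^n\|\le CM N^{-(2-\beta)}$, and this $r$ is the smallest $r\ge1$ for which both exponents in 1 equal $2-\beta$; the $L2$-$1_\sigma$ scheme with $r=\max\{\frac4\alpha,\frac8{4-\alpha}\}$ satisfies $\|\bar z^n\|+\|\nabla\bar u^n\|\le CM N^{-2}$, and this $r$ is the smallest $r\ge1$ for which both exponents in 2 equal $2$. -/

import Mathlib

open MeasureTheory Set
open scoped ContDiff

noncomputable section

namespace SFOR

/-! ### Spaces on the interval `Ω = [0, L]` -/

/-- Lebesgue measure on `Ω = [0, L]`. -/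
abbrev omegaMeasure (L : ℝ) : Measure ℝ := volume.restrict (Icc 0 L)

/-- The Hilbert space `L²(Ω)`. -/
abbrev L2 (L : ℝ) : Type := Lp ℝ 2 (omegaMeasure L)

/-- The `k`-th Dirichlet eigenvalue of `-d²/dx²` on `[0, L]`, for `k ≥ 1`. -/
def eigenvalue (L : ℝ) (k : ℕ) : ℝ := (k * Real.pi / L) ^ 2

/-- The `k`-th Dirichlet eigenfunction, normalised in `L²(0, L)`, for `k ≥ 1`. -/
def eigenfun (L : ℝ) (k : ℕ) (x : ℝ) : ℝ :=
  Real.sqrt (2 / L) * Real.sin (k * Real.pi * x / L)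

/-- The coefficient `(ψ, φ_k)` in `L²(Ω)`. -/
def coeff (L : ℝ) (ψ : L2 L) (k : ℕ) : ℝ := ∫ x, ψ x * eigenfun L k x ∂(omegaMeasure L)

/-- `ψ ∈ D((-Δ)^γ)`. The eigenpairs are numbered by `k + 1`, `k = 0, 1, 2, …`. -/
def MemFracDomain (L γ : ℝ) (ψ : L2 L) : Prop :=
  Summable fun k : ℕ => (eigenvalue L (k + 1) ^ γ * coeff L ψ (k + 1)) ^ 2

/-- The norm `‖(-Δ)^γ ψ‖` of `ψ ∈ D((-Δ)^γ)`. -/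
def fracNorm (L γ : ℝ) (ψ : L2 L) : ℝ :=
  Real.sqrt (∑' k : ℕ, (eigenvalue L (k + 1) ^ γ * coeff L ψ (k + 1)) ^ 2)

/-- `g ∈ L²(Ω)` is the weak derivative of `w ∈ L²(Ω)` on `(0, L)`. -/
def HasWeakDeriv (L : ℝ) (w g : L2 L) : Prop :=
  ∀ φ : ℝ → ℝ, ContDiff ℝ ∞ φ → HasCompactSupport φ → tsupport φ ⊆ Ioo 0 L →
    ∫ x, w x * deriv φ x ∂(omegaMeasure L) = -∫ x, g x * φ x ∂(omegaMeasure L)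

/-- `w` has a continuous representative on `[0, L]` which vanishes at `0` and at `L`. -/
def VanishesOnBoundary (L : ℝ) (w : L2 L) : Prop :=
  ∃ c : ℝ → ℝ, ContinuousOn c (Icc 0 L) ∧ c 0 = 0 ∧ c L = 0 ∧ w =ᵐ[omegaMeasure L] c

/-- `w ∈ H¹₀(Ω)` (in one dimension: `H¹` functions are continuous, and those of `H¹₀` are the
ones with boundary values zero). -/
def MemH10 (L : ℝ) (w : L2 L) : Prop :=
  (∃ g : L2 L, HasWeakDeriv L w g) ∧ VanishesOnBoundary L w

/-- `w ∈ H²(Ω) ∩ H¹₀(Ω)` and `w_xx = h`. -/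
def HasDirichletLaplacian (L : ℝ) (w h : L2 L) : Prop :=
  (∃ g : L2 L, HasWeakDeriv L w g ∧ HasWeakDeriv L g h) ∧ VanishesOnBoundary L w

/-! ### The continuous problem -/

/-- `ω_β(t) = t^(β-1) / Γ(β)`. -/
def omega (β t : ℝ) : ℝ := t ^ (β - 1) / Real.Gamma β

/-- The Caputo derivative of order `β ∈ (0, 1)` of a function of time with values in `L²(Ω)`. -/
def caputo {L : ℝ} (β : ℝ) (w : ℝ → L2 L) (t : ℝ) : L2 L :=
  ∫ s in (0 : ℝ)..t, omega (1 - β) (t - s) • deriv w s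

/-- `w ∈ C([0,T]; L²(Ω)) ∩ C¹((0,T); L²(Ω))` with `w'` integrable on `(0, T)`, so that its
Caputo derivative of order `β ∈ (0, 1)` is a convergent integral at every time in `(0, T)`. -/
structure IsTimeRegular (L T : ℝ) (w : ℝ → L2 L) : Prop where
  continuousOn : ContinuousOn w (Icc 0 T)
  differentiableAt : ∀ t ∈ Ioo 0 T, DifferentiableAt ℝ w t
  continuousOn_deriv : ContinuousOn (deriv w) (Ioo 0 T)
  integrableOn_deriv : IntegrableOn (deriv w) (Ioo 0 T)

/-- `(u, z)` solves, with `β = α / 2`,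
`∂_t^β z - u_xx = 0`, `z = ∂_t^β u - (a₁ + Γ(2-α) f) ω_{2-α/2}(t)` on `Ω × (0, T)`,
`u(0) = a₀`, `z(0) = 0`, and `u = z = 0` on `∂Ω × (0, T)`. -/
structure IsSolution (α L T : ℝ) (a₀ a₁ f : L2 L) (u z : ℝ → L2 L) : Prop where
  regular_u : IsTimeRegular L T u
  regular_z : IsTimeRegular L T z
  eq_one : ∀ t ∈ Ioo 0 T, HasDirichletLaplacian L (u t) (caputo (α / 2) z t)
  eq_two : ∀ t ∈ Ioo 0 T,
    z t = caputo (α / 2) u t - omega (2 - α / 2) t • (a₁ + Real.Gamma (2 - α) • f)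
  boundary_z : ∀ t ∈ Ioo 0 T, MemH10 L (z t)
  initial_u : u 0 = a₀
  initial_z : z 0 = 0

/-! ### Graded meshes and discrete Caputo derivatives -/

/-- `t_k = T (k / N)^r`. -/
def node (T r : ℝ) (N k : ℕ) : ℝ := T * ((k : ℝ) / N) ^ r

/-- `τ_k = t_k - t_{k-1}`, for `k ≥ 1`. -/
def step (T r : ℝ) (N k : ℕ) : ℝ := node T r N k - node T r N (k - 1)

/-- `ρ_k = τ_k / τ_{k+1}`, for `1 ≤ k ≤ N - 1`. -/
def stepRatio (T r : ℝ) (N k : ℕ) : ℝ := step T r N k / step T r N (k + 1)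

/-- `t_{n-θ} = θ t_{n-1} + (1 - θ) t_n`, for `n ≥ 1`. -/
def offsetNode (T r θ : ℝ) (N n : ℕ) : ℝ :=
  θ * node T r N (n - 1) + (1 - θ) * node T r N n

/-- `V^{n-θ} = θ V^{n-1} + (1 - θ) V^n`, for `n ≥ 1`. -/
def offsetValue {L : ℝ} (θ : ℝ) (V : ℕ → L2 L) (n : ℕ) : L2 L :=
  θ • V (n - 1) + (1 - θ) • V n

/-- The `L1` kernel: `l1Kernel T r β N n k` is `A_{n-k}^{(n)}`, for `1 ≤ k ≤ n`. -/
def l1Kernel (T r β : ℝ) (N n k : ℕ) : ℝ :=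
  (step T r N k)⁻¹ *
    ∫ s in node T r N (k - 1)..node T r N k, omega (1 - β) (node T r N n - s)

/-- `alikhanovA T r β N n k` is `a_{n-k}^{(n)}`, for `1 ≤ k ≤ n`, with `θ = β / 2`. -/
def alikhanovA (T r β : ℝ) (N n k : ℕ) : ℝ :=
  (step T r N k)⁻¹ *
    ∫ s in node T r N (k - 1)..(if k = n then offsetNode T r (β / 2) N n else node T r N k),
      omega (1 - β) (offsetNode T r (β / 2) N n - s)

/-- `alikhanovB T r β N n k` is `b_{n-k}^{(n)}`, for `1 ≤ k ≤ n - 1`, with `θ = β / 2`. -/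
def alikhanovB (T r β : ℝ) (N n k : ℕ) : ℝ :=
  2 / (step T r N k * (step T r N k + step T r N (k + 1))) *
    ∫ s in node T r N (k - 1)..node T r N k,
      (s - (node T r N (k - 1) + node T r N k) / 2) *
        omega (1 - β) (offsetNode T r (β / 2) N n - s)

/-- The Alikhanov (`L2-1_σ`) kernel: `alikhanovKernel T r β N n k` is `A_{n-k}^{(n)}`,
for `1 ≤ k ≤ n`. -/
def alikhanovKernel (T r β : ℝ) (N n k : ℕ) : ℝ :=
  if n = 1 then alikhanovA T r β N 1 1
  else if k = n then
    alikhanovA T r β N n n + stepRatio T r N (n - 1) * alikhanovB T r β N n (n - 1)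
  else if k = 1 then alikhanovA T r β N n 1 - alikhanovB T r β N n 1
  else
    alikhanovA T r β N n k + stepRatio T r N (k - 1) * alikhanovB T r β N n (k - 1)
      - alikhanovB T r β N n k

/-- The discrete Caputo derivative `∑_{k=1}^n A_{n-k}^{(n)} (V^k - V^{k-1})` of kernel `A`. -/
def discreteCaputo {L : ℝ} (A : ℕ → ℕ → ℝ) (V : ℕ → L2 L) (n : ℕ) : L2 L :=
  ∑ k ∈ Finset.Icc 1 n, A n k • (V k - V (k - 1))

/-- `(U^n, Z^n)`, `0 ≤ n ≤ N`, solves the time-semidiscrete scheme with offset `θ` and discrete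
kernel `A`, on the mesh `t_k = T (k / N)^r`. -/
structure IsSchemeSolution (α L T r θ : ℝ) (N : ℕ) (A : ℕ → ℕ → ℝ) (a₀ a₁ f : L2 L)
    (U Z : ℕ → L2 L) : Prop where
  eq_one : ∀ n ∈ Finset.Icc 1 N,
    HasDirichletLaplacian L (offsetValue θ U n) (discreteCaputo A Z n)
  eq_two : ∀ n ∈ Finset.Icc 1 N,
    offsetValue θ Z n = discreteCaputo A U n
      - omega (2 - α / 2) (offsetNode T r θ N n) • (a₁ + Real.Gamma (2 - α) • f)
  boundary_U : ∀ n ∈ Finset.Icc 1 N, MemH10 L (U n)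
  boundary_Z : ∀ n ∈ Finset.Icc 1 N, MemH10 L (Z n)
  initial_U : U 0 = a₀
  initial_Z : Z 0 = 0

/-- For all data `a₀ ∈ D((-Δ)^s₀)`, `a₁, f ∈ D((-Δ)^s₁)`, all `N ≥ 1` and all `1 ≤ n ≤ N`:
`‖z(t_n) - Z^n‖ + ‖∇(u(t_n) - U^n)‖ ≤ C (‖a₀‖_{s₀} + ‖a₁‖_{s₁} + ‖f‖_{s₁}) rate(N)`,
where the norms on the left are those of `L²(Ω)`. The family `A` has a kernel `A N` for
each number `N` of time steps. -/
def ErrorBound (α L T r θ : ℝ) (A : ℕ → ℕ → ℕ → ℝ) (s₀ s₁ C : ℝ) (rate : ℕ → ℝ) : Prop :=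
  ∀ a₀ a₁ f : L2 L,
    MemFracDomain L s₀ a₀ → MemFracDomain L s₁ a₁ → MemFracDomain L s₁ f →
    ∀ u z : ℝ → L2 L, IsSolution α L T a₀ a₁ f u z →
    ∀ N : ℕ, 1 ≤ N →
    ∀ U Z : ℕ → L2 L, IsSchemeSolution α L T r θ N (A N) a₀ a₁ f U Z →
    ∀ n ∈ Finset.Icc 1 N,
      ∃ g : L2 L, HasWeakDeriv L (u (node T r N n) - U n) g ∧
        ‖z (node T r N n) - Z n‖ + ‖g‖
          ≤ C * (fracNorm L s₀ a₀ + fracNorm L s₁ a₁ + fracNorm L s₁ f) * rate N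

end SFOR

end

/-! Expand in sines and put W = μ u_k + i z_k, where μ = kπ/L. Each mode of the continuous system
becomes one scalar equation ∂_t^β W = −iμ W + μ g ω_{2−β}, and each mode of the scheme becomes its
discrete analogue (`IsSolution.complexMode_eq_modeSol`, `IsSchemeSolution.isModeScheme`). By
Parseval, the sum of |W_k|² is ‖∇u‖² + ‖z‖². So it suffices to bound the error of a single mode with
explicit powers of μ and to sum the squares (`exists_errorBound_of_mode`). Three ingredients enter.

Regularity. The mode is a combination of Mittag-Leffler functions of −iμ t^β. By Plancherel, the
quadratic form of the fractional integral I^β takes values in a sector of half angle βπ/2 < π/2.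
Hence the equation f = −iμ I^β f + h is stable in L² uniformly in μ
(`integral_norm_sq_le_of_volterra`). If the Mittag-Leffler coefficients are weighted by a polynomial
p(k), then I^β shifts p by one, so p − p(· − 1) has smaller degree and an induction bounds all such
series (`integral_norm_sq_wml_le`, `norm_wml_le`). Derivatives are series of this kind, up to powers
of t. The outcome is |W^{(l)}(t)| ≤ C (μ²|a| + μ|g|) t^{β−l} for l = 1, 2, 3
(`exists_hasSingularDerivs`).

Stability. If the kernel increases towards the present, testing the discrete derivative with E^{n−θ}
controls weighted differences of |E|², and the generator −iμ drops out because it is skew. At the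
index of maximal norm this yields |E| ≤ 2 max |R^n| / A^{(n)}_{n−1} (`IsStableKernel.norm_le`),
without Gronwall's lemma and hence without a step restriction. Since A^{(n)}_{n−1} ≥ ω_{1−β}(t_n),
residuals of size t_n^{−β} N^{−m} produce an error N^{−m}.

Consistency. On each past step the interpolant reproduces the increment of W, so only the increment
of the kernel over that step multiplies the interpolation error. The grading makes the weighted sum
O(t_n^{−β} N^{−m}), with m ≤ rβ and m ≤ 2 − β for L1 (`exists_l1_truncation_le`) or m ≤ 3 − β for
L2-1_σ (`exists_alikhanov_truncation_le`). Evaluating the solution between grid points costs a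
further error of second order multiplied by μ (`exists_offset_le`). This explains both the cap 2 and
the additional half power of the Laplacian for L2-1_σ.

The first summand of each stated rate therefore bounds the error by itself, and the optimal gradings
are the smallest r at which both exponents saturate. -/

noncomputable section

namespace SFOR

/-! ### Plancherel's theorem for integrable and square integrable functions -/

section Plancherel

open FourierTransform ComplexInnerProductSpace

/-- The `L²` Fourier transform of an integrable, square integrable function is given by the
Fourier integral. -/
theorem fourier_toLp_ae_eq {f : ℝ → ℂ} (h1 : Integrable f) (h2 : MemLp f 2) :
    ((𝓕 (h2.toLp f) : Lp ℂ 2 (volume : Measure ℝ)) : ℝ → ℂ) =ᵐ[volume] 𝓕 f := by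
  have hcont : Continuous (𝓕 f) := by
    apply VectorFourier.fourierIntegral_continuous Real.continuous_fourierChar ?_ h1
    exact (innerSL ℝ (E := ℝ)).continuous₂
  -- Both sides are compared by testing with smooth compactly supported functions: the `L²`
  -- transform is the distributional one, and for integrable functions the transform moves to the
  -- test function by Fubini.
  refine ae_eq_of_integral_contDiff_smul_eq
    ((Lp.memLp _).locallyIntegrable (by norm_num)) hcont.locallyIntegrable ?_
  intro g g_smooth g_cpt
  have hg₁ : HasCompactSupport (Complex.ofRealCLM ∘ g) := g_cpt.comp_left rfl
  have hg₂ : ContDiff ℝ ∞ (Complex.ofRealCLM ∘ g) := by fun_prop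
  set G := hg₁.toSchwartzMap hg₂ with hG
  have hGa : ∀ x, G x = (g x : ℂ) := fun x => rfl
  have e1 : ∫ x, g x • ((𝓕 (h2.toLp f) : Lp ℂ 2 (volume : Measure ℝ)) : ℝ → ℂ) x
      = ((𝓕 (h2.toLp f) : Lp ℂ 2 (volume : Measure ℝ)) : TemperedDistribution ℝ ℂ) G := by
    rw [Lp.toTemperedDistribution_apply]
    simp [hGa]
  rw [e1, ← Lp.fourier_toTemperedDistribution_eq, TemperedDistribution.fourier_apply,
    Lp.toTemperedDistribution_apply]
  have e2 : ∫ x, (𝓕 G : SchwartzMap ℝ ℂ) x • (h2.toLp f) x = ∫ x, 𝓕 (G : ℝ → ℂ) x • f x := by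
    apply integral_congr_ae
    filter_upwards [h2.coeFn_toLp] with x hx
    rw [hx, SchwartzMap.fourier_coe]
  rw [e2]
  have := VectorFourier.integral_fourierIntegral_smul_eq_flip (μ := (volume : Measure ℝ))
    (ν := (volume : Measure ℝ)) (L := innerₗ ℝ) (f := (G : ℝ → ℂ)) (g := f)
    Real.continuous_fourierChar continuous_inner G.integrable h1
  rw [flip_innerₗ] at this
  refine Eq.trans this ?_
  rfl

/-- Plancherel's theorem for integrable, square integrable functions, in sesquilinear form. -/
theorem integral_inner_fourier_eq {f g : ℝ → ℂ} (f1 : Integrable f) (f2 : MemLp f 2)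
    (g1 : Integrable g) (g2 : MemLp g 2) :
    ∫ w, (starRingEnd ℂ) (𝓕 f w) * 𝓕 g w = ∫ x, (starRingEnd ℂ) (f x) * g x := by
  have h := Lp.inner_fourier_eq (f2.toLp f) (g2.toLp g)
  rw [L2.inner_def, L2.inner_def] at h
  have hl : ∫ a, ⟪(𝓕 (f2.toLp f) : Lp ℂ 2 (volume : Measure ℝ)) a,
      (𝓕 (g2.toLp g) : Lp ℂ 2 (volume : Measure ℝ)) a⟫
      = ∫ w, (starRingEnd ℂ) (𝓕 f w) * 𝓕 g w := by
    apply integral_congr_ae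
    filter_upwards [fourier_toLp_ae_eq f1 f2, fourier_toLp_ae_eq g1 g2] with x hx hy
    rw [hx, hy, RCLike.inner_apply, mul_comm]
  have hr : ∫ a, ⟪f2.toLp f a, g2.toLp g a⟫ = ∫ x, (starRingEnd ℂ) (f x) * g x := by
    apply integral_congr_ae
    filter_upwards [f2.coeFn_toLp, g2.coeFn_toLp] with x hx hy
    rw [hx, hy, RCLike.inner_apply, mul_comm]
  rw [← hl, ← hr, h]

end Plancherel

/-! ### The Laplace transform of a power, and the sector property of fractional integrals -/

theorem integrableOn_cpow_mul_exp {β : ℝ} (hβ : 0 < β) {z : ℂ} (hz : 0 < z.re) :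
    IntegrableOn (fun t : ℝ => ((t ^ (β - 1) : ℝ) : ℂ) * Complex.exp (-(z * t))) (Ioi 0) := by
  have h := Real.GammaIntegral_convergent hβ
  have h2 : IntegrableOn (fun t : ℝ => t ^ (β - 1) * Real.exp (-(z.re * t))) (Ioi 0) := by
    have := integrableOn_rpow_mul_exp_neg_mul_rpow (s := β - 1) (p := 1) (b := z.re)
      (by linarith) one_pos hz
    simpa using this
  refine h2.mono' ?_ ?_
  · apply Measurable.aestronglyMeasurable
    fun_prop
  · filter_upwards [ae_restrict_mem measurableSet_Ioi] with t ht
    rw [norm_mul, Complex.norm_exp, Complex.norm_real, Real.norm_of_nonneg (Real.rpow_nonneg (le_of_lt ht) _)]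
    simp

/-- The Laplace transform of `t ^ (β - 1)` in the right half plane. -/
theorem integral_rpow_mul_cexp_neg_mul {β : ℝ} (hβ : 0 < β) {z : ℂ} (hz : 0 < z.re) :
    ∫ t in Ioi (0 : ℝ), ((t ^ (β - 1) : ℝ) : ℂ) * Complex.exp (-(z * t))
      = Real.Gamma β * z ^ (-(β : ℂ)) := by
  -- Both sides are holomorphic on the right half plane and agree on the positive reals, which
  -- accumulate at 1; the identity theorem concludes.
  set U : Set ℂ := {z | 0 < z.re} with hU
  have hUo : IsOpen U := isOpen_lt continuous_const Complex.continuous_re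
  have hUc : IsPreconnected U := (convex_halfSpace_re_gt 0).isPreconnected
  set J : ℂ → ℂ := fun z => ∫ t in Ioi (0 : ℝ), ((t ^ (β - 1) : ℝ) : ℂ) * Complex.exp (-(z * t))
    with hJ
  have hJd : DifferentiableOn ℂ J U := by
    intro w hw
    have hw' : 0 < w.re := hw
    refine DifferentiableAt.differentiableWithinAt ?_
    have := hasDerivAt_integral_of_dominated_loc_of_deriv_le (μ := volume.restrict (Ioi (0 : ℝ)))
      (F := fun (z : ℂ) (t : ℝ) => ((t ^ (β - 1) : ℝ) : ℂ) * Complex.exp (-(z * t)))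
      (F' := fun (z : ℂ) (t : ℝ) => ((t ^ (β - 1) : ℝ) : ℂ) * (Complex.exp (-(z * t)) * (-t)))
      (x₀ := w) (s := Metric.ball w (w.re / 2)) (Metric.ball_mem_nhds _ (by linarith))
      (bound := fun t => t ^ β * Real.exp (-((w.re / 2) * t)))
      ?_ (integrableOn_cpow_mul_exp hβ hw') ?_ ?_ ?_ ?_
    · exact this.2.differentiableAt
    · refine Filter.Eventually.of_forall fun z => Measurable.aestronglyMeasurable ?_
      fun_prop
    · apply Measurable.aestronglyMeasurable
      fun_prop
    · filter_upwards [ae_restrict_mem measurableSet_Ioi] with t ht z hz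
      have ht : 0 < t := ht
      rw [norm_mul, norm_mul, Complex.norm_exp, Complex.norm_real,
        Real.norm_of_nonneg (Real.rpow_nonneg ht.le _), norm_neg, Complex.norm_real,
        Real.norm_of_nonneg ht.le]
      have h1 : t ^ β = t ^ (β - 1) * t := by
        rw [← Real.rpow_add_one ht.ne']; ring_nf
      have h2 : w.re / 2 ≤ z.re := by
        have := Complex.abs_re_le_norm (z - w)
        rw [Metric.mem_ball, dist_eq_norm] at hz
        rw [Complex.sub_re] at this
        have := (abs_le.1 (this.trans hz.le)).1
        linarith
      have h3 : (-(z * (t : ℂ))).re ≤ -((w.re / 2) * t) := by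
        simp only [Complex.neg_re, Complex.mul_re, Complex.ofReal_re, Complex.ofReal_im, mul_zero,
          sub_zero]
        nlinarith
      rw [h1]
      have h4 := Real.exp_le_exp.2 h3
      have h5 := Real.rpow_nonneg ht.le (β - 1)
      calc _ = t ^ (β - 1) * t * Real.exp (-(z * (t : ℂ))).re := by ring
        _ ≤ _ := by gcongr
    · have := integrableOn_rpow_mul_exp_neg_mul_rpow (s := β) (p := 1) (b := w.re / 2)
        (by linarith) one_pos (by linarith)
      simpa [IntegrableOn] using this
    · refine Filter.Eventually.of_forall fun t z _ => ?_
      have h1 : HasDerivAt (fun z : ℂ => -(z * (t : ℂ))) (-(t : ℂ)) z := by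
        simpa using ((hasDerivAt_id z).mul_const (t : ℂ)).fun_neg
      exact (h1.cexp).const_mul _
  have hRd : DifferentiableOn ℂ (fun z : ℂ => Real.Gamma β * z ^ (-(β : ℂ))) U := by
    intro w hw
    refine DifferentiableAt.differentiableWithinAt ?_
    refine DifferentiableAt.const_mul ?_ _
    exact differentiableAt_id.cpow_const (Or.inl hw)
  have hreal : ∀ r : ℝ, 0 < r → J r = Real.Gamma β * (r : ℂ) ^ (-(β : ℂ)) := by
    intro r hr
    have h := Real.integral_rpow_mul_exp_neg_mul_Ioi hβ hr
    have e : J r = ((∫ t in Ioi (0 : ℝ), t ^ (β - 1) * Real.exp (-(r * t)) : ℝ) : ℂ) := by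
      simp only [hJ]
      rw [← integral_complex_ofReal]
      refine integral_congr_ae (Filter.Eventually.of_forall fun t => ?_)
      push_cast
      rfl
    rw [e, h, one_div, Real.inv_rpow hr.le, ← Real.rpow_neg hr.le, mul_comm, Complex.ofReal_mul,
      Complex.ofReal_cpow hr.le]
    push_cast
    rfl
  have := (hJd.analyticOnNhd hUo).eqOn_of_preconnected_of_frequently_eq
    (hRd.analyticOnNhd hUo) hUc (z₀ := 1) (by simp [hU]) ?_
  · exact this hz
  · rw [Filter.frequently_iff]
    intro V hV
    have hc : Filter.Tendsto (fun r : ℝ => (r : ℂ)) (nhdsWithin 1 {1}ᶜ) (nhdsWithin 1 {1}ᶜ) := by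
      apply tendsto_nhdsWithin_of_tendsto_nhds_of_eventually_within
      · exact (Complex.continuous_ofReal.tendsto' 1 1 (by simp)).mono_left nhdsWithin_le_nhds
      · filter_upwards [self_mem_nhdsWithin] with r hr
        simpa using hr
    have h1 : ∀ᶠ r : ℝ in nhdsWithin 1 {1}ᶜ, (r : ℂ) ∈ V := hc hV
    have h2 : ∀ᶠ r : ℝ in nhdsWithin 1 {1}ᶜ, 0 < r :=
      nhdsWithin_le_nhds (lt_mem_nhds one_pos)
    obtain ⟨r, hr1, hr2⟩ := (Filter.Eventually.and h1 h2).exists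
    exact ⟨r, hr1, hreal r hr2⟩

/-- The argument of the product is −β(π/2 + arg z), which lies in (−π, 0). This is the sector
property at the level of Fourier symbols. -/
theorem im_exp_mul_cpow_nonpos {β : ℝ} (hβ0 : 0 < β) (hβ1 : β < 1) {z : ℂ} (hz : 0 < z.re) :
    (Complex.exp (-(β * Real.pi / 2 : ℝ) * Complex.I) * z ^ (-(β : ℂ))).im ≤ 0 := by
  have hz0 : z ≠ 0 := by rintro rfl; simp at hz
  have h1 := Complex.abs_arg_lt_pi_div_two_iff.2 (Or.inl hz)
  rw [Complex.cpow_def_of_ne_zero hz0, ← Complex.exp_add, Complex.exp_im]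
  apply mul_nonpos_of_nonneg_of_nonpos (Real.exp_pos _).le
  have : (-((β * Real.pi / 2 : ℝ) : ℂ) * Complex.I + Complex.log z * -(β : ℂ)).im
      = -(β * (Real.pi / 2 + z.arg)) := by
    simp [Complex.log_im]
    ring
  rw [this, Real.sin_neg]
  have h2 := abs_lt.1 h1
  have := Real.sin_nonneg_of_nonneg_of_le_pi (x := β * (Real.pi / 2 + z.arg))
    (by have : 0 < Real.pi / 2 + z.arg := by linarith
        positivity)
    (by have : 0 < Real.pi / 2 + z.arg := by linarith
        nlinarith)
  linarith

/-- The Riemann–Liouville integral of order `β`. -/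
def fracInt {E : Type*} [NormedAddCommGroup E] [NormedSpace ℝ E] (β : ℝ) (f : ℝ → E) (t : ℝ) : E :=
  ∫ s in (0 : ℝ)..t, omega β (t - s) • f s

section Sector

open FourierTransform Convolution

/-- The kernel of the Riemann–Liouville integral, damped by the factor `exp (-ε t)`. -/
def dampedKernel (β ε t : ℝ) : ℂ :=
  (Ioi (0 : ℝ)).indicator (fun t => ((omega β t * Real.exp (-(ε * t)) : ℝ) : ℂ)) t

theorem dampedKernel_eq (β ε t : ℝ) : dampedKernel β ε t =
    (Ioi (0 : ℝ)).indicator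
      (fun t : ℝ => ((Real.Gamma β)⁻¹ : ℝ) *
        (((t ^ (β - 1) : ℝ) : ℂ) * Complex.exp (-((ε : ℂ) * t)))) t := by
  unfold dampedKernel omega
  congr 1
  ext t
  push_cast
  ring

theorem integrable_dampedKernel {β ε : ℝ} (hβ : 0 < β) (hε : 0 < ε) :
    Integrable (dampedKernel β ε) := by
  have h := integrableOn_cpow_mul_exp hβ (z := (ε : ℂ)) (by simpa using hε)
  have h2 := (integrable_indicator_iff measurableSet_Ioi).2
    (h.const_mul (((Real.Gamma β)⁻¹ : ℝ) : ℂ))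
  refine h2.congr (Filter.Eventually.of_forall fun t => ?_)
  rw [dampedKernel_eq]

theorem fourier_dampedKernel {β ε : ℝ} (hβ : 0 < β) (hε : 0 < ε) (w : ℝ) :
    𝓕 (dampedKernel β ε) w = ((ε : ℂ) + 2 * Real.pi * w * Complex.I) ^ (-(β : ℂ)) := by
  rw [Real.fourier_real_eq_integral_exp_smul]
  have hG : (Real.Gamma β : ℂ) ≠ 0 := by exact_mod_cast (Real.Gamma_pos_of_pos hβ).ne'
  have h := integral_rpow_mul_cexp_neg_mul hβ
    (z := (ε : ℂ) + 2 * Real.pi * w * Complex.I) (by simpa using hε)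
  have e : ∀ v : ℝ, Complex.exp (↑(-2 * Real.pi * v * w) * Complex.I) • dampedKernel β ε v
      = (Ioi (0 : ℝ)).indicator (fun t : ℝ => ((Real.Gamma β)⁻¹ : ℝ) *
        (((t ^ (β - 1) : ℝ) : ℂ) *
          Complex.exp (-(((ε : ℂ) + 2 * Real.pi * w * Complex.I) * t)))) v := by
    intro v
    rw [dampedKernel_eq]
    by_cases hv : v ∈ Ioi (0 : ℝ)
    · rw [indicator_of_mem hv, indicator_of_mem hv, smul_eq_mul]
      have : -(((ε : ℂ) + 2 * Real.pi * w * Complex.I) * v)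
          = ↑(-2 * Real.pi * v * w) * Complex.I + -((ε : ℂ) * v) := by
        push_cast; ring
      rw [this, Complex.exp_add]
      ring
    · rw [indicator_of_notMem hv, indicator_of_notMem hv, smul_zero]
  simp_rw [e]
  rw [integral_indicator measurableSet_Ioi, integral_const_mul, h]
  push_cast
  field_simp

/-- The quadratic form of a damped fractional integral of order `β` takes its values in the sector
of half angle `β π / 2`. -/
theorem im_integral_conj_mul_convolution_nonpos {β ε : ℝ} (hβ0 : 0 < β) (hβ1 : β < 1) (hε : 0 < ε)
    {F : ℝ → ℂ} (F1 : Integrable F) {B : ℝ} (FB : ∀ t, ‖F t‖ ≤ B) :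
    (Complex.exp (-(β * Real.pi / 2 : ℝ) * Complex.I) *
      ∫ t, (starRingEnd ℂ) (F t) *
        (F ⋆[ContinuousLinearMap.mul ℂ ℂ] dampedKernel β ε) t).im ≤ 0 := by
  have k1 := integrable_dampedKernel hβ0 hε
  have memLp2 : ∀ {G : ℝ → ℂ} {B : ℝ}, Integrable G → (∀ t, ‖G t‖ ≤ B) → MemLp G 2 := by
    intro G B hG hB
    rw [memLp_two_iff_integrable_sq_norm hG.1]
    refine (hG.norm.const_mul B).mono' (hG.1.norm.pow 2) (Filter.Eventually.of_forall fun t => ?_)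
    rw [Real.norm_of_nonneg (by positivity), sq]
    exact mul_le_mul_of_nonneg_right (hB t) (norm_nonneg _)
  have G1 : Integrable (F ⋆[ContinuousLinearMap.mul ℂ ℂ] dampedKernel β ε) :=
    F1.integrable_convolution _ k1
  have GB : ∀ t, ‖(F ⋆[ContinuousLinearMap.mul ℂ ℂ] dampedKernel β ε) t‖
      ≤ ∫ s, B * ‖dampedKernel β ε s‖ := by
    intro t
    rw [← convolution_flip, convolution_def]
    refine (norm_integral_le_integral_norm _).trans ?_
    refine integral_mono_of_nonneg (Filter.Eventually.of_forall fun _ => norm_nonneg _)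
      (k1.norm.const_mul B) (Filter.Eventually.of_forall fun s => ?_)
    simp only [ContinuousLinearMap.flip_apply, ContinuousLinearMap.mul_apply', norm_mul]
    exact mul_le_mul_of_nonneg_right (FB _) (norm_nonneg _)
  have F2 := memLp2 F1 FB
  rw [← integral_inner_fourier_eq F1 F2 G1 (memLp2 G1 GB), ← integral_const_mul]
  -- On the Fourier side the form is the integral of |F̂|² against the symbol (ε + 2πiw)^(−β), whose
  -- rotation stays in the closed lower half plane.
  have hpt : ∀ w, Complex.exp (-(β * Real.pi / 2 : ℝ) * Complex.I) * ((starRingEnd ℂ) (𝓕 F w) *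
      𝓕 (F ⋆[ContinuousLinearMap.mul ℂ ℂ] dampedKernel β ε) w)
      = ((‖𝓕 F w‖ ^ 2 : ℝ) : ℂ) * (Complex.exp (-(β * Real.pi / 2 : ℝ) * Complex.I) *
        ((ε : ℂ) + 2 * Real.pi * w * Complex.I) ^ (-(β : ℂ))) := by
    intro w
    rw [Real.fourier_mul_convolution_eq F1 k1, fourier_dampedKernel hβ0 hε]
    have : (starRingEnd ℂ) (𝓕 F w) * 𝓕 F w = ((‖𝓕 F w‖ ^ 2 : ℝ) : ℂ) := by
      rw [mul_comm, Complex.mul_conj, Complex.normSq_eq_norm_sq]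
    rw [← this]; ring
  simp_rw [hpt]
  by_cases hi : Integrable (fun w => ((‖𝓕 F w‖ ^ 2 : ℝ) : ℂ) *
      (Complex.exp (-(β * Real.pi / 2 : ℝ) * Complex.I) *
        ((ε : ℂ) + 2 * Real.pi * w * Complex.I) ^ (-(β : ℂ))))
  · have := integral_im hi
    simp only [RCLike.im_eq_complex_im] at this
    rw [← this]
    apply integral_nonpos
    intro w
    simp only [Pi.zero_apply]
    rw [Complex.im_ofReal_mul]
    exact mul_nonpos_of_nonneg_of_nonpos (by positivity)
      (im_exp_mul_cpow_nonpos hβ0 hβ1 (by simpa using hε))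
  -- A non-integrable integrand has integral 0 by convention, so this case is harmless.
  · rw [integral_undef hi]; simp

/-- `L²` stability of the Volterra equation `f = -i μ I^β f + h`, uniformly in `μ ≥ 0`. -/
theorem integral_norm_sq_le_of_volterra {β T μ : ℝ} (hβ0 : 0 < β) (hβ1 : β < 1) (hT : 0 < T)
    (hμ : 0 ≤ μ) {f h : ℝ → ℂ} (hf : ContinuousOn f (Icc 0 T)) (hh : ContinuousOn h (Icc 0 T))
    (heq : ∀ t ∈ Ioo 0 T, f t = -(μ * Complex.I) * fracInt β f t + h t) :
    ∫ t in (0 : ℝ)..T, ‖f t‖ ^ 2 ≤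
      Real.exp 2 / Real.cos (β * Real.pi / 2) ^ 2 * ∫ t in (0 : ℝ)..T, ‖h t‖ ^ 2 := by
  set κ := β * Real.pi / 2 with hκ
  have hcos : 0 < Real.cos κ := by
    apply Real.cos_pos_of_mem_Ioo
    constructor <;> nlinarith [Real.pi_pos]
  -- Damping at rate 1/T makes the kernel integrable on the half line and costs only the factor e²
  -- when it is undone on [0, T].
  set ε := T⁻¹ with hε
  have hε0 : 0 < ε := by positivity
  set d : ℝ → ℂ := fun t => ((Real.exp (-(ε * t)) : ℝ) : ℂ) with hd
  have dcont : Continuous d := by fun_prop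
  have dnorm : ∀ t, ‖d t‖ = Real.exp (-(ε * t)) := fun t => by
    rw [hd, Complex.norm_real, Real.norm_of_nonneg (Real.exp_pos _).le]
  set F : ℝ → ℂ := (Ioo 0 T).indicator (fun t => d t * f t) with hF
  have hdf : ContinuousOn (fun t => d t * f t) (Icc 0 T) := dcont.continuousOn.mul hf
  have hdh : ContinuousOn (fun t => d t * h t) (Icc 0 T) := dcont.continuousOn.mul hh
  have F1 : Integrable F := by
    rw [hF, integrable_indicator_iff measurableSet_Ioo]
    exact hdf.integrableOn_Icc.mono_set Ioo_subset_Icc_self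
  obtain ⟨B, hB⟩ := isCompact_Icc.exists_bound_of_continuousOn hdf
  have FB : ∀ t, ‖F t‖ ≤ max B 0 := by
    intro t
    by_cases ht : t ∈ Ioo 0 T
    · rw [hF, indicator_of_mem ht]
      exact (hB t (Ioo_subset_Icc_self ht)).trans (le_max_left _ _)
    · rw [hF, indicator_of_notMem ht]; simp
  set Q := ∫ t, (starRingEnd ℂ) (F t) *
        (F ⋆[ContinuousLinearMap.mul ℂ ℂ] dampedKernel β ε) t with hQ
  have hsec := im_integral_conj_mul_convolution_nonpos hβ0 hβ1 hε0 F1 FB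
  rw [← hQ, ← hκ] at hsec
  -- The exponential factor is multiplicative, so damping both the kernel and the function amounts
  -- to damping the fractional integral.
  have hconv : ∀ t ∈ Ioo 0 T, (F ⋆[ContinuousLinearMap.mul ℂ ℂ] dampedKernel β ε) t
      = d t * fracInt β f t := by
    intro t ht
    rw [convolution_def, fracInt, intervalIntegral.integral_of_le ht.1.le,
      integral_Ioc_eq_integral_Ioo, ← integral_indicator measurableSet_Ioo, ← integral_const_mul]
    refine integral_congr_ae (Filter.Eventually.of_forall fun s => ?_)
    simp only [ContinuousLinearMap.mul_apply']
    by_cases hs : s ∈ Ioo 0 t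
    · have hs' : s ∈ Ioo 0 T := ⟨hs.1, hs.2.trans ht.2⟩
      rw [hF, indicator_of_mem hs', indicator_of_mem hs, dampedKernel,
        indicator_of_mem (by simpa using hs.2)]
      rw [Complex.real_smul, Complex.ofReal_mul]
      have : d t = d s * ((Real.exp (-(ε * (t - s))) : ℝ) : ℂ) := by
        rw [hd]
        simp only
        rw [← Complex.ofReal_mul, ← Real.exp_add]
        congr 2; ring
      rw [this]; ring
    · rw [indicator_of_notMem hs, mul_zero]
      by_cases hs0 : 0 < s
      · have : t - s ∉ Ioi (0 : ℝ) := by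
          simp only [mem_Ioo, not_and, not_lt] at hs
          simpa using hs hs0
        rw [dampedKernel, indicator_of_notMem this, mul_zero]
      · have : s ∉ Ioo 0 T := fun h => hs0 h.1
        rw [hF, indicator_of_notMem this, zero_mul]
  have hsplit : ∀ t ∈ Ioo 0 T, ((‖d t * f t‖ ^ 2 : ℝ) : ℂ)
      = -(μ * Complex.I) * ((starRingEnd ℂ) (F t) *
        (F ⋆[ContinuousLinearMap.mul ℂ ℂ] dampedKernel β ε) t)
        + (starRingEnd ℂ) (d t * f t) * (d t * h t) := by
    intro t ht
    rw [hconv t ht, hF, indicator_of_mem ht]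
    have : ((‖d t * f t‖ ^ 2 : ℝ) : ℂ) = (starRingEnd ℂ) (d t * f t) * (d t * f t) := by
      rw [mul_comm ((starRingEnd ℂ) _), Complex.mul_conj, Complex.normSq_eq_norm_sq]
    rw [this]
    nth_rewrite 2 [heq t ht]
    ring
  have toIoo : ∀ g : ℝ → ℂ, (∀ t, t ∉ Ioo 0 T → g t = 0) → ∫ t, g t = ∫ t in Ioo 0 T, g t := by
    intro g hg
    rw [setIntegral_eq_integral_of_forall_compl_eq_zero]
    exact fun x hx => hg x hx
  have G1 : Integrable (fun t => (starRingEnd ℂ) (F t) *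
        (F ⋆[ContinuousLinearMap.mul ℂ ℂ] dampedKernel β ε) t) := by
    have := F1.integrable_convolution (ContinuousLinearMap.mul ℂ ℂ)
      (integrable_dampedKernel hβ0 hε0)
    refine this.bdd_mul (c := max B 0) ?_ ?_
    · exact (Complex.continuous_conj.comp_aestronglyMeasurable F1.1)
    · exact Filter.Eventually.of_forall fun t => by simpa using FB t
  set X := ∫ t in Ioo 0 T, ‖d t * f t‖ ^ 2 with hX
  set R := ∫ t in Ioo 0 T, (starRingEnd ℂ) (d t * f t) * (d t * h t) with hR
  have hRint : IntegrableOn (fun t => (starRingEnd ℂ) (d t * f t) * (d t * h t)) (Ioo 0 T) := by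
    refine ContinuousOn.integrableOn_Icc ?_ |>.mono_set Ioo_subset_Icc_self
    exact (Complex.continuous_conj.comp_continuousOn hdf).mul hdh
  have hXQ : (X : ℂ) = -(μ * Complex.I) * Q + R := by
    rw [hX, ← integral_complex_ofReal, setIntegral_congr_fun measurableSet_Ioo hsplit,
      integral_add (G1.integrableOn.const_mul _) hRint, integral_const_mul, hQ,
      toIoo _ (fun t ht => by rw [hF, indicator_of_notMem ht]; simp)]
  have hXf : IntegrableOn (fun t => ‖d t * f t‖ ^ 2) (Ioo 0 T) :=
    (hdf.norm.pow 2).integrableOn_Icc.mono_set Ioo_subset_Icc_self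
  have hYf : IntegrableOn (fun t => ‖d t * h t‖ ^ 2) (Ioo 0 T) :=
    (hdh.norm.pow 2).integrableOn_Icc.mono_set Ioo_subset_Icc_self
  set Y := ∫ t in Ioo 0 T, ‖d t * h t‖ ^ 2 with hY
  -- Young's inequality, weighted so that half of X cos κ can be absorbed below.
  have hRb : ‖R‖ ≤ Real.cos κ / 2 * X + (2 * Real.cos κ)⁻¹ * Y := by
    rw [hX, hY, ← integral_const_mul, ← integral_const_mul,
      ← integral_add (hXf.const_mul _) (hYf.const_mul _)]
    refine (norm_integral_le_integral_norm _).trans ?_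
    refine integral_mono hRint.norm ((hXf.const_mul _).add (hYf.const_mul _)) fun t => ?_
    simp only [norm_mul, RCLike.norm_conj]
    set a := ‖d t‖ * ‖f t‖
    set b := ‖d t‖ * ‖h t‖
    have : Real.cos κ / 2 * a ^ 2 + (2 * Real.cos κ)⁻¹ * b ^ 2 - a * b
        = (2 * Real.cos κ)⁻¹ * (Real.cos κ * a - b) ^ 2 := by
      field_simp; ring
    have h2 : 0 ≤ (2 * Real.cos κ)⁻¹ * (Real.cos κ * a - b) ^ 2 := by positivity
    linarith
  -- Rotate X = −iμQ + R by e^(−iκ) and take real parts: the Q term contributes μ Im(e^(−iκ) Q) ≤ 0,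
  -- whatever the size of μ.
  have hkey : X * Real.cos κ ≤ ‖R‖ := by
    have e : (Complex.exp (-(κ : ℝ) * Complex.I) * (X : ℂ)).re
        = μ * (Complex.exp (-(κ : ℝ) * Complex.I) * Q).im
          + (Complex.exp (-(κ : ℝ) * Complex.I) * R).re := by
      rw [hXQ]
      simp only [Complex.mul_re, Complex.add_re, Complex.neg_re, Complex.neg_im, Complex.mul_im,
        Complex.add_im, Complex.ofReal_re, Complex.ofReal_im, Complex.I_re, Complex.I_im]
      ring
    have e1 : (Complex.exp (-(κ : ℝ) * Complex.I) * (X : ℂ)).re = X * Real.cos κ := by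
      rw [Complex.re_mul_ofReal, ← Complex.ofReal_neg, Complex.exp_ofReal_mul_I_re, Real.cos_neg,
        mul_comm]
    have e2 : (Complex.exp (-(κ : ℝ) * Complex.I) * R).re ≤ ‖R‖ := by
      refine (Complex.re_le_norm _).trans ?_
      rw [norm_mul, ← Complex.ofReal_neg, Complex.norm_exp_ofReal_mul_I, one_mul]
    rw [← e1, e]
    have := mul_nonpos_of_nonneg_of_nonpos hμ hsec
    linarith
  have hXY : X ≤ Y / Real.cos κ ^ 2 := by
    have : X * Real.cos κ / 2 ≤ (2 * Real.cos κ)⁻¹ * Y := by linarith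
    rw [le_div_iff₀ (by positivity)]
    have h3 := mul_le_mul_of_nonneg_left this (by positivity : 0 ≤ 2 * Real.cos κ)
    rw [← mul_assoc, mul_inv_cancel₀ (by positivity)] at h3
    nlinarith
  have ioo : ∀ g : ℝ → ℝ, ∫ t in (0 : ℝ)..T, g t = ∫ t in Ioo 0 T, g t := fun g => by
    rw [intervalIntegral.integral_of_le hT.le, integral_Ioc_eq_integral_Ioo]
  have hfX : ∫ t in (0 : ℝ)..T, ‖f t‖ ^ 2 ≤ Real.exp 2 * X := by
    rw [ioo, hX, ← integral_const_mul]
    refine setIntegral_mono_on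
      ((hf.norm.pow 2).integrableOn_Icc.mono_set Ioo_subset_Icc_self) (hXf.const_mul _)
      measurableSet_Ioo fun t ht => ?_
    rw [norm_mul, mul_pow, ← mul_assoc, dnorm, sq (Real.exp _), ← Real.exp_add, ← Real.exp_add]
    refine le_mul_of_one_le_left (by positivity) (Real.one_le_exp ?_)
    have : ε * t ≤ 1 := by
      rw [hε, inv_mul_le_iff₀ hT]; linarith [ht.2]
    linarith
  have hhY : Y ≤ ∫ t in (0 : ℝ)..T, ‖h t‖ ^ 2 := by
    rw [ioo, hY]
    refine setIntegral_mono_on hYf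
      ((hh.norm.pow 2).integrableOn_Icc.mono_set Ioo_subset_Icc_self)
      measurableSet_Ioo fun t ht => ?_
    rw [norm_mul, mul_pow, dnorm]
    refine mul_le_of_le_one_left (by positivity) ?_
    have : Real.exp (-(ε * t)) ≤ 1 := Real.exp_le_one_iff.2 (by
      have := mul_pos hε0 ht.1; linarith)
    exact pow_le_one₀ (Real.exp_pos _).le this
  calc _ ≤ Real.exp 2 * X := hfX
    _ ≤ Real.exp 2 * (Y / Real.cos κ ^ 2) := by gcongr
    _ = Real.exp 2 / Real.cos κ ^ 2 * Y := by ring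
    _ ≤ _ := by gcongr

end Sector

section PowerSeries

/-! ### Fractional power series and Mittag-Leffler functions -/

/-- The beta integral, in the form `I^γ ω_ν = ω_{ν + γ}`. -/
theorem integral_omega_mul_rpow {γ ν t : ℝ} (hγ : 0 < γ) (hν : 0 < ν) (ht : 0 < t) :
    ∫ s in (0 : ℝ)..t, omega γ (t - s) * s ^ (ν - 1)
      = Real.Gamma ν / Real.Gamma (ν + γ) * t ^ (ν + γ - 1) := by
  have h := Complex.betaIntegral_scaled (ν : ℂ) (γ : ℂ) ht
  rw [Complex.betaIntegral_eq_Gamma_mul_div _ _ (by simpa using hν) (by simpa using hγ)] at h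
  have e : ∫ x in (0 : ℝ)..t, (x : ℂ) ^ ((ν : ℂ) - 1) * ((t : ℂ) - x) ^ ((γ : ℂ) - 1)
      = ((∫ x in (0 : ℝ)..t, x ^ (ν - 1) * (t - x) ^ (γ - 1) : ℝ) : ℂ) := by
    rw [← intervalIntegral.integral_ofReal]
    refine intervalIntegral.integral_congr fun x hx => ?_
    rw [uIcc_of_le ht.le] at hx
    push_cast
    rw [Complex.ofReal_cpow hx.1, Complex.ofReal_cpow (by linarith [hx.2])]
    push_cast
    rfl
  rw [e, show (t : ℂ) ^ ((ν : ℂ) + γ - 1) = ((t ^ (ν + γ - 1) : ℝ) : ℂ) by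
    rw [Complex.ofReal_cpow ht.le]; push_cast; rfl, ← Complex.ofReal_add,
    Complex.Gamma_ofReal, Complex.Gamma_ofReal, Complex.Gamma_ofReal] at h
  have h' : ∫ x in (0 : ℝ)..t, x ^ (ν - 1) * (t - x) ^ (γ - 1)
      = t ^ (ν + γ - 1) * (Real.Gamma ν * Real.Gamma γ / Real.Gamma (ν + γ)) := by
    exact_mod_cast h
  have hΓ := (Real.Gamma_pos_of_pos hγ).ne'
  calc ∫ s in (0 : ℝ)..t, omega γ (t - s) * s ^ (ν - 1)
      = ∫ s in (0 : ℝ)..t, (Real.Gamma γ)⁻¹ * (s ^ (ν - 1) * (t - s) ^ (γ - 1)) := by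
        congr 1; ext s; unfold omega; ring
    _ = _ := by
        rw [intervalIntegral.integral_const_mul, h']; field_simp

/-- The integral has just been computed and is nonzero, while a non-integrable function has integral
0 by convention. -/
theorem intervalIntegrable_omega_mul_rpow {γ ν t : ℝ} (hγ : 0 < γ) (hν : 0 < ν) (ht : 0 < t) :
    IntervalIntegrable (fun s => omega γ (t - s) * s ^ (ν - 1)) volume 0 t := by
  apply intervalIntegral.intervalIntegrable_of_integral_ne_zero
  rw [integral_omega_mul_rpow hγ hν ht]
  have := Real.Gamma_pos_of_pos hν
  have := Real.Gamma_pos_of_pos (add_pos hν hγ)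
  have := Real.rpow_pos_of_pos ht (ν + γ - 1)
  positivity

theorem omega_nonneg {γ t : ℝ} (hγ : 0 < γ) (ht : 0 ≤ t) : 0 ≤ omega γ t :=
  div_nonneg (Real.rpow_nonneg ht _) (Real.Gamma_pos_of_pos hγ).le

/-- Super-exponentially decaying coefficients, i.e. those of an entire function. -/
def EntireCoeff (a : ℕ → ℂ) : Prop := ∀ R : ℝ, 0 < R → ∃ C, ∀ k, ‖a k‖ * R ^ k ≤ C

/-- Weights of at most exponential growth. -/
def ExpGrowth (b : ℕ → ℝ) : Prop := ∃ A, ∀ k, |b k| ≤ A * 2 ^ k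

theorem EntireCoeff.mul_growth {a : ℕ → ℂ} {b : ℕ → ℝ} (ha : EntireCoeff a) (hb : ExpGrowth b) :
    EntireCoeff fun k => (b k : ℂ) * a k := by
  intro R hR
  obtain ⟨A, hA⟩ := hb
  obtain ⟨C, hC⟩ := ha (2 * R) (by positivity)
  have hA0 : 0 ≤ A := by simpa using (abs_nonneg _).trans (hA 0)
  refine ⟨A * C, fun k => ?_⟩
  rw [norm_mul, Complex.norm_real, Real.norm_eq_abs]
  calc |b k| * ‖a k‖ * R ^ k ≤ (A * 2 ^ k) * ‖a k‖ * R ^ k := by gcongr; exact hA k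
    _ = A * (‖a k‖ * (2 * R) ^ k) := by rw [mul_pow]; ring
    _ ≤ A * C := by gcongr; exact hC k

theorem EntireCoeff.summable {a : ℕ → ℂ} (ha : EntireCoeff a) {R : ℝ} (hR : 0 ≤ R) :
    Summable fun k => ‖a k‖ * R ^ k := by
  obtain ⟨C, hC⟩ := ha (2 * (R + 1)) (by positivity)
  have hs : Summable fun k : ℕ => C * (1 / 2 : ℝ) ^ k :=
    (summable_geometric_of_lt_one (by norm_num) (by norm_num)).mul_left C
  refine Summable.of_nonneg_of_le (fun k => by positivity) (fun k => ?_) hs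
  calc ‖a k‖ * R ^ k ≤ ‖a k‖ * (R + 1) ^ k := by gcongr; linarith
    _ = ‖a k‖ * (2 * (R + 1)) ^ k * (1 / 2 : ℝ) ^ k := by
        rw [mul_assoc, ← mul_pow]; congr 2; ring
    _ ≤ _ := by gcongr; exact hC k

theorem expGrowth_eval (p : Polynomial ℝ) : ExpGrowth fun k => p.eval (k : ℝ) := by
  induction p using Polynomial.induction_on' with
  | add p q hp hq =>
    obtain ⟨A, hA⟩ := hp
    obtain ⟨B, hB⟩ := hq
    refine ⟨A + B, fun k => ?_⟩
    simp only [Polynomial.eval_add]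
    rw [add_mul]
    exact (abs_add_le _ _).trans (add_le_add (hA k) (hB k))
  | monomial n c =>
    have h := isLittleO_pow_const_const_pow_of_one_lt (R := ℝ) n (r := 2) one_lt_two
    obtain ⟨A, -, hA⟩ := Asymptotics.bound_of_isBigO_nat_atTop h.isBigO
    refine ⟨|c| * A, fun k => ?_⟩
    have h1 := hA (x := k) (by positivity)
    rw [Real.norm_eq_abs, Real.norm_of_nonneg (by positivity)] at h1
    simp only [Polynomial.eval_monomial, abs_mul]
    rw [mul_assoc]
    gcongr

/-- The fractional power series `∑ a_k t ^ (β k + ν - 1)`. -/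
def powSeries (β ν : ℝ) (a : ℕ → ℂ) (t : ℝ) : ℂ := ∑' k : ℕ, a k * ((t ^ (β * k + ν - 1) : ℝ) : ℂ)

theorem rpow_term_eq {β ν t : ℝ} (ht : 0 < t) (k : ℕ) :
    t ^ (β * k + ν - 1) = t ^ (ν - 1) * (t ^ β) ^ k := by
  rw [← Real.rpow_mul_natCast ht.le, ← Real.rpow_add ht]; congr 1; ring

theorem rpow_term_eq_of_nonneg {β ν t : ℝ} (hβ : 0 ≤ β) (hν : 1 ≤ ν) (ht : 0 ≤ t) (k : ℕ) :
    t ^ (β * k + ν - 1) = t ^ (ν - 1) * (t ^ β) ^ k := by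
  rw [← Real.rpow_mul_natCast ht, ← Real.rpow_add_of_nonneg ht (by linarith) (by positivity)]
  congr 1; ring

theorem summable_powSeries {β ν t : ℝ} {a : ℕ → ℂ} (ha : EntireCoeff a) (ht : 0 < t) :
    Summable fun k : ℕ => ‖a k * ((t ^ (β * k + ν - 1) : ℝ) : ℂ)‖ := by
  refine ((ha.summable (Real.rpow_nonneg ht.le β)).mul_left (t ^ (ν - 1))).congr fun k => ?_
  rw [norm_mul, Complex.norm_real, rpow_term_eq ht, Real.norm_of_nonneg (by positivity)]
  ring

theorem continuousOn_powSeries {β ν T : ℝ} {a : ℕ → ℂ} (ha : EntireCoeff a) (hβ : 0 ≤ β)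
    (hν : 1 ≤ ν) (hT : 0 ≤ T) : ContinuousOn (powSeries β ν a) (Icc 0 T) := by
  refine continuousOn_tsum (u := fun k => T ^ (ν - 1) * (‖a k‖ * (T ^ β) ^ k)) (fun k => ?_)
    ((ha.summable (Real.rpow_nonneg hT β)).mul_left _) fun k t ht => ?_
  · refine ContinuousOn.mul continuousOn_const ?_
    refine Complex.continuous_ofReal.comp_continuousOn (Continuous.continuousOn ?_)
    exact Real.continuous_rpow_const (by
      have : 0 ≤ β * k := by positivity
      linarith)
  · have ht0 : 0 ≤ t := ht.1
    rw [norm_mul, Complex.norm_real, rpow_term_eq_of_nonneg hβ hν ht.1,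
      Real.norm_of_nonneg (by positivity)]
    calc ‖a k‖ * (t ^ (ν - 1) * (t ^ β) ^ k) = t ^ (ν - 1) * (‖a k‖ * (t ^ β) ^ k) := by ring
      _ ≤ T ^ (ν - 1) * (‖a k‖ * (T ^ β) ^ k) := by
        have h1 := Real.rpow_le_rpow ht.1 ht.2 hβ
        have h2 := Real.rpow_le_rpow ht.1 ht.2 (by linarith : 0 ≤ ν - 1)
        gcongr

theorem expGrowth_linear (β c : ℝ) : ExpGrowth fun k : ℕ => β * k + c := by
  have h := expGrowth_eval (Polynomial.C β * Polynomial.X + Polynomial.C c)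
  simpa using h

theorem hasDerivAt_powSeries {β ν t : ℝ} {a : ℕ → ℂ} (ha : EntireCoeff a) (hβ : 0 ≤ β)
    (ht : 0 < t) : HasDerivAt (powSeries β ν a)
      (powSeries β (ν - 1) (fun k => ((β * k + (ν - 1) : ℝ) : ℂ) * a k) t) t := by
  have hb := ha.mul_growth (expGrowth_linear β (ν - 1))
  set b : ℕ → ℂ := fun k => ((β * k + (ν - 1) : ℝ) : ℂ) * a k with hbdef
  -- The exponent may have either sign, so the supremum over (t/2, 2t) sits at one end or the other.
  set M := max ((t / 2) ^ (ν - 1 - 1)) ((2 * t) ^ (ν - 1 - 1)) with hM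
  have hS := (hb.summable (Real.rpow_nonneg (by positivity : 0 ≤ 2 * t) β)).mul_left M
  have key := hasDerivAt_tsum_of_isPreconnected
    (g := fun (k : ℕ) (y : ℝ) => a k * ((y ^ (β * k + ν - 1) : ℝ) : ℂ))
    (g' := fun (k : ℕ) (y : ℝ) => b k * ((y ^ (β * k + (ν - 1) - 1) : ℝ) : ℂ))
    hS (t := Ioo (t / 2) (2 * t)) (y₀ := t) (y := t) isOpen_Ioo
    isPreconnected_Ioo (fun k y hy => ?_) (fun k y hy => ?_) ⟨by linarith, by linarith⟩
    (summable_powSeries ha ht).of_norm ⟨by linarith, by linarith⟩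
  · exact key
  · have hy0 : 0 < y := lt_trans (by positivity) hy.1
    have h1 := (Real.hasDerivAt_rpow_const (x := y) (p := β * k + ν - 1) (Or.inl hy0.ne')).ofReal_comp
    have h2 := h1.const_mul (a k)
    refine h2.congr_deriv ?_
    rw [hbdef, show β * (k : ℝ) + (ν - 1) - 1 = β * k + ν - 1 - 1 by ring]
    push_cast
    ring
  · have hy0 : 0 < y := lt_trans (by positivity) hy.1
    rw [norm_mul, Complex.norm_real, rpow_term_eq hy0, Real.norm_of_nonneg (by positivity)]
    have h1 : y ^ (ν - 1 - 1) ≤ M := by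
      rcases le_total 0 (ν - 1 - 1) with h | h
      · exact (Real.rpow_le_rpow hy0.le hy.2.le h).trans (le_max_right _ _)
      · exact (Real.rpow_le_rpow_of_nonpos (by positivity) hy.1.le h).trans (le_max_left _ _)
    have h2 := Real.rpow_le_rpow hy0.le hy.2.le hβ
    calc ‖b k‖ * (y ^ (ν - 1 - 1) * (y ^ β) ^ k) = y ^ (ν - 1 - 1) * (‖b k‖ * (y ^ β) ^ k) := by ring
      _ ≤ M * (‖b k‖ * ((2 * t) ^ β) ^ k) := by gcongr

theorem fracInt_powSeries {β γ ν t : ℝ} {a : ℕ → ℂ} (ha : EntireCoeff a) (hβ : 0 ≤ β)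
    (hγ : 0 < γ) (hν : 0 < ν) (ht : 0 < t) :
    fracInt γ (powSeries β ν a) t = powSeries β (ν + γ)
      (fun k => ((Real.Gamma (β * k + ν) / Real.Gamma (β * k + ν + γ) : ℝ) : ℂ) * a k) t := by
  have hint : ∀ k : ℕ, IntervalIntegrable
      (fun s => omega γ (t - s) * s ^ (β * k + ν - 1)) volume 0 t := fun k => by
    have h := intervalIntegrable_omega_mul_rpow hγ (ν := β * k + ν) (by positivity) ht
    exact h
  set F : ℕ → ℝ → ℂ := fun k s => a k * ((omega γ (t - s) * s ^ (β * k + ν - 1) : ℝ) : ℂ) with hF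
  have hFi : ∀ k, Integrable (F k) (volume.restrict (Ioc 0 t)) := fun k =>
    (((intervalIntegrable_iff_integrableOn_Ioc_of_le ht.le).1 (hint k)).ofReal (𝕜 := ℂ)).const_mul _
  have hnorm : ∀ k, ∫ s in Ioc 0 t, ‖F k s‖ ≤ (∫ s in Ioc 0 t, omega γ (t - s) * s ^ (ν - 1)) *
      (‖a k‖ * (t ^ β) ^ k) := fun k => by
    rw [← integral_mul_const]
    refine setIntegral_mono_on (hFi k).norm ?_ measurableSet_Ioc fun s hs => ?_
    · exact ((intervalIntegrable_iff_integrableOn_Ioc_of_le ht.le).1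
        (intervalIntegrable_omega_mul_rpow hγ hν ht)).mul_const _
    · have hs0 : 0 < s := hs.1
      have h0 : 0 ≤ omega γ (t - s) := omega_nonneg hγ (by linarith [hs.2])
      rw [hF, norm_mul, Complex.norm_real, rpow_term_eq hs0, Real.norm_of_nonneg (by positivity)]
      have h1 := Real.rpow_le_rpow hs0.le hs.2 hβ
      calc ‖a k‖ * (omega γ (t - s) * (s ^ (ν - 1) * (s ^ β) ^ k))
          = omega γ (t - s) * s ^ (ν - 1) * (‖a k‖ * (s ^ β) ^ k) := by ring
        _ ≤ _ := by gcongr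
  have hsum : Summable fun k => ∫ s in Ioc 0 t, ‖F k s‖ :=
    Summable.of_nonneg_of_le (fun k => by positivity) hnorm
      ((ha.summable (Real.rpow_nonneg ht.le β)).mul_left _)
  have h := hasSum_integral_of_summable_integral_norm hFi hsum
  have e1 : ∫ s in Ioc 0 t, ∑' k, F k s = fracInt γ (powSeries β ν a) t := by
    rw [fracInt, intervalIntegral.integral_of_le ht.le]
    refine integral_congr_ae (Filter.Eventually.of_forall fun s => ?_)
    simp only [hF, powSeries, Complex.real_smul]
    rw [← tsum_mul_left]
    refine tsum_congr fun k => ?_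
    push_cast; ring
  rw [← e1, ← h.tsum_eq, powSeries]
  refine tsum_congr fun k => ?_
  rw [hF]
  simp only
  rw [integral_const_mul, integral_complex_ofReal, ← intervalIntegral.integral_of_le ht.le,
    integral_omega_mul_rpow hγ (by positivity) ht]
  push_cast
  rw [show β * (k : ℝ) + ν + γ - 1 = β * k + (ν + γ) - 1 by ring]
  ring

end PowerSeries

/-! ### Mittag-Leffler functions of imaginary argument -/

section MittagLeffler

/-- Restrict Euler's integral to t > X, where t^s ≥ X^s. As X is free, Γ outgrows every geometric
sequence, which makes the Mittag-Leffler coefficients entire. -/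
theorem rpow_mul_exp_neg_le_Gamma {X s : ℝ} (hX : 0 < X) (hs : 0 < s) :
    X ^ s * Real.exp (-X) ≤ Real.Gamma (s + 1) := by
  rw [Real.Gamma_eq_integral (by linarith), ← integral_exp_neg_Ioi, ← integral_const_mul]
  have hi := Real.GammaIntegral_convergent (s := s + 1) (by linarith)
  have hsub : Ioi X ⊆ Ioi (0 : ℝ) := Ioi_subset_Ioi hX.le
  calc ∫ t in Ioi X, X ^ s * Real.exp (-t)
      ≤ ∫ t in Ioi X, Real.exp (-t) * t ^ (s + 1 - 1) := by
        refine setIntegral_mono_on ((integrableOn_exp_neg_Ioi X).const_mul _) (hi.mono_set hsub)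
          measurableSet_Ioi fun t ht => ?_
        rw [mul_comm, add_sub_cancel_right]
        exact mul_le_mul_of_nonneg_left (Real.rpow_le_rpow hX.le (le_of_lt ht) hs.le)
          (Real.exp_pos _).le
    _ ≤ _ := by
        refine setIntegral_mono_set hi ?_ (Filter.Eventually.of_forall hsub)
        filter_upwards [ae_restrict_mem measurableSet_Ioi] with t ht
        have : 0 < t := ht
        simp only [Pi.zero_apply]
        positivity

/-- The coefficients of the Mittag-Leffler function `E_{β, ν}(-i μ z)`. -/
def mlCoeff (β μ ν : ℝ) (k : ℕ) : ℂ := (-(μ * Complex.I)) ^ k / (Real.Gamma (β * k + ν) : ℂ)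

theorem entireCoeff_mlCoeff {β ν : ℝ} (hβ : 0 < β) (hν : 0 < ν) (μ : ℝ) :
    EntireCoeff (mlCoeff β μ ν) := by
  -- The lower bound for Γ needs its argument shifted by one; the recursion of Γ removes the shift
  -- afterwards at the cost of a linear weight.
  have h1 : EntireCoeff fun k => (-(μ * Complex.I)) ^ k / (Real.Gamma (β * k + ν + 1) : ℂ) := by
    intro R hR
    -- Chosen so that X^(βk) dominates (|μ| R)^k.
    set X := (R * (|μ| + 1)) ^ (1 / β) with hX
    have hX0 : 0 < X := by positivity
    have hXβ : X ^ β = R * (|μ| + 1) := by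
      rw [hX, ← Real.rpow_mul (by positivity), one_div_mul_cancel hβ.ne', Real.rpow_one]
    refine ⟨(X ^ ν * Real.exp (-X))⁻¹, fun k => ?_⟩
    have hs : 0 < β * k + ν := by positivity
    have h := rpow_mul_exp_neg_le_Gamma hX0 hs
    have hG : 0 < Real.Gamma (β * k + ν + 1) := Real.Gamma_pos_of_pos (by linarith)
    rw [norm_div, norm_pow, norm_neg, norm_mul, Complex.norm_I, mul_one, Complex.norm_real,
      Complex.norm_real, Real.norm_eq_abs, Real.norm_of_nonneg hG.le, Real.rpow_add hX0,
      Real.rpow_mul_natCast hX0.le, hXβ] at *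
    rw [div_mul_eq_mul_div, div_le_iff₀ hG, ← mul_pow]
    have h3 : (|μ| * R) ^ k ≤ (R * (|μ| + 1)) ^ k :=
      pow_le_pow_left₀ (by positivity) (by nlinarith) k
    refine h3.trans ?_
    rw [inv_mul_eq_div, le_div_iff₀ (by positivity)]
    linarith
  have h2 := h1.mul_growth (expGrowth_linear β ν)
  convert h2 using 1
  ext k
  have hs : 0 < β * k + ν := by positivity
  rw [mlCoeff, Real.Gamma_add_one hs.ne']
  have : (Real.Gamma (β * k + ν) : ℂ) ≠ 0 := by exact_mod_cast (Real.Gamma_pos_of_pos hs).ne'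
  have : ((β * k + ν : ℝ) : ℂ) ≠ 0 := by exact_mod_cast hs.ne'
  rw [Complex.ofReal_mul]
  field_simp

/-- `t ^ (ν - 1) E_{β, ν}(-i μ t ^ β)`. -/
def ml (β μ ν t : ℝ) : ℂ := powSeries β ν (mlCoeff β μ ν) t

theorem fracInt_ml {β μ γ ν t : ℝ} (hβ : 0 < β) (hγ : 0 < γ) (hν : 0 < ν) (ht : 0 < t) :
    fracInt γ (ml β μ ν) t = ml β μ (ν + γ) t := by
  have h := fracInt_powSeries (entireCoeff_mlCoeff hβ hν μ) hβ.le hγ hν ht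
  refine h.trans ?_
  unfold ml
  congr 1
  ext k
  have : (Real.Gamma (β * k + ν) : ℂ) ≠ 0 := by
    exact_mod_cast (Real.Gamma_pos_of_pos (by positivity)).ne'
  rw [mlCoeff, mlCoeff, add_assoc]
  push_cast
  field_simp

theorem hasDerivAt_ml {β μ ν t : ℝ} (hβ : 0 < β) (hν : 0 < ν) (ht : 0 < t) :
    HasDerivAt (ml β μ (ν + 1)) (ml β μ ν t) t := by
  have h := hasDerivAt_powSeries (ν := ν + 1)
    (entireCoeff_mlCoeff hβ (by linarith : 0 < ν + 1) μ) hβ.le ht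
  refine h.congr_deriv ?_
  rw [ml, add_sub_cancel_right]
  congr 1
  ext k
  have hs : 0 < β * k + ν := by positivity
  have h1 : (Real.Gamma (β * k + ν) : ℂ) ≠ 0 := by exact_mod_cast (Real.Gamma_pos_of_pos hs).ne'
  have h2 : ((β * k + ν : ℝ) : ℂ) ≠ 0 := by exact_mod_cast hs.ne'
  rw [mlCoeff, mlCoeff, ← add_assoc, Real.Gamma_add_one hs.ne', Complex.ofReal_mul]
  field_simp

theorem ml_eq {β μ ν t : ℝ} (hβ : 0 < β) (hν : 0 < ν) (ht : 0 < t) :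
    ml β μ ν t = (omega ν t : ℂ) - μ * Complex.I * ml β μ (ν + β) t := by
  have hs := (summable_powSeries (β := β) (ν := ν) (entireCoeff_mlCoeff hβ hν μ) ht).of_norm
  rw [ml, powSeries, hs.tsum_eq_zero_add, ml, powSeries, ← tsum_mul_left,
    sub_eq_add_neg (omega ν t : ℂ), ← tsum_neg]
  congr 1
  · simp only [mlCoeff, omega]
    push_cast
    simp
    ring
  · refine tsum_congr fun k => ?_
    rw [mlCoeff, mlCoeff, pow_succ]
    have e : β * ((k + 1 : ℕ) : ℝ) + ν = β * k + (ν + β) := by push_cast; ring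
    rw [e]
    ring

theorem continuousOn_ml {β μ ν T : ℝ} (hβ : 0 < β) (hν : 1 ≤ ν) (hT : 0 ≤ T) :
    ContinuousOn (ml β μ ν) (Icc 0 T) :=
  continuousOn_powSeries (entireCoeff_mlCoeff hβ (by linarith) μ) hβ.le hν hT

theorem ml_zero {β μ ν : ℝ} (hβ : 0 < β) (hν : 1 ≤ ν) :
    ml β μ ν 0 = if ν = 1 then 1 else 0 := by
  rw [ml, powSeries, tsum_eq_single 0]
  · split_ifs with h
    · subst h; simp [mlCoeff]
    · have : ν - 1 ≠ 0 := sub_ne_zero.2 h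
      simp [Real.zero_rpow this]
  · intro k hk
    have : 0 < β * k := by
      have : (0 : ℝ) < k := by exact_mod_cast Nat.pos_of_ne_zero hk
      positivity
    rw [Real.zero_rpow (by linarith)]
    simp

/-! ### Polynomially weighted Mittag-Leffler series -/

open Polynomial in
/-- The series `∑ p(k) (-i μ)^k t^(β k) / Γ(β k + 1)`. -/
def wml (β μ : ℝ) (p : ℝ[X]) (t : ℝ) : ℂ :=
  powSeries β 1 (fun k => ((p.eval (k : ℝ) : ℝ) : ℂ) * mlCoeff β μ 1 k) t

open Polynomial

variable {β μ : ℝ}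

theorem entireCoeff_wml (hβ : 0 < β) (p : ℝ[X]) :
    EntireCoeff fun k => ((p.eval (k : ℝ) : ℝ) : ℂ) * mlCoeff β μ 1 k :=
  (entireCoeff_mlCoeff hβ one_pos μ).mul_growth (expGrowth_eval p)

theorem continuousOn_wml (hβ : 0 < β) (p : ℝ[X]) {T : ℝ} (hT : 0 ≤ T) :
    ContinuousOn (wml β μ p) (Icc 0 T) :=
  continuousOn_powSeries (entireCoeff_wml hβ p) hβ.le le_rfl hT

theorem wml_one (t : ℝ) : wml β μ 1 t = ml β μ 1 t := by
  simp [wml, ml]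

theorem wml_zero_poly (t : ℝ) : wml β μ 0 t = 0 := by
  simp [wml, powSeries]

theorem wml_sub (hβ : 0 < β) (p q : ℝ[X]) {t : ℝ} (ht : 0 < t) :
    wml β μ (p - q) t = wml β μ p t - wml β μ q t := by
  have h1 := (summable_powSeries (β := β) (ν := 1) (entireCoeff_wml (μ := μ) hβ p) ht).of_norm
  have h2 := (summable_powSeries (β := β) (ν := 1) (entireCoeff_wml (μ := μ) hβ q) ht).of_norm
  rw [wml, powSeries, wml, powSeries, wml, powSeries, ← h1.tsum_sub h2]
  refine tsum_congr fun k => ?_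
  rw [eval_sub]
  push_cast
  ring

theorem hasDerivAt_wml (hβ : 0 < β) (p : ℝ[X]) {t : ℝ} (ht : 0 < t) :
    HasDerivAt (wml β μ p) (wml β μ (C β * X * p) t / t) t := by
  have h := hasDerivAt_powSeries (ν := 1) (entireCoeff_wml (μ := μ) hβ p) hβ.le ht
  refine h.congr_deriv ?_
  rw [wml, powSeries, powSeries, ← tsum_div_const]
  refine tsum_congr fun k => ?_
  rw [show β * (k : ℝ) + (1 - 1) - 1 = β * k + 1 - 1 - 1 by ring, Real.rpow_sub_one ht.ne']
  simp only [eval_mul, eval_C, eval_X]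
  push_cast
  ring

/-- Integration of order `β` shifts the weight. -/
theorem neg_mul_fracInt_wml (hβ : 0 < β) (p : ℝ[X]) {t : ℝ} (ht : 0 < t) :
    -(μ * Complex.I) * fracInt β (wml β μ p) t
      = wml β μ (p.comp (X - 1)) t - (p.eval (-1) : ℝ) := by
  have hs := (summable_powSeries (β := β) (ν := 1)
    (entireCoeff_wml (μ := μ) hβ (p.comp (X - 1))) ht).of_norm
  have h := fracInt_powSeries (γ := β) (ν := 1) (entireCoeff_wml (μ := μ) hβ p) hβ.le hβ one_pos ht
  have h' : fracInt β (wml β μ p) t = _ := h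
  rw [h', wml, powSeries, powSeries, hs.tsum_eq_zero_add, ← tsum_mul_left]
  have e0 : ((eval ((0 : ℕ) : ℝ) (p.comp (X - 1)) : ℝ) : ℂ) * mlCoeff β μ 1 0 *
      ((t ^ (β * ((0 : ℕ) : ℝ) + 1 - 1) : ℝ) : ℂ) = (p.eval (-1) : ℝ) := by
    simp [mlCoeff, eval_comp]
  rw [e0, add_sub_cancel_left]
  refine tsum_congr fun k => ?_
  have hG : (Real.Gamma (β * k + 1) : ℂ) ≠ 0 := by
    exact_mod_cast (Real.Gamma_pos_of_pos (by positivity)).ne'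
  have e1 : β * ((k + 1 : ℕ) : ℝ) + 1 = β * k + 1 + β := by push_cast; ring
  have e2 : β * (k : ℝ) + (1 + β) = β * k + 1 + β := by ring
  rw [mlCoeff, mlCoeff, e1, e2, pow_succ]
  simp only [eval_comp, eval_sub, eval_X, eval_one]
  push_cast
  rw [add_sub_cancel_right]
  field_simp

/-- Induction on the degree. By the shift identity, `wml β μ p` solves the Volterra equation whose
right side is the series with weight p − p(X − 1), of smaller degree, plus the constant p(−1). The
stability constant does not depend on μ, hence neither does the bound. -/
theorem integral_norm_sq_wml_le (hβ0 : 0 < β) (hβ1 : β < 1) (p : ℝ[X]) :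
    ∃ C, 0 ≤ C ∧ ∀ μ, 0 ≤ μ → ∀ T, 0 < T → ∫ t in (0 : ℝ)..T, ‖wml β μ p t‖ ^ 2 ≤ C * T := by
  suffices H : ∀ n : ℕ, ∀ p : ℝ[X], p.degree < n →
      ∃ C, 0 ≤ C ∧ ∀ μ, 0 ≤ μ → ∀ T, 0 < T → ∫ t in (0 : ℝ)..T, ‖wml β μ p t‖ ^ 2 ≤ C * T from
    H (p.natDegree + 1) p (lt_of_le_of_lt degree_le_natDegree (by exact_mod_cast Nat.lt_succ_self _))
  intro n
  induction n with
  | zero =>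
    intro p hp
    have : p = 0 := by
      by_contra h
      rw [degree_eq_natDegree h] at hp
      exact absurd hp (not_lt.2 (by exact_mod_cast Nat.zero_le _))
    subst this
    exact ⟨0, le_rfl, fun μ _ T _ => by simp [wml_zero_poly]⟩
  | succ n ih =>
    intro p hp
    by_cases hp0 : p = 0
    · subst hp0
      exact ⟨0, le_rfl, fun μ _ T _ => by simp [wml_zero_poly]⟩
    have hX : (X - 1 : ℝ[X]) = X - C 1 := by simp
    have hnd : (X - 1 : ℝ[X]).natDegree = 1 := by rw [hX]; exact natDegree_X_sub_C 1
    -- A translate has the same degree and leading coefficient, so the leading terms cancel.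
    have hq : (p - p.comp (X - 1)).degree < n := by
      have hc0 : p.comp (X - 1) ≠ 0 := by
        intro h
        rw [comp_eq_zero_iff] at h
        rcases h with h | ⟨_, h⟩
        · exact hp0 h
        · have := congrArg natDegree h
          rw [hnd] at this
          simp at this
      have h1 : (p - p.comp (X - 1)).degree < p.degree := by
        refine degree_sub_lt_left ?_ hp0 ?_
        · rw [degree_eq_natDegree hp0, degree_eq_natDegree hc0, natDegree_comp, hnd, mul_one]
        · rw [leadingCoeff_comp (by rw [hnd]; norm_num), hX, leadingCoeff_X_sub_C, one_pow, mul_one]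
      refine lt_of_lt_of_le h1 ?_
      rw [degree_eq_natDegree hp0] at hp ⊢
      have : p.natDegree < n + 1 := by exact_mod_cast hp
      exact_mod_cast Nat.lt_succ_iff.1 this
    obtain ⟨C, hC0, hC⟩ := ih _ hq
    set c := p.eval (-1)
    set A := Real.exp 2 / Real.cos (β * Real.pi / 2) ^ 2
    have hA : 0 ≤ A := by positivity
    refine ⟨A * (2 * C + 2 * c ^ 2), by positivity, fun μ hμ T hT => ?_⟩
    have hq' := continuousOn_wml (μ := μ) hβ0 (p - p.comp (X - 1)) hT.le
    have h := integral_norm_sq_le_of_volterra (f := wml β μ p)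
      (h := fun t => wml β μ (p - p.comp (X - 1)) t + (c : ℝ)) hβ0 hβ1 hT hμ
      (continuousOn_wml hβ0 p hT.le) (hq'.add continuousOn_const) (fun t ht => by
        rw [neg_mul_fracInt_wml hβ0 p ht.1, wml_sub hβ0 _ _ ht.1]; ring)
    refine h.trans ?_
    rw [mul_assoc]
    refine mul_le_mul_of_nonneg_left ?_ hA
    have hi : IntervalIntegrable (fun t => 2 * ‖wml β μ (p - p.comp (X - 1)) t‖ ^ 2) volume 0 T :=
      ContinuousOn.intervalIntegrable (by
        rw [uIcc_of_le hT.le]; exact continuousOn_const.mul (hq'.norm.pow 2))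
    calc ∫ t in (0 : ℝ)..T, ‖wml β μ (p - p.comp (X - 1)) t + (c : ℝ)‖ ^ 2
        ≤ ∫ t in (0 : ℝ)..T, (2 * ‖wml β μ (p - p.comp (X - 1)) t‖ ^ 2 + 2 * c ^ 2) := by
          refine intervalIntegral.integral_mono_on hT.le ?_ (hi.add intervalIntegrable_const)
            fun t _ => ?_
          · refine ContinuousOn.intervalIntegrable ?_
            rw [uIcc_of_le hT.le]
            exact (hq'.add continuousOn_const).norm.pow 2
          · have h1 := norm_add_le (wml β μ (p - p.comp (X - 1)) t) ((c : ℝ) : ℂ)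
            rw [Complex.norm_real, Real.norm_eq_abs] at h1
            have h2 : 0 ≤ ‖wml β μ (p - p.comp (X - 1)) t + (c : ℝ)‖ := norm_nonneg _
            have h3 := sq_abs c
            nlinarith [sq_nonneg (‖wml β μ (p - p.comp (X - 1)) t‖ - |c|)]
      _ = 2 * (∫ t in (0 : ℝ)..T, ‖wml β μ (p - p.comp (X - 1)) t‖ ^ 2) + 2 * c ^ 2 * T := by
          rw [intervalIntegral.integral_add hi intervalIntegrable_const,
            intervalIntegral.integral_const_mul, intervalIntegral.integral_const, smul_eq_mul]
          ring
      _ ≤ 2 * (C * T) + 2 * c ^ 2 * T := by gcongr; exact hC μ hμ T hT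
      _ = _ := by ring

/-- Passage from L² to pointwise bounds: T|V(T)|² is the integral of (t|V|²)' = |V|² + 2⟨V, tV'⟩,
and tV' is again a weighted series, with weight βXp. Both mean squares are O(T), and no asymptotics
of Mittag-Leffler functions are needed. -/
theorem norm_wml_le (hβ0 : 0 < β) (hβ1 : β < 1) (p : ℝ[X]) :
    ∃ C, 0 ≤ C ∧ ∀ μ, 0 ≤ μ → ∀ t, 0 < t → ‖wml β μ p t‖ ≤ C := by
  obtain ⟨C, hC0, hC⟩ := integral_norm_sq_wml_le hβ0 hβ1 p
  obtain ⟨D, hD0, hD⟩ := integral_norm_sq_wml_le hβ0 hβ1 (Polynomial.C β * X * p)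
  refine ⟨Real.sqrt (2 * C + D), Real.sqrt_nonneg _, fun μ hμ T hT => ?_⟩
  set V := wml β μ p with hV
  set V' := wml β μ (Polynomial.C β * X * p) with hV'
  have cV : ContinuousOn V (Icc 0 T) := continuousOn_wml hβ0 p hT.le
  have cV' : ContinuousOn V' (Icc 0 T) := continuousOn_wml hβ0 _ hT.le
  have hint : ∀ g : ℝ → ℝ, ContinuousOn g (Icc 0 T) → IntervalIntegrable g volume 0 T :=
    fun g hg => ContinuousOn.intervalIntegrable (by rwa [uIcc_of_le hT.le])
  have cG : ContinuousOn (fun s => ‖V s‖ ^ 2 + 2 * inner ℝ (V s) (V' s)) (Icc 0 T) :=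
    (cV.norm.pow 2).add (continuousOn_const.mul (cV.inner (𝕜 := ℝ) cV'))
  have hftc : ∫ s in (0 : ℝ)..T, (‖V s‖ ^ 2 + 2 * inner ℝ (V s) (V' s))
      = T * ‖V T‖ ^ 2 - 0 * ‖V 0‖ ^ 2 := by
    refine intervalIntegral.integral_eq_sub_of_hasDerivAt_of_le hT.le
      (f := fun s => s * ‖V s‖ ^ 2) ?_ (fun s hs => ?_) (hint _ cG)
    · exact continuousOn_id.mul (cV.norm.pow 2)
    · have h1 := (hasDerivAt_wml (μ := μ) hβ0 p hs.1).norm_sq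
      have h2 := (hasDerivAt_id s).mul h1
      refine h2.congr_deriv ?_
      have e : wml β μ (Polynomial.C β * X * p) s / (s : ℂ) = s⁻¹ • V' s := by
        rw [Complex.real_smul]; push_cast; rw [div_eq_inv_mul]
      rw [e, inner_smul_right]
      have := hs.1.ne'
      rw [← hV]
      simp only [id, one_mul]
      field_simp
  have hle : T * ‖V T‖ ^ 2 ≤ (2 * C + D) * T := by
    rw [zero_mul, sub_zero] at hftc
    rw [← hftc]
    have i1 : IntervalIntegrable (fun s => ‖V s‖ ^ 2) volume 0 T := hint _ (cV.norm.pow 2)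
    have i2 : IntervalIntegrable (fun s => ‖V' s‖ ^ 2) volume 0 T := hint _ (cV'.norm.pow 2)
    calc _ ≤ ∫ s in (0 : ℝ)..T, (2 * ‖V s‖ ^ 2 + ‖V' s‖ ^ 2) := by
          refine intervalIntegral.integral_mono_on hT.le (hint _ cG) ((i1.const_mul 2).add i2)
            fun s _ => ?_
          have := real_inner_le_norm (V s) (V' s)
          nlinarith [sq_nonneg (‖V s‖ - ‖V' s‖)]
      _ = 2 * (∫ s in (0 : ℝ)..T, ‖V s‖ ^ 2) + ∫ s in (0 : ℝ)..T, ‖V' s‖ ^ 2 := by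
          rw [intervalIntegral.integral_add (i1.const_mul 2) i2,
            intervalIntegral.integral_const_mul]
      _ ≤ 2 * (C * T) + D * T := by
          gcongr
          · exact hC μ hμ T hT
          · exact hD μ hμ T hT
      _ = _ := by ring
  refine Real.le_sqrt_of_sq_le ?_
  have : ‖V T‖ ^ 2 * T ≤ (2 * C + D) * T := by linarith
  exact le_of_mul_le_mul_right this hT

theorem integral_omega_sub {γ t : ℝ} (hγ : 0 < γ) (ht : 0 < t) :
    ∫ s in (0 : ℝ)..t, omega γ (t - s) = t ^ γ / Real.Gamma (1 + γ) := by
  have h := integral_omega_mul_rpow hγ one_pos ht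
  simp only [sub_self, Real.rpow_zero, mul_one, Real.Gamma_one] at h
  rw [h, add_sub_cancel_left]
  ring

/-- The shift identity for the weight p(X + 1) writes the difference as −iμ I^β of a bounded
function, and I^β of a constant is of size t^β. -/
theorem norm_wml_sub_le (hβ0 : 0 < β) (hβ1 : β < 1) (p : ℝ[X]) :
    ∃ C, 0 ≤ C ∧ ∀ μ, 0 ≤ μ → ∀ t, 0 < t → ‖wml β μ p t - (p.eval 0 : ℝ)‖ ≤ C * (μ * t ^ β) := by
  obtain ⟨C, hC0, hC⟩ := norm_wml_le hβ0 hβ1 (p.comp (X + 1))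
  have hG : 0 < Real.Gamma (1 + β) := Real.Gamma_pos_of_pos (by linarith)
  refine ⟨C / Real.Gamma (1 + β), by positivity, fun μ hμ t ht => ?_⟩
  have h := neg_mul_fracInt_wml (μ := μ) hβ0 (p.comp (X + 1)) ht
  rw [comp_assoc, eval_comp] at h
  simp only [add_comp, X_comp, one_comp, sub_add_cancel, comp_X, eval_add, eval_X, eval_one,
    neg_add_cancel] at h
  rw [← h, norm_mul, norm_neg, norm_mul, Complex.norm_I, mul_one, Complex.norm_real,
    Real.norm_of_nonneg hμ]
  have hb : ‖fracInt β (wml β μ (p.comp (X + 1))) t‖ ≤ ∫ s in (0 : ℝ)..t, omega β (t - s) * C := by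
    rw [fracInt]
    have hi : IntervalIntegrable (fun s => omega β (t - s)) volume 0 t := by
      simpa using intervalIntegrable_omega_mul_rpow hβ0 one_pos ht
    refine intervalIntegral.norm_integral_le_of_norm_le ht.le
      (Filter.Eventually.of_forall fun s hs => ?_) (hi.mul_const C)
    have h0 := omega_nonneg hβ0 (sub_nonneg.2 hs.2)
    rw [norm_smul, Real.norm_of_nonneg h0]
    exact mul_le_mul_of_nonneg_left (hC μ hμ s hs.1) h0
  rw [intervalIntegral.integral_mul_const, integral_omega_sub hβ0 ht] at hb
  calc _ ≤ μ * (t ^ β / Real.Gamma (1 + β) * C) := by gcongr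
    _ = _ := by ring

end MittagLeffler

section Modes

/-! ### Composition of complementary fractional integrals -/

theorem integral_omega_mul_omega_compl {β r t : ℝ} (hβ0 : 0 < β) (hβ1 : β < 1) (hrt : r < t) :
    ∫ s in r..t, omega β (t - s) * omega (1 - β) (s - r) = 1 := by
  have h := integral_omega_mul_rpow (γ := β) (ν := 1 - β) (t := t - r) hβ0 (by linarith)
    (by linarith)
  have hG := (Real.Gamma_pos_of_pos (by linarith : 0 < 1 - β)).ne'
  have h1 := intervalIntegral.integral_comp_sub_right (a := r) (b := t)
    (fun s => omega β (t - r - s) * omega (1 - β) s) r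
  rw [sub_self] at h1
  have e : ∀ s, omega β (t - r - (s - r)) * omega (1 - β) (s - r)
      = omega β (t - s) * omega (1 - β) (s - r) := fun s => by congr 2; ring
  simp_rw [e] at h1
  rw [h1]
  have e2 : ∀ s, omega β (t - r - s) * omega (1 - β) s
      = (Real.Gamma (1 - β))⁻¹ * (omega β (t - r - s) * s ^ (1 - β - 1)) := fun s => by
    rw [omega, omega]; ring
  simp_rw [e2]
  rw [intervalIntegral.integral_const_mul, h]
  simp [hG]

theorem measurable_omega (γ : ℝ) : Measurable (omega γ) := by
  unfold omega; fun_prop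

/-- `I^β I^{1-β} = I^1`. -/
theorem fracInt_fracInt_compl {β t : ℝ} (hβ0 : 0 < β) (hβ1 : β < 1) (ht : 0 < t) {w : ℝ → ℂ}
    (hw : IntervalIntegrable w volume 0 t) :
    fracInt β (fracInt (1 - β) w) t = ∫ s in (0 : ℝ)..t, w s := by
  set m : Measure ℝ := volume.restrict (Ioc 0 t) with hm
  have hw' : Integrable w m := (intervalIntegrable_iff_integrableOn_Ioc_of_le ht.le).1 hw
  -- Fubini on the triangle r < s ≤ t. The kernel integrates to 1 in s for each r, which gives both
  -- the integrability on the product and the value.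
  set κ : ℝ → ℝ → ℝ := fun r s => (Ioc r t).indicator
    (fun s => omega β (t - s) * omega (1 - β) (s - r)) s with hκ
  have hκm : Measurable (fun p : ℝ × ℝ => κ p.2 p.1) := by
    have : (fun p : ℝ × ℝ => κ p.2 p.1) = ({p : ℝ × ℝ | p.2 < p.1 ∧ p.1 ≤ t}).indicator
        (fun p => omega β (t - p.1) * omega (1 - β) (p.1 - p.2)) := by
      ext p
      simp only [hκ, indicator, mem_Ioc, mem_ofPred_eq]
    rw [this]
    refine Measurable.indicator ?_ ?_
    · exact ((measurable_omega _).comp (by fun_prop)).mul ((measurable_omega _).comp (by fun_prop))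
    · exact (measurableSet_lt measurable_snd measurable_fst).inter
        (measurableSet_le measurable_fst measurable_const)
  have hκ0 : ∀ r s, 0 ≤ κ r s := fun r s => by
    refine indicator_nonneg (fun s hs => ?_) s
    exact mul_nonneg (omega_nonneg hβ0 (by linarith [hs.2]))
      (omega_nonneg (by linarith) (by linarith [hs.1]))
  have hκ1 : ∀ r ∈ Ioo 0 t, ∫ s, κ r s ∂m = 1 := fun r hr => by
    rw [hm, setIntegral_indicator measurableSet_Ioc, inter_eq_right.2 (Ioc_subset_Ioc_left hr.1.le),
      ← intervalIntegral.integral_of_le hr.2.le, integral_omega_mul_omega_compl hβ0 hβ1 hr.2]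
  have hκi : ∀ r ∈ Ioo 0 t, Integrable (κ r) m := fun r hr =>
    .of_integral_ne_zero (by rw [hκ1 r hr]; norm_num)
  have hae : ∀ᵐ r ∂m, r ∈ Ioo 0 t := by
    rw [hm, Measure.restrict_congr_set Ioo_ae_eq_Ioc.symm]
    exact ae_restrict_mem measurableSet_Ioo
  set f : ℝ × ℝ → ℂ := fun p => (κ p.2 p.1 : ℂ) * w p.2 with hf
  have hfm : AEStronglyMeasurable f (m.prod m) :=
    (Complex.measurable_ofReal.comp hκm).aestronglyMeasurable.mul hw'.1.comp_snd
  have hfi : Integrable f (m.prod m) := by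
    rw [integrable_prod_iff' hfm]
    constructor
    · filter_upwards [hae] with r hr
      exact ((hκi r hr).ofReal (𝕜 := ℂ)).mul_const (w r)
    · refine hw'.norm.congr ?_
      filter_upwards [hae] with r hr
      simp only [hf, norm_mul, Complex.norm_real]
      rw [integral_mul_const]
      have : ∀ s, ‖κ r s‖ = κ r s := fun s => Real.norm_of_nonneg (hκ0 r s)
      simp_rw [this]
      rw [hκ1 r hr, one_mul]
  have hswap := integral_integral_swap (f := fun s r => f (s, r)) hfi
  have hR : ∫ r, ∫ s, f (s, r) ∂m ∂m = ∫ s in (0 : ℝ)..t, w s := by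
    rw [intervalIntegral.integral_of_le ht.le]
    refine integral_congr_ae ?_
    filter_upwards [hae] with r hr
    simp only [hf]
    rw [integral_mul_const, integral_complex_ofReal, hκ1 r hr]
    simp
  have hL : ∫ s, ∫ r, f (s, r) ∂m ∂m = fracInt β (fracInt (1 - β) w) t := by
    rw [fracInt, intervalIntegral.integral_of_le ht.le]
    refine integral_congr_ae ?_
    filter_upwards [hae] with s hs
    have hsub : Ioo 0 s ⊆ Ioc 0 t := Ioo_subset_Ioc_self.trans (Ioc_subset_Ioc_right hs.2.le)
    have hind : ∀ G : ℝ → ℂ, ∫ r in Ioc 0 s, G r = ∫ r in Ioc 0 t, (Ioo 0 s).indicator G r :=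
      fun G => by
        rw [setIntegral_indicator measurableSet_Ioo, inter_eq_right.2 hsub,
          integral_Ioc_eq_integral_Ioo]
    rw [fracInt, intervalIntegral.integral_of_le hs.1.le, ← integral_smul, hind]
    refine setIntegral_congr_fun measurableSet_Ioc fun r hr => ?_
    simp only [hf, hκ]
    by_cases hrs : r < s
    · rw [indicator_of_mem (show s ∈ Ioc r t from ⟨hrs, hs.2.le⟩),
        indicator_of_mem (show r ∈ Ioo 0 s from ⟨hr.1, hrs⟩)]
      simp only [Complex.real_smul]
      push_cast
      ring
    · rw [indicator_of_notMem (fun h : s ∈ Ioc r t => hrs h.1),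
        indicator_of_notMem (fun h : r ∈ Ioo 0 s => hrs h.2)]
      simp
  rw [← hL, hswap, hR]

/-! ### The solution of a single mode -/

open Polynomial

variable {β : ℝ}

theorem wml_C_mul (c : ℝ) (p : ℝ[X]) (μ t : ℝ) : wml β μ (C c * p) t = c * wml β μ p t := by
  rw [wml, powSeries, wml, powSeries, ← tsum_mul_left]
  refine tsum_congr fun k => ?_
  rw [eval_mul, eval_C]
  push_cast
  ring

theorem hasDerivAt_wml_div_pow {μ : ℝ} (hβ : 0 < β) (p : ℝ[X]) (j : ℕ) {t : ℝ} (ht : 0 < t) :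
    HasDerivAt (fun t : ℝ => wml β μ p t / (t : ℂ) ^ j)
      (wml β μ ((C β * X - C (j : ℝ)) * p) t / (t : ℂ) ^ (j + 1)) t := by
  have h1 := hasDerivAt_wml (μ := μ) hβ p ht
  have h2 : HasDerivAt (fun t : ℝ => (t : ℂ) ^ j) (j * (t : ℂ) ^ (j - 1) * 1) t :=
    (hasDerivAt_id t).ofReal_comp.pow j
  have ht' : (t : ℂ) ≠ 0 := by exact_mod_cast ht.ne'
  refine (h1.div h2 (pow_ne_zero _ ht')).congr_deriv ?_
  rw [sub_mul, wml_sub hβ _ _ ht, wml_C_mul]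
  rcases j with _ | j
  · simp
  · simp only [Nat.add_sub_cancel]
    push_cast
    field_simp
    ring

/-- The weights of the derivatives of `E_β(-i μ t^β)`. -/
def derivWeight (β : ℝ) : ℕ → ℝ[X]
  | 0 => 1
  | j + 1 => (C β * X - C (j : ℝ)) * derivWeight β j

/-- Every derivative weight of positive order contains the factor βX. This vanishing is what yields
the gain μ t^β through `norm_wml_sub_le`. -/
theorem derivWeight_eval_zero (β : ℝ) (j : ℕ) : (derivWeight β (j + 1)).eval 0 = 0 := by
  induction j with
  | zero => simp [derivWeight]
  | succ j ih => rw [derivWeight, eval_mul, ih, mul_zero]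

/-- The solution `μ u + i z` of the mode of frequency `μ` with initial datum `a` and
source `g`. -/
def modeSol (β μ a g t : ℝ) : ℂ := μ * (a * ml β μ 1 t + g * ml β μ 2 t)

/-- The derivative of order `j + 1` of `modeSol`. -/
def modeSolDeriv (β μ a g : ℝ) (j : ℕ) (t : ℝ) : ℂ :=
  μ * (a * (wml β μ (derivWeight β (j + 1)) t / (t : ℂ) ^ (j + 1))
    + g * (wml β μ (derivWeight β j) t / (t : ℂ) ^ j))

theorem hasDerivAt_modeSolDeriv {μ a g t : ℝ} (hβ : 0 < β) (j : ℕ) (ht : 0 < t) :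
    HasDerivAt (modeSolDeriv β μ a g j) (modeSolDeriv β μ a g (j + 1) t) t := by
  have h1 := hasDerivAt_wml_div_pow (μ := μ) hβ (derivWeight β (j + 1)) (j + 1) ht
  have h2 := hasDerivAt_wml_div_pow (μ := μ) hβ (derivWeight β j) j ht
  exact ((h1.const_mul (a : ℂ)).add (h2.const_mul (g : ℂ))).const_mul (μ : ℂ)

theorem hasDerivAt_modeSol {μ a g t : ℝ} (hβ : 0 < β) (ht : 0 < t) :
    HasDerivAt (modeSol β μ a g) (modeSolDeriv β μ a g 0 t) t := by
  have h1 := hasDerivAt_wml_div_pow (μ := μ) hβ (derivWeight β 0) 0 ht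
  have h2 := hasDerivAt_ml (μ := μ) (ν := 1) hβ one_pos ht
  rw [one_add_one_eq_two] at h2
  have e : (fun t : ℝ => wml β μ (derivWeight β 0) t / (t : ℂ) ^ 0) = ml β μ 1 := by
    ext t; simp [derivWeight, wml_one]
  rw [e] at h1
  refine (((h1.const_mul (a : ℂ)).add (h2.const_mul (g : ℂ))).const_mul (μ : ℂ)).congr_deriv ?_
  simp [modeSolDeriv, derivWeight, wml_one]

theorem continuousOn_modeSol {μ a g T : ℝ} (hβ : 0 < β) (hT : 0 ≤ T) :
    ContinuousOn (modeSol β μ a g) (Icc 0 T) :=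
  continuousOn_const.mul ((continuousOn_const.mul (continuousOn_ml hβ le_rfl hT)).add
    (continuousOn_const.mul (continuousOn_ml hβ one_le_two hT)))

theorem modeSol_zero {μ a g : ℝ} (hβ : 0 < β) : modeSol β μ a g 0 = μ * a := by
  rw [modeSol, ml_zero hβ le_rfl, ml_zero hβ one_le_two]
  simp

/-- The weighted form of the derivative serves for bounds; this form, in plain Mittag-Leffler
functions, is the one to which `fracInt_ml` applies. -/
theorem modeSolDeriv_zero_eq {μ a g t : ℝ} (hβ : 0 < β) (ht : 0 < t) :
    modeSolDeriv β μ a g 0 t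
      = μ * (a * (-(μ * Complex.I) * ml β μ β t) + g * ml β μ 1 t) := by
  have h1 := hasDerivAt_wml_div_pow (μ := μ) hβ (derivWeight β 0) 0 ht
  have h2 : HasDerivAt (fun t : ℝ => wml β μ (derivWeight β 0) t / (t : ℂ) ^ 0)
      (-(μ * Complex.I) * ml β μ β t) t := by
    have h3 := ((hasDerivAt_ml (μ := μ) hβ hβ ht).const_mul (μ * Complex.I)).const_sub 1
    refine (h3.congr_of_eventuallyEq ?_).congr_deriv (by ring)
    filter_upwards [lt_mem_nhds ht] with s hs
    have := ml_eq (μ := μ) hβ one_pos hs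
    simp only [derivWeight, wml_one, pow_zero, div_one]
    rw [this, add_comm β 1]
    simp [omega]
  rw [modeSolDeriv, ← h1.unique h2]
  simp [derivWeight, wml_one]

theorem fracInt_congr {E : Type*} [NormedAddCommGroup E] [NormedSpace ℝ E] {γ t : ℝ} (ht : 0 ≤ t)
    {f g : ℝ → E} (h : ∀ s ∈ Ioo 0 t, f s = g s) : fracInt γ f t = fracInt γ g t := by
  rw [fracInt, fracInt]
  refine intervalIntegral.integral_congr_Ioo_of_le ht fun s hs => ?_
  simp only [h s hs]

theorem intervalIntegrable_omega_smul_powSeries {γ ν t : ℝ} {a : ℕ → ℂ} (ha : EntireCoeff a)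
    (hβ : 0 ≤ β) (hγ : 0 < γ) (hν : 0 < ν) (ht : 0 < t) :
    IntervalIntegrable (fun s => omega γ (t - s) • powSeries β ν a s) volume 0 t := by
  have hc : ContinuousOn (powSeries β 1 a) (Icc 0 t) := continuousOn_powSeries ha hβ le_rfl ht.le
  obtain ⟨B, hB⟩ := isCompact_Icc.exists_bound_of_continuousOn hc
  have h1 := intervalIntegrable_omega_mul_rpow hγ hν ht
  rw [intervalIntegrable_iff_integrableOn_Ioo_of_le ht.le] at h1 ⊢
  have e : ∀ s ∈ Ioo 0 t, omega γ (t - s) • powSeries β ν a s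
      = ((omega γ (t - s) * s ^ (ν - 1) : ℝ) : ℂ) * powSeries β 1 a s := fun s hs => by
    have e' : powSeries β ν a s = ((s ^ (ν - 1) : ℝ) : ℂ) * powSeries β 1 a s := by
      rw [powSeries, powSeries, ← tsum_mul_left]
      refine tsum_congr fun k => ?_
      rw [rpow_term_eq hs.1, rpow_term_eq (ν := 1) hs.1]
      simp
      ring
    rw [Complex.real_smul, Complex.ofReal_mul, mul_assoc, e']
  refine IntegrableOn.congr_fun ?_ (fun s hs => (e s hs).symm) measurableSet_Ioo
  refine Integrable.mul_bdd (c := B) (h1.ofReal (𝕜 := ℂ)) ?_ ?_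
  · exact (hc.mono (Ioo_subset_Icc_self : Ioo 0 t ⊆ Icc 0 t)).aestronglyMeasurable measurableSet_Ioo
  · filter_upwards [ae_restrict_mem measurableSet_Ioo] with s hs
    exact hB s (Ioo_subset_Icc_self hs)

theorem fracInt_lin_ml {μ γ ν₁ ν₂ t : ℝ} (b₁ b₂ : ℂ) (hβ : 0 < β) (hγ : 0 < γ) (h₁ : 0 < ν₁)
    (h₂ : 0 < ν₂) (ht : 0 < t) :
    fracInt γ (fun s => b₁ * ml β μ ν₁ s + b₂ * ml β μ ν₂ s) t
      = b₁ * ml β μ (ν₁ + γ) t + b₂ * ml β μ (ν₂ + γ) t := by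
  rw [← fracInt_ml hβ hγ h₁ ht, ← fracInt_ml hβ hγ h₂ ht, fracInt, fracInt, fracInt,
    ← intervalIntegral.integral_const_mul, ← intervalIntegral.integral_const_mul,
    ← intervalIntegral.integral_add]
  · congr 1
    ext s
    simp only [Complex.real_smul]
    ring
  · exact (intervalIntegrable_omega_smul_powSeries (entireCoeff_mlCoeff hβ h₁ μ) hβ.le hγ h₁
      ht).const_mul _
  · exact (intervalIntegrable_omega_smul_powSeries (entireCoeff_mlCoeff hβ h₂ μ) hβ.le hγ h₂
      ht).const_mul _

/-- The mode satisfies `∂_t^β W = -i μ W + μ g ω_{2-β}`. -/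
theorem fracInt_modeSolDeriv {μ a g t : ℝ} (hβ0 : 0 < β) (hβ1 : β < 1) (ht : 0 < t) :
    fracInt (1 - β) (modeSolDeriv β μ a g 0) t
      = -(μ * Complex.I) * modeSol β μ a g t + μ * g * (omega (2 - β) t : ℂ) := by
  have e : ∀ s ∈ Ioo 0 t, modeSolDeriv β μ a g 0 s
      = (μ * (a * (-(μ * Complex.I)))) * ml β μ β s + (μ * g) * ml β μ 1 s := fun s hs => by
    rw [modeSolDeriv_zero_eq hβ0 hs.1]; ring
  rw [fracInt_congr ht.le e, fracInt_lin_ml _ _ hβ0 (by linarith) hβ0 one_pos ht,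
    modeSol, add_sub_cancel, ml_eq hβ0 (by linarith : 0 < 1 + (1 - β)) ht,
    show 1 + (1 - β) + β = 2 by ring, show 1 + (1 - β) = 2 - β by ring]
  ring

/-- The Volterra equation of the mode. -/
theorem neg_mul_fracInt_modeSol {μ a g t : ℝ} (hβ : 0 < β) (ht : 0 < t) :
    -(μ * Complex.I) * fracInt β (modeSol β μ a g) t
      = modeSol β μ a g t - μ * (a + g * t) := by
  have e : ∀ s ∈ Ioo 0 t, modeSol β μ a g s
      = (μ * a : ℂ) * ml β μ 1 s + (μ * g) * ml β μ 2 s := fun s hs => by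
    rw [modeSol]; ring
  rw [fracInt_congr ht.le e, fracInt_lin_ml _ _ hβ hβ one_pos two_pos ht,
    modeSol, ml_eq (ν := 1) hβ one_pos ht, ml_eq (ν := 2) hβ two_pos ht]
  have h2 : Real.Gamma 2 = 1 := by simp
  simp only [omega, sub_self, Real.rpow_zero, Real.Gamma_one, h2]
  norm_num
  ring

end Modes

/-! ### Bounds and uniqueness for a single mode -/

section ModeEstimates

open Polynomial

variable {β : ℝ}

/-- The weight multiplying the datum a vanishes at 0 and so supplies a factor μ t^β, whence μ²|a|.
The source term is less singular by one power of t, of which t^β is kept and t^(1−β) is bounded by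
T^(1−β). -/
theorem exists_norm_modeSolDeriv_le (hβ0 : 0 < β) (hβ1 : β < 1) (T : ℝ) (j : ℕ) :
    ∃ C, 0 ≤ C ∧ ∀ μ a g : ℝ, 0 ≤ μ → ∀ t ∈ Ioc 0 T,
      ‖modeSolDeriv β μ a g j t‖ ≤ C * (μ ^ 2 * |a| + μ * |g|) * t ^ (β - (j + 1)) := by
  obtain ⟨C₁, h₁0, h₁⟩ := norm_wml_sub_le hβ0 hβ1 (derivWeight β (j + 1))
  obtain ⟨C₂, h₂0, h₂⟩ := norm_wml_le hβ0 hβ1 (derivWeight β j)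
  refine ⟨max C₁ (C₂ * T ^ (1 - β)), by positivity, fun μ a g hμ t ht => ?_⟩
  have ht0 : 0 < t := ht.1
  have e1 : t ^ (β - (j + 1)) = t ^ β / t ^ (j + 1) := by
    rw [Real.rpow_sub ht0, ← Real.rpow_natCast]; push_cast; rfl
  have b1 := h₁ μ hμ t ht0
  rw [derivWeight_eval_zero, Complex.ofReal_zero, sub_zero] at b1
  have b2 := h₂ μ hμ t ht0
  have b3 : C₂ * t ≤ C₂ * T ^ (1 - β) * t ^ β := by
    have : t = t ^ (1 - β) * t ^ β := by rw [← Real.rpow_add ht0]; simp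
    calc C₂ * t = C₂ * (t ^ (1 - β) * t ^ β) := by rw [← this]
      _ ≤ C₂ * (T ^ (1 - β) * t ^ β) := by
        have := Real.rpow_le_rpow ht0.le ht.2 (by linarith : 0 ≤ 1 - β)
        gcongr
      _ = _ := by ring
  rw [modeSolDeriv, norm_mul, Complex.norm_real, Real.norm_of_nonneg hμ, e1]
  set M := max C₁ (C₂ * T ^ (1 - β)) with hM
  have n1 : ‖(t : ℂ)‖ = t := by rw [Complex.norm_real, Real.norm_of_nonneg ht0.le]
  have a1 : ‖(a : ℂ) * (wml β μ (derivWeight β (j + 1)) t / (t : ℂ) ^ (j + 1))‖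
      ≤ |a| * (M * (μ * t ^ β) / t ^ (j + 1)) := by
    rw [norm_mul, Complex.norm_real, Real.norm_eq_abs, norm_div, norm_pow, n1]
    gcongr
    refine b1.trans ?_
    gcongr
    exact le_max_left _ _
  have a2 : ‖(g : ℂ) * (wml β μ (derivWeight β j) t / (t : ℂ) ^ j)‖
      ≤ |g| * (M * t ^ β / t ^ (j + 1)) := by
    rw [norm_mul, Complex.norm_real, Real.norm_eq_abs, norm_div, norm_pow, n1]
    refine mul_le_mul_of_nonneg_left ?_ (abs_nonneg _)
    rw [div_le_div_iff₀ (by positivity) (by positivity), pow_succ]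
    calc _ ≤ C₂ * (t ^ j * t) := by gcongr
      _ = C₂ * t * t ^ j := by ring
      _ ≤ C₂ * T ^ (1 - β) * t ^ β * t ^ j := by gcongr
      _ ≤ M * t ^ β * t ^ j := by gcongr; exact le_max_right _ _
  calc _ ≤ μ * (|a| * (M * (μ * t ^ β) / t ^ (j + 1)) + |g| * (M * t ^ β / t ^ (j + 1))) := by
        gcongr
        exact (norm_add_le _ _).trans (add_le_add a1 a2)
    _ = _ := by ring

theorem fracInt_omega_two_sub {t : ℝ} (hβ0 : 0 < β) (hβ1 : β < 1) (ht : 0 < t) :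
    ∫ s in (0 : ℝ)..t, omega β (t - s) * omega (2 - β) s = t := by
  have h := integral_omega_mul_rpow (γ := β) (ν := 2 - β) hβ0 (by linarith) ht
  have hG := (Real.Gamma_pos_of_pos (by linarith : 0 < 2 - β)).ne'
  have e : ∀ s, omega β (t - s) * omega (2 - β) s
      = (Real.Gamma (2 - β))⁻¹ * (omega β (t - s) * s ^ (2 - β - 1)) := fun s => by
    rw [omega, omega]; ring
  simp_rw [e]
  rw [intervalIntegral.integral_const_mul, h, sub_add_cancel]
  norm_num
  field_simp

theorem intervalIntegrable_omega_smul {γ t : ℝ} (hγ : 0 < γ) (ht : 0 < t) {f : ℝ → ℂ}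
    (hf : ContinuousOn f (Icc 0 t)) :
    IntervalIntegrable (fun s => omega γ (t - s) • f s) volume 0 t := by
  have h1 : IntervalIntegrable (fun s => omega γ (t - s)) volume 0 t := by
    simpa using intervalIntegrable_omega_mul_rpow hγ one_pos ht
  refine h1.smul_continuousOn ?_
  rwa [uIcc_of_le ht.le]

/-- A function satisfying the fractional differential equation of a mode is `modeSol`. -/
theorem eq_modeSol (hβ0 : 0 < β) (hβ1 : β < 1) {μ a g T : ℝ} (hμ : 0 ≤ μ) (hT : 0 < T)
    {W W₁ : ℝ → ℂ} (hW : ContinuousOn W (Icc 0 T)) (hd : ∀ t ∈ Ioo 0 T, HasDerivAt W (W₁ t) t)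
    (hi : IntegrableOn W₁ (Ioo 0 T)) (h0 : W 0 = μ * a)
    (heq : ∀ t ∈ Ioo 0 T, fracInt (1 - β) W₁ t
      = -(μ * Complex.I) * W t + μ * g * (omega (2 - β) t : ℂ)) :
    ∀ t ∈ Icc 0 T, W t = modeSol β μ a g t := by
  have hmc := continuousOn_modeSol (μ := μ) (a := a) (g := g) hβ0 hT.le
  set Y : ℝ → ℂ := fun t => W t - modeSol β μ a g t with hY
  have hYc : ContinuousOn Y (Icc 0 T) := hW.sub hmc
  -- Applying I^β and I^β I^(1−β) = I¹ turns the differential equation into a Volterra equation. The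
  -- difference of two solutions satisfies the homogeneous one, and the L² stability makes it
  -- vanish.
  have hvol : ∀ t ∈ Ioo 0 T, Y t = -(μ * Complex.I) * fracInt β Y t + (fun _ => 0) t := by
    intro t ht
    have hsub : Icc 0 t ⊆ Icc 0 T := Icc_subset_Icc_right ht.2.le
    have hi' : IntervalIntegrable W₁ volume 0 t := by
      rw [intervalIntegrable_iff_integrableOn_Ioo_of_le ht.1.le]
      exact hi.mono_set (Ioo_subset_Ioo_right ht.2.le)
    have hftc := intervalIntegral.integral_eq_sub_of_hasDerivAt_of_le ht.1.le (hW.mono hsub)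
      (fun s hs => hd s ⟨hs.1, hs.2.trans ht.2⟩) hi'
    rw [← fracInt_fracInt_compl hβ0 hβ1 ht.1 hi',
      fracInt_congr ht.1.le (fun s hs => heq s ⟨hs.1, hs.2.trans ht.2⟩), h0] at hftc
    have hsplit : fracInt β (fun s => -(μ * Complex.I) * W s + μ * g * (omega (2 - β) s : ℂ)) t
        = -(μ * Complex.I) * fracInt β W t + μ * g * t := by
      have i1 := intervalIntegrable_omega_smul hβ0 ht.1 (hW.mono hsub)
      have i2 : IntervalIntegrable (fun s => ((omega β (t - s) * omega (2 - β) s : ℝ) : ℂ))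
          volume 0 t := by
        have h : IntervalIntegrable (fun s => omega β (t - s) * omega (2 - β) s) volume 0 t := by
          apply intervalIntegral.intervalIntegrable_of_integral_ne_zero
          rw [fracInt_omega_two_sub hβ0 hβ1 ht.1]
          exact ht.1.ne'
        exact ⟨h.1.ofReal, h.2.ofReal⟩
      have e : ∀ s, omega β (t - s) • (-(μ * Complex.I) * W s + μ * g * (omega (2 - β) s : ℂ))
          = -(μ * Complex.I) * (omega β (t - s) • W s)
            + μ * g * ((omega β (t - s) * omega (2 - β) s : ℝ) : ℂ) := fun s => by
        simp only [Complex.real_smul]; push_cast; ring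
      rw [fracInt, fracInt]
      simp_rw [e]
      rw [intervalIntegral.integral_add (i1.const_mul _) (i2.const_mul _),
        intervalIntegral.integral_const_mul, intervalIntegral.integral_const_mul,
        intervalIntegral.integral_ofReal, fracInt_omega_two_sub hβ0 hβ1 ht.1]
    have hm := neg_mul_fracInt_modeSol (μ := μ) (a := a) (g := g) hβ0 ht.1
    have hYs : fracInt β Y t = fracInt β W t - fracInt β (modeSol β μ a g) t := by
      rw [fracInt, fracInt, fracInt, ← intervalIntegral.integral_sub
        (intervalIntegrable_omega_smul hβ0 ht.1 (hW.mono hsub))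
        (intervalIntegrable_omega_smul hβ0 ht.1 (hmc.mono hsub))]
      simp only [hY, smul_sub]
    rw [hsplit] at hftc
    rw [hYs, mul_sub, hm, hY]
    simp only
    linear_combination hftc.symm
  have hz := integral_norm_sq_le_of_volterra hβ0 hβ1 hT hμ hYc continuousOn_const hvol
  simp only [norm_zero, ne_eq, OfNat.ofNat_ne_zero, not_false_eq_true, zero_pow,
    intervalIntegral.integral_zero, mul_zero] at hz
  intro t ht
  by_contra hne
  have hpos : 0 < ∫ t in (0 : ℝ)..T, ‖Y t‖ ^ 2 := by
    refine intervalIntegral.integral_pos hT (hYc.norm.pow 2) (fun x _ => by positivity) ⟨t, ht, ?_⟩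
    have : Y t ≠ 0 := sub_ne_zero.2 hne
    positivity
  linarith

end ModeEstimates

/-! ### Graded meshes -/

section Mesh

variable {T r : ℝ} {N : ℕ}

theorem node_zero (hr : 1 ≤ r) : node T r N 0 = 0 := by
  simp [node, Real.zero_rpow (by linarith : r ≠ 0)]

theorem node_self (hN : 1 ≤ N) : node T r N N = T := by
  have : (N : ℝ) ≠ 0 := by positivity
  simp [node, div_self this]

theorem node_lt (hT : 0 < T) (hr : 1 ≤ r) (hN : 1 ≤ N) {j k : ℕ} (h : j < k) :
    node T r N j < node T r N k := by
  have hN' : (0 : ℝ) < N := by positivity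
  have h' : (j : ℝ) < k := by exact_mod_cast h
  unfold node
  gcongr

theorem node_le (hT : 0 < T) (hr : 1 ≤ r) (hN : 1 ≤ N) {j k : ℕ} (h : j ≤ k) :
    node T r N j ≤ node T r N k := by
  rcases h.eq_or_lt with rfl | h
  · exact le_rfl
  · exact (node_lt hT hr hN h).le

theorem node_pos (hT : 0 < T) (hN : 1 ≤ N) {k : ℕ} (hk : 1 ≤ k) : 0 < node T r N k := by
  have : (0 : ℝ) < N := by positivity
  have : (0 : ℝ) < k := by positivity
  unfold node
  positivity

theorem node_nonneg (hT : 0 < T) (k : ℕ) : 0 ≤ node T r N k := by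
  unfold node; positivity

theorem node_le_T (hT : 0 < T) (hr : 1 ≤ r) (hN : 1 ≤ N) {k : ℕ} (hk : k ≤ N) :
    node T r N k ≤ T := by
  have := node_le (T := T) (r := r) hT hr hN hk
  rwa [node_self hN] at this

theorem step_succ (k : ℕ) : step T r N (k + 1) = node T r N (k + 1) - node T r N k := rfl

theorem step_pos (hT : 0 < T) (hr : 1 ≤ r) (hN : 1 ≤ N) {k : ℕ} (hk : 1 ≤ k) :
    0 < step T r N k :=
  sub_pos.2 (node_lt hT hr hN (by omega))

theorem node_eq_mul (hN : 1 ≤ N) {k n : ℕ} (hn : 1 ≤ n) :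
    node T r N k = node T r N n * ((k : ℝ) / n) ^ r := by
  have h1 : (0 : ℝ) < N := by positivity
  have h2 : (0 : ℝ) < n := by positivity
  unfold node
  rw [mul_assoc, ← Real.mul_rpow (by positivity) (by positivity)]
  congr 2
  field_simp

/-- Midpoint convexity of x^r. The monotonicity of Alikhanov's kernel relies on growing steps. -/
theorem step_le_step_succ (hT : 0 < T) (hr : 1 ≤ r) (hN : 1 ≤ N) {k : ℕ} (hk : 1 ≤ k) :
    step T r N k ≤ step T r N (k + 1) := by
  obtain ⟨k, rfl⟩ := Nat.exists_eq_add_of_le' hk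
  have hN' : (0 : ℝ) < N := by positivity
  have h := (convexOn_rpow hr).2
    (show (k : ℝ) / N ∈ Ici (0 : ℝ) by simp only [mem_Ici]; positivity)
    (show ((k + 2 : ℕ) : ℝ) / N ∈ Ici (0 : ℝ) by simp only [mem_Ici]; positivity)
    (by norm_num : (0 : ℝ) ≤ 1 / 2) (by norm_num : (0 : ℝ) ≤ 1 / 2) (by norm_num)
  simp only [smul_eq_mul] at h
  rw [show (1 / 2 : ℝ) * (k / N) + 1 / 2 * (((k + 2 : ℕ) : ℝ) / N) = ((k + 1 : ℕ) : ℝ) / N by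
    push_cast; ring] at h
  rw [step_succ, step_succ, node, node, node]
  have := mul_le_mul_of_nonneg_left h hT.le
  linarith

/-- Bernoulli's inequality (1 − 1/k)^r ≥ 1 − r/k. -/
theorem step_le_mul_node_div (hT : 0 < T) (hr : 1 ≤ r) (hN : 1 ≤ N) {k : ℕ} (hk : 1 ≤ k) :
    step T r N k ≤ r * (node T r N k / k) := by
  have hk' : (1 : ℝ) ≤ k := by exact_mod_cast hk
  have hp := node_pos (r := r) hT hN hk
  have h := one_add_mul_self_le_rpow_one_add (s := -(1 / (k : ℝ))) (by
    rw [neg_le_neg_iff, div_le_one (by linarith)]; exact hk') hr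
  have e : ((k - 1 : ℕ) : ℝ) / k = 1 + -(1 / (k : ℝ)) := by
    rw [Nat.cast_sub hk]; field_simp; push_cast; ring
  rw [step, node_eq_mul hN (k := k - 1) hk, e]
  have := mul_le_mul_of_nonneg_left h hp.le
  have e2 : r * (node T r N k / k) = node T r N k - node T r N k * (1 + r * -(1 / (k : ℝ))) := by
    ring
  rw [e2]
  linarith

/-- From (1 − 1/k)^r ≤ 1 − 1/k: the latest step is at least the average of the k steps so far. -/
theorem node_le_mul_step (hT : 0 < T) (hr : 1 ≤ r) (hN : 1 ≤ N) {k : ℕ} (hk : 1 ≤ k) :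
    node T r N k ≤ k * step T r N k := by
  have hk' : (1 : ℝ) ≤ k := by exact_mod_cast hk
  have hp := node_pos (r := r) hT hN hk
  have e : ((k - 1 : ℕ) : ℝ) / k = 1 - 1 / (k : ℝ) := by
    rw [Nat.cast_sub hk]; field_simp; push_cast; ring
  have h1 : (0 : ℝ) ≤ 1 - 1 / (k : ℝ) := by
    rw [sub_nonneg, div_le_one (by linarith)]; exact hk'
  have h2 : (1 : ℝ) - 1 / (k : ℝ) ≤ 1 := by
    have : (0 : ℝ) ≤ 1 / k := by positivity
    linarith
  have h := Real.rpow_le_rpow_of_exponent_ge' h1 h2 zero_le_one hr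
  rw [Real.rpow_one] at h
  rw [step, node_eq_mul hN (k := k - 1) hk, e]
  have h3 := mul_le_mul_of_nonneg_left h hp.le
  have h4 : node T r N k / k ≤ node T r N k - node T r N k * (1 - 1 / (k : ℝ)) ^ r := by
    have : node T r N k * (1 - 1 / (k : ℝ)) = node T r N k - node T r N k / k := by ring
    linarith
  rwa [div_le_iff₀ (by linarith), mul_comm] at h4

theorem node_le_half (hT : 0 < T) (hr : 1 ≤ r) (hN : 1 ≤ N) {k n : ℕ} (hn : 1 ≤ n)
    (h : 2 * k ≤ n) : node T r N k ≤ node T r N n / 2 := by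
  have hn' : (0 : ℝ) < n := by positivity
  have h' : 2 * (k : ℝ) ≤ n := by exact_mod_cast h
  have h2 : (k : ℝ) / n ≤ 1 / 2 := by rw [div_le_div_iff₀ hn' two_pos]; linarith
  have h1 := Real.rpow_le_rpow_of_exponent_ge' (by positivity : (0 : ℝ) ≤ k / n) (by linarith)
    zero_le_one hr
  rw [Real.rpow_one] at h1
  rw [node_eq_mul hN hn]
  have hp := node_pos (r := r) hT hN hn
  nlinarith

theorem node_succ_le (hT : 0 < T) (hr : 1 ≤ r) (hN : 1 ≤ N) {k : ℕ} (hk : 1 ≤ k) :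
    node T r N (k + 1) ≤ 2 ^ r * node T r N k := by
  have hk' : (1 : ℝ) ≤ k := by exact_mod_cast hk
  have hp := node_pos (r := r) hT hN hk
  rw [node_eq_mul hN (k := k + 1) hk, mul_comm]
  have h : ((k + 1 : ℕ) : ℝ) / k ≤ 2 := by
    rw [div_le_iff₀ (by linarith)]; push_cast; linarith
  gcongr

/-- The weights of the local truncation errors, compared with the rate `N ^ (-m)`. -/
theorem node_rpow_mul_le (hT : 0 < T) (hN : 1 ≤ N) {β m : ℝ} (J : ℝ)
    (hm : m ≤ r * β) {k : ℕ} (hk : 1 ≤ k) (hkN : k ≤ N) :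
    node T r N k ^ β * (k : ℝ) ^ (-J) ≤ T ^ β * (N : ℝ) ^ (-m) * (k : ℝ) ^ (-(J - m)) := by
  have hN' : (0 : ℝ) < N := by positivity
  have hk' : (0 : ℝ) < k := by positivity
  have hkN' : (k : ℝ) ≤ N := by exact_mod_cast hkN
  have h1 : node T r N k ^ β = T ^ β * ((k : ℝ) / N) ^ (r * β) := by
    rw [node, Real.mul_rpow hT.le (by positivity), ← Real.rpow_mul (by positivity)]
  have h2 : ((k : ℝ) / N) ^ (r * β) ≤ ((k : ℝ) / N) ^ m :=
    Real.rpow_le_rpow_of_exponent_ge (by positivity) ((div_le_one hN').2 hkN') hm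
  rw [h1]
  calc T ^ β * ((k : ℝ) / N) ^ (r * β) * (k : ℝ) ^ (-J)
      ≤ T ^ β * ((k : ℝ) / N) ^ m * (k : ℝ) ^ (-J) := by gcongr
    _ = T ^ β * (N : ℝ) ^ (-m) * ((k : ℝ) ^ m * (k : ℝ) ^ (-J)) := by
        rw [Real.div_rpow hk'.le hN'.le, Real.rpow_neg hN'.le]; ring
    _ = _ := by rw [← Real.rpow_add hk']; ring_nf

end Mesh

/-! ### Averages and first moments of convex functions -/

section Moments

variable {φ : ℝ → ℝ} {a b c D : ℝ}

theorem integral_sub_mid (a b : ℝ) : ∫ s in a..b, (s - (a + b) / 2) = 0 := by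
  rw [intervalIntegral.integral_sub (by simp) (by simp)]
  simp
  ring

theorem integral_sub_mid_sq (a b : ℝ) : ∫ s in a..b, (s - (a + b) / 2) ^ 2 = (b - a) ^ 3 / 12 := by
  rw [intervalIntegral.integral_comp_sub_right (fun s => s ^ 2) ((a + b) / 2), integral_pow]
  ring

theorem intervalIntegrable_of_continuousOn_Icc {E : Type*} [NormedAddCommGroup E] {φ : ℝ → E}
    (hab : a ≤ b) (hc : ContinuousOn φ (Icc a b)) : IntervalIntegrable φ volume a b :=
  ContinuousOn.intervalIntegrable (by rwa [uIcc_of_le hab])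

theorem moment_eq_sub (hab : a ≤ b) (hc : ContinuousOn φ (Icc a b)) (y : ℝ) :
    ∫ s in a..b, (s - (a + b) / 2) * φ s = ∫ s in a..b, (s - (a + b) / 2) * (φ s - y) := by
  have h1 : IntervalIntegrable (fun s => (s - (a + b) / 2) * φ s) volume a b :=
    intervalIntegrable_of_continuousOn_Icc hab (by fun_prop)
  have h2 : IntervalIntegrable (fun s => (s - (a + b) / 2) * y) volume a b :=
    intervalIntegrable_of_continuousOn_Icc hab (by fun_prop)
  simp_rw [mul_sub]
  rw [intervalIntegral.integral_sub h1 h2, intervalIntegral.integral_mul_const, integral_sub_mid]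
  ring

/-- Subtracting the midpoint value does not change the moment and makes the two factors of the
integrand agree in sign. -/
theorem moment_nonneg (hab : a ≤ b) (hc : ContinuousOn φ (Icc a b)) (hm : MonotoneOn φ (Icc a b)) :
    0 ≤ ∫ s in a..b, (s - (a + b) / 2) * φ s := by
  rw [moment_eq_sub hab hc (φ ((a + b) / 2))]
  have hmid : (a + b) / 2 ∈ Icc a b := ⟨by linarith, by linarith⟩
  refine intervalIntegral.integral_nonneg hab fun s hs => ?_
  rcases le_total s ((a + b) / 2) with h | h
  · exact mul_nonneg_of_nonpos_of_nonpos (by linarith) (by linarith [hm hs hmid h])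
  · exact mul_nonneg (by linarith) (by linarith [hm hmid hs h])

theorem moment_le (hab : a < b) (hc : ContinuousOn φ (Icc a b)) (hm : MonotoneOn φ (Icc a b)) :
    ∫ s in a..b, (s - (a + b) / 2) * φ s
      ≤ (b - a) ^ 2 / 2 * ((b - a)⁻¹ * (∫ s in a..b, φ s) - φ a) := by
  rw [moment_eq_sub hab.le hc (φ a)]
  have hi := intervalIntegrable_of_continuousOn_Icc hab.le hc
  have h1 : ∫ s in a..b, (s - (a + b) / 2) * (φ s - φ a)
      ≤ ∫ s in a..b, (b - a) / 2 * (φ s - φ a) := by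
    refine intervalIntegral.integral_mono_on hab.le
      (intervalIntegrable_of_continuousOn_Icc hab.le (by fun_prop))
      (intervalIntegrable_of_continuousOn_Icc hab.le (by fun_prop)) fun s hs => ?_
    exact mul_le_mul_of_nonneg_right (by linarith [hs.2])
      (sub_nonneg.2 (hm ⟨le_rfl, hab.le⟩ hs hs.1))
  refine h1.trans (le_of_eq ?_)
  rw [intervalIntegral.integral_const_mul, intervalIntegral.integral_sub hi (by simp),
    intervalIntegral.integral_const, smul_eq_mul]
  have : b - a ≠ 0 := by linarith
  field_simp

/-- The moment is nonnegative and at most a positive multiple of the difference of the two sides. -/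
theorem le_average (hab : a < b) (hc : ContinuousOn φ (Icc a b)) (hm : MonotoneOn φ (Icc a b)) :
    φ a ≤ (b - a)⁻¹ * ∫ s in a..b, φ s := by
  have h := moment_nonneg hab.le hc hm
  have h2 := moment_le hab hc hm
  have hba : 0 < b - a := by linarith
  have h3 : 0 < (b - a) ^ 2 / 2 := by positivity
  by_contra hlt
  push Not at hlt
  nlinarith

theorem average_le (hab : a < b) (hc : ContinuousOn φ (Icc a b)) (hm : MonotoneOn φ (Icc a b)) :
    (b - a)⁻¹ * (∫ s in a..b, φ s) ≤ φ b := by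
  have h1 : ∫ s in a..b, φ s ≤ ∫ s in a..b, φ b :=
    intervalIntegral.integral_mono_on hab.le (intervalIntegrable_of_continuousOn_Icc hab.le hc)
      (by simp) fun s hs => hm hs ⟨hab.le, le_rfl⟩ hs.2
  rw [intervalIntegral.integral_const, smul_eq_mul] at h1
  rw [inv_mul_le_iff₀ (by linarith)]
  exact h1

/-- The first moment over an interval, compared with the deviation of the average over the next
interval from the right end value, for a function with subgradient `D` at the common end. -/
theorem moment_le_of_subgradient (hab : a < b) (hbc : b < c) (hle : b - a ≤ c - b)
    (hc : ContinuousOn φ (Icc a c)) (hD0 : 0 ≤ D)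
    (hD₁ : ∀ s ∈ Icc a b, ∀ s' ∈ Icc a b, s ≤ s' → φ s' - φ s ≤ D * (s' - s))
    (hD₂ : ∀ s ∈ Icc b c, D * (c - s) ≤ φ c - φ s) :
    2 / ((c - b) * (b - a + (c - b))) * ∫ s in a..b, (s - (a + b) / 2) * φ s
      ≤ (φ c - (c - b)⁻¹ * ∫ s in b..c, φ s) / 6 := by
  have hc₁ : ContinuousOn φ (Icc a b) := hc.mono (Icc_subset_Icc_right hbc.le)
  have hc₂ : ContinuousOn φ (Icc b c) := hc.mono (Icc_subset_Icc_left hab.le)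
  have hmid : (a + b) / 2 ∈ Icc a b := ⟨by linarith, by linarith⟩
  -- To the left of b the slope is at most D, so the moment is at most that of a line of slope D.
  have h1 : ∫ s in a..b, (s - (a + b) / 2) * φ s ≤ D * ((b - a) ^ 3 / 12) := by
    rw [moment_eq_sub hab.le hc₁ (φ ((a + b) / 2)), ← integral_sub_mid_sq,
      ← intervalIntegral.integral_const_mul]
    refine intervalIntegral.integral_mono_on hab.le
      (intervalIntegrable_of_continuousOn_Icc hab.le (by fun_prop))
      (intervalIntegrable_of_continuousOn_Icc hab.le (by fun_prop)) fun s hs => ?_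
    rcases le_total s ((a + b) / 2) with h | h
    · have := hD₁ s hs _ hmid h
      nlinarith
    · have := hD₁ _ hmid s hs h
      nlinarith
  -- To the right of b the chords to c have slope at least D, so the average falls short of the end
  -- value by at least D(c − b)/2.
  have h2 : D * ((c - b) ^ 2 / 2) ≤ (c - b) * φ c - ∫ s in b..c, φ s := by
    have e1 : ∫ s in b..c, D * (c - s) = D * ((c - b) ^ 2 / 2) := by
      rw [intervalIntegral.integral_const_mul, intervalIntegral.integral_sub (by simp) (by simp)]
      simp
      left; ring
    have e2 : ∫ s in b..c, (φ c - φ s) = (c - b) * φ c - ∫ s in b..c, φ s := by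
      rw [intervalIntegral.integral_sub (by simp)
        (intervalIntegrable_of_continuousOn_Icc hbc.le hc₂)]
      simp
    rw [← e1, ← e2]
    exact intervalIntegral.integral_mono_on hbc.le
      (intervalIntegrable_of_continuousOn_Icc hbc.le (by fun_prop))
      (intervalIntegrable_of_continuousOn_Icc hbc.le (by fun_prop)) hD₂
  set x := b - a
  set y := c - b
  have hx : 0 < x := by simp only [x]; linarith
  have hy : 0 < y := by simp only [y]; linarith
  have h3 : φ c - y⁻¹ * ∫ s in b..c, φ s = y⁻¹ * (y * φ c - ∫ s in b..c, φ s) := by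
    field_simp
  rw [h3]
  have h4 : D * (y / 2) ≤ y⁻¹ * (y * φ c - ∫ s in b..c, φ s) := by
    rw [inv_mul_eq_div, le_div_iff₀ hy]
    linarith
  calc _ ≤ 2 / (y * (x + y)) * (D * (x ^ 3 / 12)) := by gcongr
    _ ≤ D * (y / 2) / 6 := by
      -- With denominators cleared this is x³ + x·x² ≤ y³ + x·y², true because x ≤ y. It produces
      -- the factor 1/6, as y/12 = (y/2)/6.
      have : 2 / (y * (x + y)) * (x ^ 3 / 12) ≤ y / 12 := by
        rw [div_mul_eq_mul_div, div_le_iff₀ (by positivity)]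
        have h5 : x ^ 3 ≤ y ^ 3 := by gcongr
        have h6 : x * x ^ 2 ≤ x * y ^ 2 := by gcongr
        linarith [show 2 * (x ^ 3 / 12) = (x ^ 3 + x * x ^ 2) / 12 by ring,
          show y / 12 * (y * (x + y)) = (y ^ 3 + x * y ^ 2) / 12 by ring]
      calc _ = D * (2 / (y * (x + y)) * (x ^ 3 / 12)) := by ring
        _ ≤ D * (y / 12) := by gcongr
        _ = _ := by ring
    _ ≤ _ := by gcongr

end Moments

/-! ### The kernel `ω_{1-β}(t - s)` -/

section Kernel

variable {β t : ℝ}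

theorem omega_pos {γ s : ℝ} (hγ : 0 < γ) (hs : 0 < s) : 0 < omega γ s :=
  div_pos (Real.rpow_pos_of_pos hs _) (Real.Gamma_pos_of_pos hγ)

theorem omega_compl_anti (hβ0 : 0 < β) (hβ1 : β < 1) {x y : ℝ} (hx : 0 < x) (hxy : x ≤ y) :
    omega (1 - β) y ≤ omega (1 - β) x := by
  have := Real.Gamma_pos_of_pos (by linarith : 0 < 1 - β)
  unfold omega
  have := Real.rpow_le_rpow_of_nonpos hx hxy (by linarith : 1 - β - 1 ≤ 0)
  gcongr

theorem monotoneOn_omega_sub (hβ0 : 0 < β) (hβ1 : β < 1) :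
    MonotoneOn (fun s => omega (1 - β) (t - s)) (Iio t) := fun _ _ y hy hxy =>
  omega_compl_anti hβ0 hβ1 (sub_pos.2 hy) (by linarith)

theorem hasDerivAt_omega_sub {s : ℝ} (hs : s < t) :
    HasDerivAt (fun s => omega (1 - β) (t - s))
      (β / Real.Gamma (1 - β) * (t - s) ^ (-β - 1)) s := by
  have h1 : HasDerivAt (fun s => t - s) (-1) s := by
    simpa using (hasDerivAt_id s).const_sub t
  have h2 := (Real.hasDerivAt_rpow_const (x := t - s) (p := 1 - β - 1)
    (Or.inl (sub_pos.2 hs).ne')).comp s h1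
  refine (h2.div_const (Real.Gamma (1 - β))).congr_deriv ?_
  rw [show 1 - β - 1 - 1 = -β - 1 by ring]
  ring

theorem continuousOn_omega_sub : ContinuousOn (fun s => omega (1 - β) (t - s)) (Iio t) :=
  fun _ hs => (hasDerivAt_omega_sub hs).continuousAt.continuousWithinAt

/-- D is the derivative at b of the kernel, which is convex in s. The absolute value in the witness
keeps D nonnegative before b < t is known. -/
theorem omega_sub_subgradient (hβ0 : 0 < β) (hβ1 : β < 1) {a b c : ℝ} (hc : c < t) :
    ∃ D, 0 ≤ D ∧
      (b < t → ∀ s ∈ Icc a b, ∀ s' ∈ Icc a b, s ≤ s' →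
        omega (1 - β) (t - s') - omega (1 - β) (t - s) ≤ D * (s' - s)) ∧
      (b < t → ∀ s ∈ Icc b c, D * (c - s) ≤ omega (1 - β) (t - c) - omega (1 - β) (t - s)) := by
  have hG := Real.Gamma_pos_of_pos (by linarith : 0 < 1 - β)
  refine ⟨β / Real.Gamma (1 - β) * |t - b| ^ (-β - 1), by positivity, fun hb s hs s' hs' hss => ?_,
    fun hb s hs => ?_⟩
  · rw [abs_of_pos (sub_pos.2 hb)]
    refine (convex_Icc a b).image_sub_le_mul_sub_of_deriv_le (f := fun s => omega (1 - β) (t - s))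
      ?_ ?_ ?_ s hs s' hs' hss
    · exact continuousOn_omega_sub.mono fun x hx => lt_of_le_of_lt hx.2 hb
    · intro x hx
      rw [interior_Icc] at hx
      exact (hasDerivAt_omega_sub (hx.2.trans hb)).differentiableAt.differentiableWithinAt
    · intro x hx
      rw [interior_Icc] at hx
      rw [(hasDerivAt_omega_sub (hx.2.trans hb)).deriv]
      have := Real.rpow_le_rpow_of_nonpos (sub_pos.2 hb) (by linarith [hx.2] : t - b ≤ t - x)
        (by linarith : -β - 1 ≤ 0)
      gcongr
  · rw [abs_of_pos (sub_pos.2 hb)]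
    refine (convex_Icc b c).mul_sub_le_image_sub_of_le_deriv (f := fun s => omega (1 - β) (t - s))
      ?_ ?_ ?_ s hs c ⟨hs.1.trans hs.2, le_rfl⟩ hs.2
    · exact continuousOn_omega_sub.mono fun x hx => lt_of_le_of_lt hx.2 hc
    · intro x hx
      rw [interior_Icc] at hx
      exact (hasDerivAt_omega_sub (hx.2.trans hc)).differentiableAt.differentiableWithinAt
    · intro x hx
      rw [interior_Icc] at hx
      rw [(hasDerivAt_omega_sub (hx.2.trans hc)).deriv]
      have := Real.rpow_le_rpow_of_nonpos (sub_pos.2 (hx.2.trans hc))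
        (by linarith [hx.1] : t - x ≤ t - b) (by linarith : -β - 1 ≤ 0)
      gcongr

theorem integral_omega_sub_right {γ a : ℝ} (hγ : 0 < γ) (ha : a < t) :
    ∫ s in a..t, omega γ (t - s) = (t - a) ^ γ / Real.Gamma (1 + γ) := by
  have h := integral_omega_sub hγ (sub_pos.2 ha)
  rw [← h]
  have h1 := intervalIntegral.integral_comp_sub_right (a := a) (b := t)
    (fun s => omega γ (t - a - s)) a
  rw [sub_self] at h1
  rw [← h1]
  congr 1
  ext s
  congr 1
  ring

theorem integral_omega_compl_right (hβ1 : β < 1) {a : ℝ} (ha : a < t) :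
    ∫ s in a..t, omega (1 - β) (t - s) = (t - a) / (1 - β) * omega (1 - β) (t - a) := by
  have hG := (Real.Gamma_pos_of_pos (by linarith : 0 < 1 - β)).ne'
  have h1 : 1 - β ≠ 0 := by linarith
  rw [integral_omega_sub_right (by linarith) ha, add_comm 1 (1 - β), Real.Gamma_add_one h1, omega,
    Real.rpow_sub_one (sub_pos.2 ha).ne']
  have := (sub_pos.2 ha).ne'
  field_simp

end Kernel

/-- The properties of a discrete kernel on which the stability of the scheme rests. -/
structure IsStableKernel (T r β θ : ℝ) (N : ℕ) (A : ℕ → ℕ → ℝ) : Prop where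
  mono : ∀ n k, 1 ≤ k → k < n → n ≤ N → A n k ≤ A n (k + 1)
  last : ∀ n, 1 ≤ n → n + 1 ≤ N → (1 - θ) ^ 2 * A (n + 1) n ≤ (1 - 2 * θ) * A (n + 1) (n + 1)
  first : ∀ n, 1 ≤ n → n ≤ N → omega (1 - β) (node T r N n) ≤ A n 1

/-! ### Monotonicity and lower bounds of the two kernels -/

section Kernels

variable {T r β : ℝ} {N : ℕ}

/-- Each weight averages an increasing function over a step, hence lies between its end values, and
neighbouring steps share an end point. On the last, singular step the integral is explicit and the
factor 1/(1 − β) ≥ 1 gives the lower bound. For θ = 0 the condition `last` is monotonicity. -/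
theorem isStableKernel_l1Kernel (hT : 0 < T) (hr : 1 ≤ r) (hN : 1 ≤ N) (hβ0 : 0 < β)
    (hβ1 : β < 1) : IsStableKernel T r β 0 N (l1Kernel T r β N) := by
  have hcont : ∀ {n k : ℕ}, k + 1 < n → ContinuousOn (fun s => omega (1 - β) (node T r N n - s))
      (Icc (node T r N k) (node T r N (k + 1))) := fun h =>
    continuousOn_omega_sub.mono fun x hx => lt_of_le_of_lt hx.2 (node_lt hT hr hN h)
  have hmono : ∀ {n k : ℕ}, k + 1 < n → MonotoneOn (fun s => omega (1 - β) (node T r N n - s))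
      (Icc (node T r N k) (node T r N (k + 1))) := fun h =>
    (monotoneOn_omega_sub hβ0 hβ1).mono fun x hx => lt_of_le_of_lt hx.2 (node_lt hT hr hN h)
  have lower : ∀ n k, k + 1 ≤ n →
      omega (1 - β) (node T r N n - node T r N k) ≤ l1Kernel T r β N n (k + 1) := by
    intro n k h
    have hlt := node_lt (T := T) (r := r) hT hr hN (Nat.lt_succ_self k)
    rcases h.lt_or_eq with h | rfl
    · exact le_average hlt (hcont h) (hmono h)
    · rw [l1Kernel, Nat.add_sub_cancel, integral_omega_compl_right hβ1 hlt, step_succ]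
      have hp := omega_pos (γ := 1 - β) (by linarith) (sub_pos.2 hlt)
      have h2 : 0 < node T r N (k + 1) - node T r N k := sub_pos.2 hlt
      rw [← mul_assoc, inv_mul_eq_div, div_div_cancel_left' h2.ne']
      refine le_mul_of_one_le_left hp.le ?_
      exact (one_le_inv₀ (by linarith)).2 (by linarith)
  have upper : ∀ n k, k + 1 < n →
      l1Kernel T r β N n (k + 1) ≤ omega (1 - β) (node T r N n - node T r N (k + 1)) :=
    fun n k h => average_le (node_lt hT hr hN (Nat.lt_succ_self k)) (hcont h) (hmono h)
  have mono : ∀ n k, 1 ≤ k → k < n → n ≤ N → l1Kernel T r β N n k ≤ l1Kernel T r β N n (k + 1) := by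
    intro n k hk hkn _
    obtain ⟨k, rfl⟩ := Nat.exists_eq_add_of_le' hk
    exact (upper n k hkn).trans (lower n (k + 1) hkn)
  refine ⟨mono, fun n hn hnN => ?_, fun n hn hnN => ?_⟩
  · have := mono (n + 1) n hn (Nat.lt_succ_self n) hnN
    simpa using this
  · have := lower n 0 hn
    rwa [node_zero hr, sub_zero] at this

/-- The corrections b are small against the gaps left by averaging: b ≤ (a − left end value)/2 on
its own step, and by convexity and growing steps ρb ≤ (right end value − a)/6 on the next one. So
the corrected weights on past steps are still separated by the nodal values of ω. For the last step,
(1 − β) a₀ = (1 − β/2) ω(t_{n−θ} − t_{n−1}) holds exactly, which leaves the room demanded by `last`.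
-/
theorem isStableKernel_alikhanovKernel (hT : 0 < T) (hr : 1 ≤ r) (hN : 1 ≤ N) (hβ0 : 0 < β)
    (hβ1 : β < 1) : IsStableKernel T r β (β / 2) N (alikhanovKernel T r β N) := by
  set t : ℕ → ℝ := node T r N with ht
  set x : ℕ → ℝ := offsetNode T r (β / 2) N with hx
  have hlt : ∀ {j k : ℕ}, j < k → t j < t k := fun h => node_lt hT hr hN h
  have hxe : ∀ n, x (n + 1) - t n = (1 - β / 2) * (t (n + 1) - t n) := fun n => by
    rw [hx, offsetNode, Nat.add_sub_cancel]; ring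
  have htx : ∀ {n k : ℕ}, k ≤ n → t k < x (n + 1) := fun {n k} h => by
    have h1 : t k ≤ t n := node_le hT hr hN h
    have h2 := sub_pos.2 (hlt (Nat.lt_succ_self n))
    have h3 : 0 < x (n + 1) - t n := by rw [hxe]; exact mul_pos (by linarith) h2
    linarith
  have hxt : ∀ n, x (n + 1) ≤ t (n + 1) := fun n => by
    have h2 := sub_pos.2 (hlt (Nat.lt_succ_self n))
    have := hxe n
    nlinarith
  have hcont : ∀ {n j k : ℕ}, k ≤ n → ContinuousOn (fun s => omega (1 - β) (x (n + 1) - s))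
      (Icc (t j) (t k)) := fun h =>
    continuousOn_omega_sub.mono fun y hy => lt_of_le_of_lt hy.2 (htx h)
  have hmono : ∀ {n j k : ℕ}, k ≤ n → MonotoneOn (fun s => omega (1 - β) (x (n + 1) - s))
      (Icc (t j) (t k)) := fun h =>
    (monotoneOn_omega_sub hβ0 hβ1).mono fun y hy => lt_of_le_of_lt hy.2 (htx h)
  have hA : ∀ n k, k + 1 ≤ n → alikhanovA T r β N (n + 1) (k + 1)
      = (t (k + 1) - t k)⁻¹ * ∫ s in t k..t (k + 1), omega (1 - β) (x (n + 1) - s) := by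
    intro n k h
    rw [alikhanovA, if_neg (by omega), Nat.add_sub_cancel, step_succ]
  have hB : ∀ n k, alikhanovB T r β N (n + 1) (k + 1)
      = 2 / ((t (k + 1) - t k) * (t (k + 1) - t k + (t (k + 2) - t (k + 1)))) *
        ∫ s in t k..t (k + 1), (s - (t k + t (k + 1)) / 2) * omega (1 - β) (x (n + 1) - s) := by
    intro n k
    rw [alikhanovB, Nat.add_sub_cancel, step_succ, step_succ]
  have stepd : ∀ k, t (k + 1) - t k ≤ t (k + 2) - t (k + 1) := fun k =>
    step_le_step_succ hT hr hN (k := k + 1) (by omega)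
  have B_nonneg : ∀ n k, k + 1 ≤ n → 0 ≤ alikhanovB T r β N (n + 1) (k + 1) := by
    intro n k h
    rw [hB]
    have h1 := sub_pos.2 (hlt (Nat.lt_succ_self k))
    have h2 := sub_pos.2 (hlt (Nat.lt_succ_self (k + 1)))
    have h3 := moment_nonneg (hlt (Nat.lt_succ_self k)).le (hcont (j := k) h) (hmono (j := k) h)
    exact mul_nonneg (by positivity) h3
  have B_le : ∀ n k, k + 1 ≤ n → alikhanovB T r β N (n + 1) (k + 1)
      ≤ (alikhanovA T r β N (n + 1) (k + 1) - omega (1 - β) (x (n + 1) - t k)) / 2 := by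
    intro n k h
    rw [hB, hA n k h]
    have h1 := sub_pos.2 (hlt (Nat.lt_succ_self k))
    have h3 := moment_le (hlt (Nat.lt_succ_self k)) (hcont (j := k) h) (hmono (j := k) h)
    have h4 := moment_nonneg (hlt (Nat.lt_succ_self k)).le (hcont (j := k) h) (hmono (j := k) h)
    set d := t (k + 1) - t k
    have h5 : 2 / (d * (d + (t (k + 2) - t (k + 1)))) ≤ 1 / d ^ 2 := by
      rw [div_le_div_iff₀ (by nlinarith [stepd k]) (by positivity)]
      nlinarith [stepd k]
    calc _ ≤ 1 / d ^ 2 * ∫ s in t k..t (k + 1),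
          (s - (t k + t (k + 1)) / 2) * omega (1 - β) (x (n + 1) - s) := by gcongr
      _ ≤ 1 / d ^ 2 * (d ^ 2 / 2 * (d⁻¹ * (∫ s in t k..t (k + 1), omega (1 - β) (x (n + 1) - s))
          - omega (1 - β) (x (n + 1) - t k))) := mul_le_mul_of_nonneg_left h3 (by positivity)
      _ = _ := by
        rw [← mul_assoc, show 1 / d ^ 2 * (d ^ 2 / 2) = 1 / 2 by field_simp]
        ring
  have ρB_le : ∀ n k, k + 2 ≤ n → stepRatio T r N (k + 1) * alikhanovB T r β N (n + 1) (k + 1)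
      ≤ (omega (1 - β) (x (n + 1) - t (k + 2)) - alikhanovA T r β N (n + 1) (k + 2)) / 6 := by
    intro n k h
    have h1 := sub_pos.2 (hlt (Nat.lt_succ_self k))
    have h2 := sub_pos.2 (hlt (Nat.lt_succ_self (k + 1)))
    obtain ⟨D, hD0, hD1, hD2⟩ := omega_sub_subgradient hβ0 hβ1 (a := t k) (b := t (k + 1))
      (htx h)
    have h3 := moment_le_of_subgradient (hlt (Nat.lt_succ_self k)) (hlt (Nat.lt_succ_self (k + 1)))
      (stepd k) (hcont h) hD0 (hD1 (htx (by omega))) (hD2 (htx (by omega)))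
    rw [hB, hA n (k + 1) h, stepRatio, step_succ, step_succ]
    refine le_trans (le_of_eq ?_) h3
    rw [← mul_assoc]
    congr 1
    change (t (k + 1) - t k) / (t (k + 2) - t (k + 1)) * (2 / ((t (k + 1) - t k) *
      (t (k + 1) - t k + (t (k + 2) - t (k + 1))))) = _
    simp only [Nat.succ_eq_add_one] at h1 h2 ⊢
    field_simp
    try ring
  have A_ge : ∀ n k, k + 1 ≤ n →
      omega (1 - β) (x (n + 1) - t k) ≤ alikhanovA T r β N (n + 1) (k + 1) := by
    intro n k h
    rw [hA n k h]
    exact le_average (hlt (Nat.lt_succ_self k)) (hcont h) (hmono h)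
  have A_le : ∀ n k, k + 1 ≤ n →
      alikhanovA T r β N (n + 1) (k + 1) ≤ omega (1 - β) (x (n + 1) - t (k + 1)) := by
    intro n k h
    rw [hA n k h]
    exact average_le (hlt (Nat.lt_succ_self k)) (hcont h) (hmono h)
  have A_last : ∀ n, (1 - β) * alikhanovA T r β N (n + 1) (n + 1)
      = (1 - β / 2) * omega (1 - β) (x (n + 1) - t n) := by
    intro n
    rw [alikhanovA, if_pos rfl, Nat.add_sub_cancel, step_succ,
      integral_omega_compl_right hβ1 (htx le_rfl)]
    change (1 - β) * ((t (n + 1) - t n)⁻¹ * ((x (n + 1) - t n) / (1 - β) * _)) = _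
    have h2 := sub_pos.2 (hlt (Nat.lt_succ_self n))
    have h3 : 0 < 1 - β := by linarith
    rw [hxe]
    field_simp
  have K_last : ∀ n, 1 ≤ n → alikhanovA T r β N (n + 1) (n + 1)
      ≤ alikhanovKernel T r β N (n + 1) (n + 1) := by
    intro n hn
    obtain ⟨n, rfl⟩ := Nat.exists_eq_add_of_le' hn
    rw [alikhanovKernel, if_neg (by omega), if_pos rfl, Nat.add_sub_cancel]
    have h1 := step_pos (T := T) (r := r) hT hr hN (k := n + 1) (by omega)
    have h2 := step_pos (T := T) (r := r) hT hr hN (k := n + 2) (by omega)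
    have h3 := B_nonneg (n + 1) n le_rfl
    have : 0 ≤ stepRatio T r N (n + 1) := by rw [stepRatio]; positivity
    nlinarith [mul_nonneg this h3]
  have K_first : ∀ n, 1 ≤ n → alikhanovKernel T r β N (n + 1) 1
      = alikhanovA T r β N (n + 1) 1 - alikhanovB T r β N (n + 1) 1 := by
    intro n hn
    rw [alikhanovKernel, if_neg (by omega), if_neg (by omega), if_pos rfl]
  have K_mid : ∀ n k, k + 2 ≤ n → alikhanovKernel T r β N (n + 1) (k + 2)
      = alikhanovA T r β N (n + 1) (k + 2) + stepRatio T r N (k + 1) *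
        alikhanovB T r β N (n + 1) (k + 1) - alikhanovB T r β N (n + 1) (k + 2) := by
    intro n k h
    rw [alikhanovKernel, if_neg (by omega), if_neg (by omega), if_neg (by omega)]
    rfl
  have K_le : ∀ n k, k + 1 ≤ n → alikhanovKernel T r β N (n + 1) (k + 1)
      ≤ omega (1 - β) (x (n + 1) - t (k + 1)) - alikhanovB T r β N (n + 1) (k + 1) := by
    intro n k h
    have h1 := A_le n k h
    rcases k with _ | k
    · rw [K_first n h]; linarith
    · rw [K_mid n k h]
      have := ρB_le n k h
      linarith
  have K_ge : ∀ n k, k + 1 ≤ n → omega (1 - β) (x (n + 1) - t k)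
      ≤ alikhanovKernel T r β N (n + 1) (k + 1) := by
    intro n k h
    have h1 := A_ge n k h
    have h2 := B_le n k h
    rcases k with _ | k
    · rw [K_first n h]
      linarith
    · rw [K_mid n k h]
      have h3 := step_pos (T := T) (r := r) hT hr hN (k := k + 1) (by omega)
      have h4 := step_pos (T := T) (r := r) hT hr hN (k := k + 2) (by omega)
      have h5 := B_nonneg n k (by omega)
      have : 0 ≤ stepRatio T r N (k + 1) := by rw [stepRatio]; positivity
      have := mul_nonneg this h5
      linarith
  have last : ∀ n, 1 ≤ n → n + 1 ≤ N → (1 - β / 2) ^ 2 * alikhanovKernel T r β N (n + 1) n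
      ≤ (1 - 2 * (β / 2)) * alikhanovKernel T r β N (n + 1) (n + 1) := by
    intro n hn hnN
    have h1 := K_last n hn
    have h2 := A_last n
    have h3 : alikhanovKernel T r β N (n + 1) n ≤ omega (1 - β) (x (n + 1) - t n) := by
      obtain ⟨n, rfl⟩ := Nat.exists_eq_add_of_le' hn
      have := K_le (n + 1) n le_rfl
      have := B_nonneg (n + 1) n le_rfl
      linarith
    have h4 := omega_pos (γ := 1 - β) (by linarith) (sub_pos.2 (htx (le_refl n)))
    -- Since 1 − β/2 < 1, one of its two factors is dropped; the other is the one in the identity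
    -- for a₀.
    calc _ ≤ (1 - β / 2) ^ 2 * omega (1 - β) (x (n + 1) - t n) := by gcongr
      _ ≤ (1 - β / 2) * omega (1 - β) (x (n + 1) - t n) := by
        gcongr; nlinarith
      _ = (1 - β) * alikhanovA T r β N (n + 1) (n + 1) := h2.symm
      _ ≤ (1 - β) * alikhanovKernel T r β N (n + 1) (n + 1) := by
        have : 0 ≤ 1 - β := by linarith
        gcongr
      _ = _ := by ring
  refine ⟨fun n k hk hkn hnN => ?_, last, fun n hn hnN => ?_⟩
  · obtain ⟨n, rfl⟩ := Nat.exists_eq_add_of_le' (show 1 ≤ n by omega)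
    obtain ⟨k, rfl⟩ := Nat.exists_eq_add_of_le' hk
    rcases (show k + 1 ≤ n by omega).lt_or_eq with h | rfl
    · have h1 := K_le n k (by omega)
      have h2 := K_ge n (k + 1) (by omega)
      have h3 := B_nonneg n k (by omega)
      linarith
    · have h1 := last (k + 1) hk hnN
      have h2 := K_ge (k + 1) k le_rfl
      have h3 := omega_pos (γ := 1 - β) (by linarith) (sub_pos.2 (htx (show k ≤ k + 1 by omega)))
      -- Monotonicity into the last step is weaker than `last`, because 1 − 2θ ≤ (1 − θ)².
      have h4 : (1 - 2 * (β / 2)) * alikhanovKernel T r β N (k + 1 + 1) (k + 1)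
          ≤ (1 - β / 2) ^ 2 * alikhanovKernel T r β N (k + 1 + 1) (k + 1) := by
        refine mul_le_mul_of_nonneg_right (by nlinarith) (by linarith)
      exact le_of_mul_le_mul_left (h4.trans h1) (by linarith)
  · obtain ⟨n, rfl⟩ := Nat.exists_eq_add_of_le' hn
    have h0 : t 0 = 0 := node_zero hr
    have h1 := htx (Nat.zero_le n)
    rw [h0] at h1
    have h2 := omega_compl_anti hβ0 hβ1 h1 (hxt n)
    refine h2.trans ?_
    rcases Nat.eq_zero_or_pos n with rfl | hn'
    · rw [alikhanovKernel, if_pos (by simp)]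
      have h3 := A_last 0
      rw [h0, sub_zero] at h3
      have h4 := omega_pos (γ := 1 - β) (by linarith) h1
      refine le_of_mul_le_mul_left ?_ (by linarith : 0 < 1 - β)
      simp only [zero_add] at h3 h4 ⊢
      rw [h3]
      gcongr
      linarith
    · have := K_ge n 0 hn'
      rwa [h0, sub_zero] at this

end Kernels

/-! ### Stability of the discrete scheme -/

section Stability

variable {F : Type*} [NormedAddCommGroup F] [InnerProductSpace ℝ F]

/-- The energy defect of a discrete derivative with an increasing kernel. -/
theorem norm_sq_div_le_energy_defect {A : ℕ → ℝ} {E : ℕ → F} {n : ℕ} (hA : 0 < A 1)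
    (hmono : ∀ k, 1 ≤ k → k ≤ n → A k ≤ A (k + 1)) :
    ‖∑ k ∈ Finset.range (n + 1), A (k + 1) • (E (k + 1) - E k)‖ ^ 2 / A (n + 1) ≤
      2 * inner ℝ (E (n + 1)) (∑ k ∈ Finset.range (n + 1), A (k + 1) • (E (k + 1) - E k))
        - ∑ k ∈ Finset.range (n + 1), A (k + 1) * (‖E (k + 1)‖ ^ 2 - ‖E k‖ ^ 2) := by
  induction n with
  | zero =>
    simp only [zero_add, Finset.sum_range_one, norm_smul, inner_smul_right, mul_pow, Real.norm_eq_abs,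
      sq_abs, norm_sub_sq_real, inner_sub_right, real_inner_self_eq_norm_sq]
    apply le_of_eq
    field_simp
    ring
  | succ n ih =>
    have h0 := ih fun k h1 h2 => hmono k h1 (by omega)
    have hpos : ∀ k, k ≤ n + 1 → 0 < A (k + 1) := by
      intro k hk
      induction k with
      | zero => exact hA
      | succ k ihk => exact (ihk (by omega)).trans_le (hmono (k + 1) (by omega) hk)
    have h1 := hpos n (by omega)
    have h2 := hpos (n + 1) le_rfl
    have h3 := hmono (n + 1) (by omega) le_rfl
    rw [Finset.sum_range_succ _ (n + 1), Finset.sum_range_succ _ (n + 1)]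
    set G := ∑ k ∈ Finset.range (n + 1), A (k + 1) • (E (k + 1) - E k)
    set S := ∑ k ∈ Finset.range (n + 1), A (k + 1) * (‖E (k + 1)‖ ^ 2 - ‖E k‖ ^ 2)
    -- The only loss in the induction, and the only use of monotonicity; the rest is the expansion
    -- of a square.
    have h4 : ‖G‖ ^ 2 / A (n + 1 + 1) ≤ ‖G‖ ^ 2 / A (n + 1) := by gcongr
    set a := A (n + 1 + 1)
    have h5 : ‖G + a • (E (n + 1 + 1) - E (n + 1))‖ ^ 2 / a = ‖G‖ ^ 2 / a +
        2 * inner ℝ G (E (n + 1 + 1) - E (n + 1)) + a * ‖E (n + 1 + 1) - E (n + 1)‖ ^ 2 := by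
      rw [norm_add_sq_real, norm_smul, inner_smul_right, Real.norm_eq_abs, abs_of_pos h2]
      field_simp
    rw [h5, norm_sub_sq_real]
    simp only [inner_add_right, inner_sub_right, inner_smul_right, real_inner_self_eq_norm_sq,
      real_inner_comm (E (n + 1 + 1)) G, real_inner_comm (E (n + 1)) G]
    have := real_inner_comm (E (n + 1 + 1)) G
    have := real_inner_comm (E (n + 1)) G
    linarith

/-- Write e for the last increment, G for the earlier part of the derivative, and b, a for the last
two weights. The energy defect without the last step leaves ‖G‖²/b + 2(1 − θ)⟨e, G⟩ + (1 − 2θ) a‖e‖²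
to be shown nonnegative. By Cauchy–Schwarz this follows from (1 − θ)² b ≤ (1 − 2θ) a. -/
theorem sum_energy_le_inner {A : ℕ → ℝ} {E : ℕ → F} {θ : ℝ} {n : ℕ} (hA : 0 < A 1)
    (hθ1 : θ < 1 / 2)
    (hmono : ∀ k, 1 ≤ k → k ≤ n → A k ≤ A (k + 1))
    (hlast : 1 ≤ n → (1 - θ) ^ 2 * A n ≤ (1 - 2 * θ) * A (n + 1)) :
    ∑ k ∈ Finset.range (n + 1), A (k + 1) * (‖E (k + 1)‖ ^ 2 - ‖E k‖ ^ 2) ≤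
      2 * inner ℝ (θ • E n + (1 - θ) • E (n + 1))
        (∑ k ∈ Finset.range (n + 1), A (k + 1) • (E (k + 1) - E k)) := by
  have hE : θ • E n + (1 - θ) • E (n + 1) = E (n + 1) - θ • (E (n + 1) - E n) := by module
  rw [hE]
  rcases n with _ | n
  · simp only [zero_add, Finset.sum_range_one, inner_smul_right, inner_sub_left,
      inner_smul_left, inner_sub_right, real_inner_self_eq_norm_sq, real_inner_comm (E 1) (E 0),
      conj_trivial]
    have h1 := norm_sub_sq_real (E 1) (E 0)
    have h2 := real_inner_comm (E 1) (E 0)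
    have : 0 ≤ A 1 * ((1 - 2 * θ) * ‖E 1 - E 0‖ ^ 2) := by
      have : 0 ≤ 1 - 2 * θ := by linarith
      positivity
    rw [h1] at this
    nlinarith
  · have hpos : ∀ k, k ≤ n + 1 → 0 < A (k + 1) := by
      intro k hk
      induction k with
      | zero => exact hA
      | succ k ihk => exact (ihk (by omega)).trans_le (hmono (k + 1) (by omega) hk)
    have h0 := norm_sq_div_le_energy_defect (E := E) hA fun k h1 h2 => hmono k h1 (by omega : k ≤ n + 1)
    have hl := hlast (by omega)
    have h1 := hpos n (by omega)
    have h2 := hpos (n + 1) le_rfl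
    have hd := norm_sq_div_le_energy_defect (E := E) (n := n) hA fun k h1 h2 => hmono k h1 (by omega)
    rw [Finset.sum_range_succ _ (n + 1), Finset.sum_range_succ _ (n + 1)]
    set G := ∑ k ∈ Finset.range (n + 1), A (k + 1) • (E (k + 1) - E k)
    set S := ∑ k ∈ Finset.range (n + 1), A (k + 1) * (‖E (k + 1)‖ ^ 2 - ‖E k‖ ^ 2)
    set a := A (n + 1 + 1)
    set b := A (n + 1)
    set e := E (n + 1 + 1) - E (n + 1) with he
    have hEe : E (n + 1 + 1) = E (n + 1) + e := by rw [he]; abel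
    rw [hEe, norm_add_sq_real]
    simp only [inner_add_right, inner_add_left, inner_sub_left, inner_smul_left, inner_smul_right,
      real_inner_self_eq_norm_sq, conj_trivial]
    have h3 : 0 ≤ ‖G‖ ^ 2 / b + 2 * (1 - θ) * inner ℝ e G + (1 - 2 * θ) * a * ‖e‖ ^ 2 := by
      have h4 := abs_real_inner_le_norm e G
      have h5 : 0 ≤ (‖G‖ - (1 - θ) * b * ‖e‖) ^ 2 / b := by positivity
      have h6 : (‖G‖ - (1 - θ) * b * ‖e‖) ^ 2 / b = ‖G‖ ^ 2 / b - 2 * (1 - θ) * (‖e‖ * ‖G‖)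
          + (1 - θ) ^ 2 * b * ‖e‖ ^ 2 := by
        field_simp
        ring
      have h7 := mul_le_mul_of_nonneg_right hl (sq_nonneg ‖e‖)
      have h8 := mul_le_mul_of_nonneg_left (neg_le_of_abs_le h4) (by linarith : 0 ≤ 2 * (1 - θ))
      linarith
    linarith

/-- Stability in the maximum norm of a discrete fractional evolution equation with a skew
generator. -/
theorem IsStableKernel.norm_le {T r β θ : ℝ} {N : ℕ} {A : ℕ → ℕ → ℝ}
    (h : IsStableKernel T r β θ N A) (hβ1 : β < 1) (hT : 0 < T) (hN : 1 ≤ N)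
    (hθ0 : 0 ≤ θ) (hθ1 : θ < 1 / 2) {B : ℝ} (E R : ℕ → F) (hE : E 0 = 0)
    (hR : ∀ n < N, ‖R (n + 1)‖ ≤ B * A (n + 1) 1)
    (heq : ∀ n < N, inner ℝ (θ • E n + (1 - θ) • E (n + 1))
      (∑ k ∈ Finset.range (n + 1), A (n + 1) (k + 1) • (E (k + 1) - E k)) =
      inner ℝ (θ • E n + (1 - θ) • E (n + 1)) (R (n + 1))) {n : ℕ} (hn : n ≤ N) :
    ‖E n‖ ≤ 2 * B := by
  -- Testing the equation only at the index of largest norm replaces a discrete Gronwall argument.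
  obtain ⟨m, hm, hmax⟩ := Finset.exists_max_image (Finset.range (N + 1)) (fun k => ‖E k‖)
    ⟨0, by simp⟩
  have hmN : m ≤ N := by simpa [Nat.lt_succ_iff] using hm
  have hmax : ∀ k ≤ N, ‖E k‖ ≤ ‖E m‖ := fun k hk => hmax k (by simpa [Nat.lt_succ_iff] using hk)
  refine (hmax n hn).trans ?_
  have hpos : ∀ n < N, 0 < A (n + 1) 1 := fun n hn =>
    (omega_pos (by linarith) (node_pos hT hN (by omega))).trans_le
      (h.first (n + 1) (by omega) hn)
  rcases m with _ | m
  · have := (norm_nonneg _).trans (hR 0 (by omega))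
    rw [hE, norm_zero]
    linarith [nonneg_of_mul_nonneg_left this (hpos 0 (by omega))]
  have hA := hpos m (by omega)
  have h1 := sum_energy_le_inner (A := A (m + 1)) (E := E) hA hθ1
    (fun k h1 h2 => h.mono _ k h1 (by omega) hmN) (fun hm => h.last m hm hmN)
  rw [heq m (by omega)] at h1
  -- Summation by parts: increasing weights and maximality of ‖E (m + 1)‖ bound the energy sum from
  -- below. For j = m what remains is A (m + 1) 1 · ‖E (m + 1)‖².
  have habel : ∀ j ≤ m, A (m + 1) (j + 1) * ‖E (j + 1)‖ ^ 2 -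
      (A (m + 1) (j + 1) - A (m + 1) 1) * ‖E (m + 1)‖ ^ 2 ≤
      ∑ k ∈ Finset.range (j + 1), A (m + 1) (k + 1) * (‖E (k + 1)‖ ^ 2 - ‖E k‖ ^ 2) := by
    intro j hj
    induction j with
    | zero => simp [hE]
    | succ j ih =>
      rw [Finset.sum_range_succ]
      have h2 := ih (by omega)
      have h3 := h.mono (m + 1) (j + 1) (by omega) (by omega) hmN
      have h4 : ‖E (j + 1)‖ ^ 2 ≤ ‖E (m + 1)‖ ^ 2 := by
        gcongr
        exact hmax _ (by omega)
      nlinarith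
  have h2 := habel m le_rfl
  have h3 : ‖θ • E m + (1 - θ) • E (m + 1)‖ ≤ ‖E (m + 1)‖ := by
    refine (norm_add_le _ _).trans ?_
    rw [norm_smul, norm_smul, Real.norm_of_nonneg hθ0, Real.norm_of_nonneg (by linarith)]
    nlinarith [hmax m (by omega)]
  have h4 : inner ℝ (θ • E m + (1 - θ) • E (m + 1)) (R (m + 1))
      ≤ ‖E (m + 1)‖ * (B * A (m + 1) 1) :=
    (real_inner_le_norm _ _).trans (mul_le_mul h3 (hR m (by omega)) (norm_nonneg _) (norm_nonneg _))
  have h5 : A (m + 1) 1 * (‖E (m + 1)‖ * ‖E (m + 1)‖)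
      ≤ A (m + 1) 1 * (2 * B * ‖E (m + 1)‖) := by
    nlinarith
  have h6 := le_of_mul_le_mul_left h5 hA
  rcases (norm_nonneg (E (m + 1))).eq_or_lt with h0 | h0
  · rw [← h0]
    have := (norm_nonneg _).trans (hR m (by omega))
    linarith [nonneg_of_mul_nonneg_left this hA]
  · exact le_of_mul_le_mul_right h6 h0

end Stability

/-! ### Truncation errors: the history -/

section History

variable {E : Type*} [NormedAddCommGroup E] [NormedSpace ℝ E]

/-- As q has mean zero, φ may be replaced by φ − φ(a), which never exceeds the total increment. -/
theorem norm_integral_smul_le_of_integral_eq_zero [CompleteSpace E] {a b : ℝ} {φ : ℝ → ℝ}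
    {q : ℝ → E} (hab : a ≤ b)
    (hc : ContinuousOn φ (Icc a b)) (hm : MonotoneOn φ (Icc a b))
    (hq : IntervalIntegrable q volume a b) (h0 : ∫ s in a..b, q s = 0) :
    ‖∫ s in a..b, φ s • q s‖ ≤ (φ b - φ a) * ∫ s in a..b, ‖q s‖ := by
  have h1 : IntervalIntegrable (fun s => φ s • q s) volume a b :=
    hq.continuousOn_smul (by rwa [uIcc_of_le hab])
  have h2 : ∫ s in a..b, φ s • q s = ∫ s in a..b, (φ s - φ a) • q s := by
    simp_rw [sub_smul]
    rw [intervalIntegral.integral_sub h1 (g := fun s => φ a • q s) (hq.smul (φ a)),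
      intervalIntegral.integral_smul, h0, smul_zero, sub_zero]
  rw [h2, ← intervalIntegral.integral_const_mul]
  refine intervalIntegral.norm_integral_le_of_norm_le hab ?_ (hq.norm.const_mul _)
  refine Filter.Eventually.of_forall fun s hs => ?_
  have hs' : s ∈ Icc a b := Ioc_subset_Icc_self hs
  have h3 := hm (left_mem_Icc.2 hab) hs' hs'.1
  have h4 := hm hs' (right_mem_Icc.2 hab) hs'.2
  rw [norm_smul, Real.norm_of_nonneg (by linarith)]
  gcongr

variable {T r β θ : ℝ} {N : ℕ}

theorem offsetNode_succ (n : ℕ) :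
    offsetNode T r θ N (n + 1) = θ * node T r N n + (1 - θ) * node T r N (n + 1) := rfl

theorem node_lt_offsetNode (hT : 0 < T) (hr : 1 ≤ r) (hN : 1 ≤ N) (hθ : θ < 1) (n : ℕ) :
    node T r N n < offsetNode T r θ N (n + 1) := by
  have := node_lt (T := T) (r := r) hT hr hN (Nat.lt_succ_self n)
  rw [offsetNode_succ]
  simp only [Nat.succ_eq_add_one] at this
  nlinarith

theorem offsetNode_le_node (hT : 0 < T) (hr : 1 ≤ r) (hN : 1 ≤ N) (hθ : 0 ≤ θ) (n : ℕ) :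
    offsetNode T r θ N (n + 1) ≤ node T r N (n + 1) := by
  have := node_lt (T := T) (r := r) hT hr hN (Nat.lt_succ_self n)
  rw [offsetNode_succ]
  simp only [Nat.succ_eq_add_one] at this
  nlinarith

theorem omega_compl_mul {c x : ℝ} (hc : 0 < c) (hx : 0 < x) :
    omega (1 - β) (c * x) = c ^ (-β) / Real.Gamma (1 - β) * x ^ (-β) := by
  rw [omega, show 1 - β - 1 = -β by ring, Real.mul_rpow hc.le hx.le]
  ring

/-- The increments of the kernel over the past steps, weighted by `k ^ (-β)`. -/
theorem exists_sum_omega_increment_le (hβ0 : 0 < β) (hβ1 : β < 1) (hθ0 : 0 ≤ θ)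
    (hθ1 : θ < 1 / 2) :
    ∃ C, 0 ≤ C ∧ ∀ (T r : ℝ), 0 < T → 1 ≤ r → ∀ N : ℕ, 1 ≤ N → ∀ n : ℕ,
      ∑ k ∈ Finset.range n, (omega (1 - β) (offsetNode T r θ N (n + 1) - node T r N (k + 1))
        - omega (1 - β) (offsetNode T r θ N (n + 1) - node T r N k)) * ((k : ℝ) + 1) ^ (-β)
      ≤ C * node T r N (n + 1) ^ (-β) := by
  have hG := Real.Gamma_pos_of_pos (by linarith : 0 < 1 - β)
  refine ⟨((1 / 2 - θ) ^ (-β) + 2 ^ β * (1 - θ) ^ (-β)) / Real.Gamma (1 - β), ?_, ?_⟩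
  · have : 0 < 1 / 2 - θ := by linarith
    have : 0 < 1 - θ := by linarith
    positivity
  intro T r hT hr N hN n
  set x := offsetNode T r θ N (n + 1) with hx
  set w : ℕ → ℝ := fun k => omega (1 - β) (x - node T r N k) with hw
  have hxn : ∀ {k}, k ≤ n → 0 < x - node T r N k := fun {k} hk => by
    have := node_lt_offsetNode (θ := θ) hT hr hN (by linarith) n
    have := node_le (T := T) (r := r) hT hr hN hk
    linarith
  have hwm : ∀ {j k}, j ≤ k → k ≤ n → w j ≤ w k := fun {j k} hjk hk =>
    omega_compl_anti hβ0 hβ1 (hxn hk) (by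
      have := node_le (T := T) (r := r) hT hr hN hjk
      linarith)
  have hwp : ∀ {k}, k ≤ n → 0 < w k := fun {k} hk => omega_pos (by linarith) (hxn hk)
  have hn' : (0 : ℝ) < (n + 1 : ℕ) := by positivity
  have hp := node_pos (T := T) (r := r) (k := n + 1) hT hN (by omega)
  -- Split the history in the middle: early weights are at most 1, late ones at most 2^β (n +
  -- 1)^(−β). The `min` lets the early part telescope over the whole range.
  have h1 : ∀ k ∈ Finset.range n, (w (k + 1) - w k) * ((k : ℝ) + 1) ^ (-β) ≤
      (w (min (k + 1) ((n + 1) / 2)) - w (min k ((n + 1) / 2)))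
        + 2 ^ β * ((n + 1 : ℕ) : ℝ) ^ (-β) * (w (k + 1) - w k) := by
    intro k hk
    have hkn := Finset.mem_range.1 hk
    have hd : 0 ≤ w (k + 1) - w k := sub_nonneg.2 (hwm (by omega) (by omega))
    rcases le_or_gt (k + 1) ((n + 1) / 2) with h | h
    · rw [min_eq_left h, min_eq_left (by omega)]
      have h2 : ((k : ℝ) + 1) ^ (-β) ≤ 1 :=
        Real.rpow_le_one_of_one_le_of_nonpos (by linarith [k.cast_nonneg (α := ℝ)]) (by linarith)
      have h3 : 0 ≤ 2 ^ β * ((n + 1 : ℕ) : ℝ) ^ (-β) * (w (k + 1) - w k) := by positivity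
      nlinarith
    · rw [min_eq_right h.le, min_eq_right (by omega), sub_self, zero_add, mul_comm]
      gcongr
      rw [← one_div_one_div (2 : ℝ), Real.div_rpow zero_le_one (by norm_num), Real.one_rpow,
        one_div ((1 / 2 : ℝ) ^ β), ← Real.rpow_neg (by norm_num),
        ← Real.mul_rpow (by norm_num) hn'.le]
      refine Real.rpow_le_rpow_of_nonpos (by positivity) ?_ (by linarith)
      have : ((n + 1 : ℕ) : ℝ) ≤ ((2 * (k + 1) : ℕ) : ℝ) := by exact_mod_cast (by omega)
      push_cast at this ⊢
      linarith
  refine (Finset.sum_le_sum h1).trans ?_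
  rw [Finset.sum_add_distrib, ← Finset.mul_sum, Finset.sum_range_sub,
    Finset.sum_range_sub (fun k => w (min k ((n + 1) / 2)))]
  -- Early nodes lie below t_{n+1}/2, hence at distance at least (1/2 − θ) t_{n+1} from the offset
  -- node.
  have h2 : w (min n ((n + 1) / 2)) ≤
      (1 / 2 - θ) ^ (-β) / Real.Gamma (1 - β) * node T r N (n + 1) ^ (-β) := by
    rw [← omega_compl_mul (by linarith) hp]
    refine omega_compl_anti hβ0 hβ1 (mul_pos (by linarith) hp) ?_
    have h3 := node_le_half (T := T) (r := r) hT hr hN (n := n + 1) (by omega)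
      (show 2 * min n ((n + 1) / 2) ≤ n + 1 by omega)
    have h4 := mul_nonneg hθ0 (node_nonneg (T := T) (r := r) (N := N) hT n)
    rw [hx, offsetNode_succ]
    linarith
  -- The late part telescopes to the kernel at distance (1 − θ)τ_{n+1}, and t_{n+1} ≤ (n + 1)τ_{n+1}
  -- converts the product into t_{n+1}^(−β).
  have h3 : ((n + 1 : ℕ) : ℝ) ^ (-β) * w n ≤
      (1 - θ) ^ (-β) / Real.Gamma (1 - β) * node T r N (n + 1) ^ (-β) := by
    have h4 : x - node T r N n = (1 - θ) * step T r N (n + 1) := by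
      rw [hx, offsetNode_succ, step_succ]; ring
    have h5 := step_pos (T := T) (r := r) hT hr hN (k := n + 1) (by omega)
    have h6 := node_le_mul_step (T := T) (r := r) hT hr hN (k := n + 1) (by omega)
    have h7 := Real.rpow_le_rpow_of_nonpos hp h6 (by linarith : -β ≤ 0)
    simp only [hw]
    rw [h4, omega_compl_mul (by linarith) h5]
    rw [Real.mul_rpow hn'.le h5.le] at h7
    have h8 := mul_le_mul_of_nonneg_left h7
      (show 0 ≤ (1 - θ) ^ (-β) / Real.Gamma (1 - β) by
        have : 0 < 1 - θ := by linarith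
        positivity)
    linarith
  have h4 : 0 < w (min 0 ((n + 1) / 2)) := hwp (by omega)
  have h5 : 0 < w 0 := hwp (by omega)
  have h6 : 2 ^ β * ((n + 1 : ℕ) : ℝ) ^ (-β) * (w n - w 0) ≤
      2 ^ β * (((n + 1 : ℕ) : ℝ) ^ (-β) * w n) := by
    rw [mul_assoc]
    gcongr
    linarith
  have h7 := mul_le_mul_of_nonneg_left h3 (by positivity : (0 : ℝ) ≤ 2 ^ β)
  calc _ ≤ (1 / 2 - θ) ^ (-β) / Real.Gamma (1 - β) * node T r N (n + 1) ^ (-β) +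
        2 ^ β * ((1 - θ) ^ (-β) / Real.Gamma (1 - β) * node T r N (n + 1) ^ (-β)) := by linarith
    _ = _ := by ring

/-- Common frame for both schemes: p k is the derivative of the interpolant on step k. On past steps
w − p k has mean zero, so the increment of the kernel suffices; the step carrying the singularity is
left as a hypothesis. -/
theorem norm_fracInt_sub_le [CompleteSpace E] (hβ0 : 0 < β) (hβ1 : β < 1) (hθ1 : θ < 1)
    (hT : 0 < T) (hr : 1 ≤ r) (hN : 1 ≤ N) {n : ℕ} {w : ℝ → E} {p : ℕ → ℝ → E} {c e : ℝ}
    (hw : IntervalIntegrable w volume 0 (offsetNode T r θ N (n + 1)))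
    (hωw : IntervalIntegrable (fun s => omega (1 - β) (offsetNode T r θ N (n + 1) - s) • w s)
      volume 0 (offsetNode T r θ N (n + 1)))
    (hp : ∀ k ≤ n, Continuous (p k))
    (h0 : ∀ k < n, ∫ s in node T r N k..node T r N (k + 1), (w s - p k s) = 0)
    (hQ : ∀ k < n, ∫ s in node T r N k..node T r N (k + 1), ‖w s - p k s‖ ≤
      c * ((k : ℝ) + 1) ^ (-β))
    (hlast : ‖∫ s in node T r N n..offsetNode T r θ N (n + 1),
      omega (1 - β) (offsetNode T r θ N (n + 1) - s) • (w s - p n s)‖ ≤ e) :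
    ‖fracInt (1 - β) w (offsetNode T r θ N (n + 1)) -
      (∑ k ∈ Finset.range n, (∫ s in node T r N k..node T r N (k + 1),
        omega (1 - β) (offsetNode T r θ N (n + 1) - s) • p k s) +
      ∫ s in node T r N n..offsetNode T r θ N (n + 1),
        omega (1 - β) (offsetNode T r θ N (n + 1) - s) • p n s)‖ ≤
      c * (∑ k ∈ Finset.range n,
        (omega (1 - β) (offsetNode T r θ N (n + 1) - node T r N (k + 1))
        - omega (1 - β) (offsetNode T r θ N (n + 1) - node T r N k)) * ((k : ℝ) + 1) ^ (-β)) + e := by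
  set x := offsetNode T r θ N (n + 1) with hx
  set t : ℕ → ℝ := node T r N with ht
  have htx : ∀ {k}, k ≤ n → t k < x := fun {k} hk =>
    (node_le hT hr hN hk).trans_lt (node_lt_offsetNode hT hr hN hθ1 n)
  have ht0 : ∀ k, 0 ≤ t k := fun k => node_nonneg hT k
  have hlt : ∀ k, t k < t (k + 1) := fun k => node_lt hT hr hN (Nat.lt_succ_self k)
  have hx0 : 0 < x := (ht0 0).trans_lt (htx (Nat.zero_le n))
  have hsub : ∀ {a b : ℝ} {f : ℝ → E}, 0 ≤ a → a ≤ b → b ≤ x → IntervalIntegrable f volume 0 x →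
      IntervalIntegrable f volume a b := fun {a b f} ha hab hb hf =>
    hf.mono_set (by rw [uIcc_of_le hab, uIcc_of_le hx0.le]; exact Icc_subset_Icc ha hb)
  have hω : IntervalIntegrable (fun s => omega (1 - β) (x - s)) volume 0 x := by
    simpa using intervalIntegrable_omega_mul_rpow (γ := 1 - β) (by linarith) one_pos hx0
  have hωp : ∀ k ≤ n, IntervalIntegrable (fun s => omega (1 - β) (x - s) • p k s) volume 0 x :=
    fun k hk => hω.smul_continuousOn (hp k hk).continuousOn
  have hsplit : fracInt (1 - β) w x =
      ∑ k ∈ Finset.range n, (∫ s in t k..t (k + 1), omega (1 - β) (x - s) • w s) +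
        ∫ s in t n..x, omega (1 - β) (x - s) • w s := by
    rw [intervalIntegral.sum_integral_adjacent_intervals fun k hk =>
      hsub (ht0 k) (hlt k).le (htx (by omega)).le hωw, fracInt,
      show t 0 = 0 from node_zero hr,
      intervalIntegral.integral_add_adjacent_intervals
        (hsub le_rfl (ht0 n) (htx le_rfl).le hωw) (hsub (ht0 n) (htx le_rfl).le le_rfl hωw)]
  have hsum : ∀ k ∈ Finset.range n,
      ‖(∫ s in t k..t (k + 1), omega (1 - β) (x - s) • w s) -
        ∫ s in t k..t (k + 1), omega (1 - β) (x - s) • p k s‖ ≤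
      c * ((omega (1 - β) (x - t (k + 1)) - omega (1 - β) (x - t k)) * ((k : ℝ) + 1) ^ (-β)) := by
    intro k hk
    have hkn := Finset.mem_range.1 hk
    have hd : 0 ≤ omega (1 - β) (x - t (k + 1)) - omega (1 - β) (x - t k) :=
      sub_nonneg.2 (omega_compl_anti hβ0 hβ1 (sub_pos.2 (htx hkn)) (by linarith [hlt k]))
    rw [← intervalIntegral.integral_sub (hsub (ht0 k) (hlt k).le (htx hkn).le hωw)
      (hsub (ht0 k) (hlt k).le (htx hkn).le (hωp k hkn.le))]
    simp_rw [← smul_sub]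
    refine (norm_integral_smul_le_of_integral_eq_zero (hlt k).le
      (continuousOn_omega_sub.mono fun y hy => hy.2.trans_lt (htx hkn))
      ((monotoneOn_omega_sub hβ0 hβ1).mono fun y hy => hy.2.trans_lt (htx hkn))
      ((hsub (ht0 k) (hlt k).le (htx hkn).le hw).sub ((hp k hkn.le).intervalIntegrable _ _))
      (h0 k hkn)).trans ?_
    have := mul_le_mul_of_nonneg_left (hQ k hkn) hd
    linarith
  have e1 : ∀ a b c d : E, a + b - (c + d) = (a - c) + (b - d) := fun a b c d => by abel
  rw [hsplit, e1, ← Finset.sum_sub_distrib]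
  refine (norm_add_le _ _).trans (add_le_add ?_ ?_)
  · refine (norm_sum_le _ _).trans ?_
    rw [Finset.mul_sum]
    exact Finset.sum_le_sum hsum
  · rw [← intervalIntegral.integral_sub (hsub (ht0 n) (htx le_rfl).le le_rfl hωw)
      (hsub (ht0 n) (htx le_rfl).le le_rfl (hωp n le_rfl))]
    simp_rw [← smul_sub]
    exact hlast

end History

/-! ### Mean value inequalities -/

section MeanValue

variable {E : Type*} [NormedAddCommGroup E] [NormedSpace ℝ E]

theorem norm_sub_sub_smul_le {f f' : ℝ → E} {a b M : ℝ} {c : E}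
    (hf : ∀ x ∈ Icc a b, HasDerivAt f (f' x) x) (hM : ∀ x ∈ Icc a b, ‖f' x - c‖ ≤ M) {x y : ℝ}
    (hx : x ∈ Icc a b) (hy : y ∈ Icc a b) (hxy : x ≤ y) :
    ‖f y - f x - (y - x) • c‖ ≤ M * (y - x) := by
  have h := norm_image_sub_le_of_norm_deriv_le_segment' (f := fun z => f z - z • c)
    (f' := fun z => f' z - c) (a := x) (b := y) (C := M)
    (fun z hz => by
      have hz' : z ∈ Icc a b := ⟨hx.1.trans hz.1, hz.2.trans hy.2⟩
      have h2 : HasDerivAt (fun z => f z - z • c) (f' z - (1 : ℝ) • c) z :=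
        (hf z hz').sub ((hasDerivAt_id z).smul_const c)
      rw [one_smul] at h2
      exact h2.hasDerivWithinAt)
    (fun z hz => hM z ⟨hx.1.trans hz.1, hz.2.le.trans hy.2⟩) y (right_mem_Icc.2 hxy)
  convert h using 2
  module

theorem norm_slope_sub_le {f f' : ℝ → E} {a b M : ℝ} {c : E}
    (hf : ∀ x ∈ Icc a b, HasDerivAt f (f' x) x) (hM : ∀ x ∈ Icc a b, ‖f' x - c‖ ≤ M) {x y : ℝ}
    (hx : x ∈ Icc a b) (hy : y ∈ Icc a b) (hxy : x < y) :
    ‖(y - x)⁻¹ • (f y - f x) - c‖ ≤ M := by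
  have h := norm_sub_sub_smul_le hf hM hx hy hxy.le
  have h0 : 0 < y - x := sub_pos.2 hxy
  have e : (y - x)⁻¹ • (f y - f x) - c = (y - x)⁻¹ • (f y - f x - (y - x) • c) := by
    rw [smul_sub (y - x)⁻¹ (f y - f x), inv_smul_smul₀ h0.ne']
  rw [e, norm_smul, norm_inv, Real.norm_of_nonneg h0.le, inv_mul_le_iff₀ h0, mul_comm]
  exact h

end MeanValue

/-- `v 0` is continuous on `[0, T]`, and its derivatives `v l` are singular at `0` like those of
`t ^ β`, up to order three. -/
structure HasSingularDerivs (β T K : ℝ) (v : ℕ → ℝ → ℂ) : Prop where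
  cont : ContinuousOn (v 0) (Icc 0 T)
  deriv : ∀ l t, 0 < t → HasDerivAt (v l) (v (l + 1) t) t
  bound : ∀ l, 1 ≤ l → l ≤ 3 → ∀ t ∈ Ioc 0 T, ‖v l t‖ ≤ K * t ^ (β - l)

/-! ### Integrability, slopes and Taylor remainders under singular derivative bounds -/

namespace HasSingularDerivs

variable {β T K : ℝ} {v : ℕ → ℝ → ℂ}

theorem continuousOn_Ioi (h : HasSingularDerivs β T K v) (l : ℕ) : ContinuousOn (v l) (Ioi 0) :=
  fun _ ht => (h.deriv l _ ht).continuousAt.continuousWithinAt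

theorem norm_le_of_le (h : HasSingularDerivs β T K v) (hK : 0 ≤ K) (hβ1 : β < 1) {l : ℕ}
    (hl1 : 1 ≤ l) (hl3 : l ≤ 3) {a s : ℝ} (ha : 0 < a) (hs : s ∈ Icc a T) :
    ‖v l s‖ ≤ K * a ^ (β - l) := by
  refine (h.bound l hl1 hl3 s ⟨ha.trans_le hs.1, hs.2⟩).trans ?_
  have : (1 : ℝ) ≤ l := by exact_mod_cast hl1
  exact mul_le_mul_of_nonneg_left
    (Real.rpow_le_rpow_of_nonpos ha hs.1 (by linarith)) hK

theorem intervalIntegrable (h : HasSingularDerivs β T K v) (hβ0 : 0 < β) {x : ℝ} (hx0 : 0 < x)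
    (hxT : x ≤ T) : IntervalIntegrable (v 1) volume 0 x := by
  have h1 : IntervalIntegrable (fun s : ℝ => K * s ^ (β - 1)) volume 0 x :=
    (intervalIntegral.intervalIntegrable_rpow' (by linarith)).const_mul K
  refine h1.mono_fun' ?_ ?_
  · rw [uIoc_of_le hx0.le]
    exact ((h.continuousOn_Ioi 1).mono fun s hs => hs.1).aestronglyMeasurable measurableSet_Ioc
  · rw [uIoc_of_le hx0.le]
    refine (ae_restrict_iff' measurableSet_Ioc).2 (Filter.Eventually.of_forall fun s hs => ?_)
    simpa using h.bound 1 le_rfl (by norm_num) s ⟨hs.1, hs.2.trans hxT⟩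

theorem norm_omega_smul_le (h : HasSingularDerivs β T K v) (hβ1 : β < 1) {x s : ℝ}
    (hxT : x ≤ T) (hs : s ∈ Ioc 0 x) :
    ‖omega (1 - β) (x - s) • v 1 s‖ ≤ K * (omega (1 - β) (x - s) * s ^ (β - 1)) := by
  have h0 : 0 ≤ omega (1 - β) (x - s) := omega_nonneg (by linarith) (by linarith [hs.2])
  rw [norm_smul, Real.norm_of_nonneg h0, mul_left_comm]
  gcongr
  simpa using h.bound 1 le_rfl (by norm_num) s ⟨hs.1, hs.2.trans hxT⟩

theorem intervalIntegrable_omega_smul (h : HasSingularDerivs β T K v) (hβ0 : 0 < β) (hβ1 : β < 1)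
    {x : ℝ} (hx0 : 0 < x) (hxT : x ≤ T) :
    IntervalIntegrable (fun s => omega (1 - β) (x - s) • v 1 s) volume 0 x := by
  have h1 := (intervalIntegrable_omega_mul_rpow (γ := 1 - β) (by linarith) hβ0 hx0).const_mul K
  refine h1.mono_fun' ?_ ?_
  · rw [uIoc_of_le hx0.le]
    have : AEStronglyMeasurable (v 1) (volume.restrict (Ioc 0 x)) :=
      ((h.continuousOn_Ioi 1).mono fun s hs => hs.1).aestronglyMeasurable measurableSet_Ioc
    exact (((measurable_omega (1 - β)).comp (measurable_const.sub measurable_id)).aestronglyMeasurable).smul this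
  · rw [uIoc_of_le hx0.le]
    exact (ae_restrict_iff' measurableSet_Ioc).2
      (Filter.Eventually.of_forall fun s hs => h.norm_omega_smul_le hβ1 hxT hs)

theorem integral_eq_sub (h : HasSingularDerivs β T K v) (hβ0 : 0 < β) {a b : ℝ} (ha : 0 ≤ a)
    (hab : a ≤ b) (hb0 : 0 < b) (hbT : b ≤ T) : ∫ s in a..b, v 1 s = v 0 b - v 0 a := by
  refine intervalIntegral.integral_eq_sub_of_hasDerivAt_of_le hab
    (h.cont.mono (Icc_subset_Icc ha hbT)) (fun x hx => h.deriv 0 x (ha.trans_lt hx.1)) ?_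
  refine (h.intervalIntegrable hβ0 hb0 hbT).mono_set ?_
  rw [uIcc_of_le hab, uIcc_of_le hb0.le]
  exact Icc_subset_Icc_left ha

theorem integral_norm_le (h : HasSingularDerivs β T K v) (hβ0 : 0 < β) {b : ℝ} (hb0 : 0 < b)
    (hbT : b ≤ T) : ∫ s in (0 : ℝ)..b, ‖v 1 s‖ ≤ K * (b ^ β / β) := by
  have h1 : ∫ s in (0 : ℝ)..b, K * s ^ (β - 1) = K * (b ^ β / β) := by
    rw [intervalIntegral.integral_const_mul, integral_rpow (Or.inl (by linarith)), sub_add_cancel,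
      Real.zero_rpow hβ0.ne', sub_zero]
  rw [← h1]
  refine intervalIntegral.integral_mono_ae_restrict hb0.le (h.intervalIntegrable hβ0 hb0 hbT).norm
    ((intervalIntegral.intervalIntegrable_rpow' (by linarith)).const_mul K) ?_
  have h2 : (volume.restrict (Icc 0 b)) = volume.restrict (Ioc 0 b) :=
    Measure.restrict_congr_set Ioc_ae_eq_Icc.symm
  rw [h2]
  refine (ae_restrict_iff' measurableSet_Ioc).2 (Filter.Eventually.of_forall fun s hs => ?_)
  simpa using h.bound 1 le_rfl (by norm_num) s ⟨hs.1, hs.2.trans hbT⟩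

theorem norm_sub_le (h : HasSingularDerivs β T K v) (hβ0 : 0 < β) {a b : ℝ} (ha : 0 ≤ a)
    (hab : a ≤ b) (hb0 : 0 < b) (hbT : b ≤ T) : ‖v 0 b - v 0 a‖ ≤ K * (b ^ β / β) := by
  rw [← h.integral_eq_sub hβ0 ha hab hb0 hbT]
  refine (intervalIntegral.norm_integral_le_integral_norm hab).trans ?_
  refine le_trans ?_ (h.integral_norm_le hβ0 hb0 hbT)
  exact intervalIntegral.integral_mono_interval ha hab le_rfl
    (Filter.Eventually.of_forall fun _ => norm_nonneg _) (h.intervalIntegrable hβ0 hb0 hbT).norm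

theorem norm_one_sub_le (h : HasSingularDerivs β T K v) (hK : 0 ≤ K) (hβ1 : β < 1) {a b : ℝ}
    (ha : 0 < a) (hbT : b ≤ T) {s : ℝ} (hs : s ∈ Icc a b) :
    ‖v 1 s - v 1 a‖ ≤ K * a ^ (β - 2) * (b - a) := by
  have h1 := norm_sub_sub_smul_le (c := (0 : ℂ)) (f := v 1) (M := K * a ^ (β - 2))
    (fun x (hx : x ∈ Icc a b) => h.deriv 1 x (ha.trans_le hx.1))
    (fun x hx => by
      simpa using h.norm_le_of_le hK hβ1 (l := 2) (by norm_num) (by norm_num) ha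
        ⟨hx.1, hx.2.trans hbT⟩) (left_mem_Icc.2 (hs.1.trans hs.2)) hs hs.1
  rw [smul_zero, sub_zero] at h1
  refine h1.trans ?_
  have := Real.rpow_pos_of_pos ha (β - 2)
  gcongr
  exact hs.2

theorem norm_sub_slope_le (h : HasSingularDerivs β T K v) (hK : 0 ≤ K) (hβ1 : β < 1) {a b : ℝ}
    (ha : 0 < a) (hbT : b ≤ T) {s : ℝ} (hs : s ∈ Icc a b) (hab : a < b) :
    ‖v 1 s - (b - a)⁻¹ • (v 0 b - v 0 a)‖ ≤ 2 * (K * a ^ (β - 2) * (b - a)) := by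
  have h1 := h.norm_one_sub_le hK hβ1 ha hbT hs
  have h2 := norm_slope_sub_le (f := v 0)
    (fun x (hx : x ∈ Icc a b) => h.deriv 0 x (ha.trans_le hx.1))
    (fun x hx => h.norm_one_sub_le hK hβ1 ha hbT hx) (left_mem_Icc.2 hab.le)
    (right_mem_Icc.2 hab.le) hab
  have h3 := norm_sub_le_norm_sub_add_norm_sub (v 1 s) (v 1 a) ((b - a)⁻¹ • (v 0 b - v 0 a))
  rw [norm_sub_rev (v 1 a)] at h3
  linarith

theorem norm_taylor_one_le (h : HasSingularDerivs β T K v) (hK : 0 ≤ K) (hβ1 : β < 1) {a b : ℝ}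
    (ha : 0 < a) (hbT : b ≤ T) {s : ℝ} (hs : s ∈ Icc a b) :
    ‖v 1 s - (s - a) • v 2 a - v 1 a‖ ≤ K * a ^ (β - 3) * (b - a) ^ 2 := by
  have h1 : ∀ x ∈ Icc a b, ‖v 2 x - v 2 a‖ ≤ K * a ^ (β - 3) * (b - a) := by
    intro x hx
    have h1 := norm_sub_sub_smul_le (c := (0 : ℂ)) (f := v 2) (M := K * a ^ (β - 3))
      (fun x (hx : x ∈ Icc a b) => h.deriv 2 x (ha.trans_le hx.1))
      (fun x hx => by
        simpa using h.norm_le_of_le hK hβ1 (l := 3) (by norm_num) (by norm_num) ha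
          ⟨hx.1, hx.2.trans hbT⟩) (left_mem_Icc.2 (hx.1.trans hx.2)) hx hx.1
    rw [smul_zero, sub_zero] at h1
    refine h1.trans ?_
    have := Real.rpow_pos_of_pos ha (β - 3)
    gcongr
    exact hx.2
  have h2 := norm_sub_sub_smul_le (f := v 1)
    (fun x (hx : x ∈ Icc a b) => h.deriv 1 x (ha.trans_le hx.1)) h1
    (left_mem_Icc.2 (hs.1.trans hs.2)) hs hs.1
  rw [sub_right_comm] at h2
  refine h2.trans ?_
  have := Real.rpow_pos_of_pos ha (β - 3)
  have : 0 ≤ b - a := by linarith [hs.1, hs.2]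
  rw [pow_two, ← mul_assoc]
  gcongr
  exact hs.2

/-- A difference quotient of a quadratic polynomial is its derivative at the midpoint, so removing
the quadratic Taylor term reduces the claim to the bound on slopes. -/
theorem norm_slope_sub_taylor_le (h : HasSingularDerivs β T K v) (hK : 0 ≤ K) (hβ1 : β < 1)
    {a b c d : ℝ} (ha : 0 < a) (hbT : b ≤ T) (hc : c ∈ Icc a b) (hd : d ∈ Icc a b) (hcd : c < d) :
    ‖(d - c)⁻¹ • (v 0 d - v 0 c) - ((c + d) / 2 - a) • v 2 a - v 1 a‖
      ≤ K * a ^ (β - 3) * (b - a) ^ 2 := by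
  have h1 := norm_slope_sub_le (f := fun s => v 0 s - ((s - a) ^ 2 / 2) • v 2 a)
    (f' := fun s => v 1 s - (s - a) • v 2 a) (c := v 1 a)
    (fun x (hx : x ∈ Icc a b) => by
      refine (h.deriv 0 x (ha.trans_le hx.1)).sub (HasDerivAt.smul_const ?_ _)
      have := ((((hasDerivAt_id x).sub_const a).pow 2).div_const 2)
      refine this.congr_deriv ?_
      simp)
    (fun x hx => h.norm_taylor_one_le hK hβ1 ha hbT hx) hc hd hcd
  refine le_of_eq_of_le ?_ h1
  have h0 : d - c ≠ 0 := (sub_pos.2 hcd).ne'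
  have e : (c + d) / 2 - a = (d - c)⁻¹ * ((d - a) ^ 2 / 2 - (c - a) ^ 2 / 2) := by
    field_simp
    ring
  rw [e]
  congr 1
  module

end HasSingularDerivs

/-! ### Weights of the graded mesh -/

section Mesh

variable {T r β : ℝ} {N : ℕ}

/-- The window of two steps is the one seen by a quadratic interpolant. Its length is O(t_k/k), and
4^r compares t_{k+2} with t_k. -/
theorem node_add_two_sub_le (hT : 0 < T) (hr : 1 ≤ r) (hN : 1 ≤ N) {k : ℕ} (hk : 1 ≤ k) :
    node T r N (k + 2) - node T r N k ≤ (2 * r * 4 ^ r) * (node T r N k / (k + 1)) := by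
  have h1 := step_le_step_succ (T := T) (r := r) hT hr hN (k := k + 1) (by omega)
  have h2 := step_le_mul_node_div (T := T) (r := r) hT hr hN (k := k + 2) (by omega)
  have h3 := node_succ_le (T := T) (r := r) hT hr hN hk
  have h4 := node_succ_le (T := T) (r := r) hT hr hN (k := k + 1) (by omega)
  have hp := node_pos (r := r) hT hN hk
  have hp2 := node_pos (r := r) hT hN (k := k + 2) (by omega)
  have h5 : node T r N (k + 2) ≤ 4 ^ r * node T r N k := by
    rw [show (4 : ℝ) = 2 * 2 by norm_num, Real.mul_rpow (by norm_num) (by norm_num), mul_assoc]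
    refine h4.trans ?_
    gcongr
  have h6 : node T r N (k + 2) / ((k + 2 : ℕ) : ℝ) ≤ 4 ^ r * node T r N k / (k + 1) := by
    push_cast
    gcongr
    linarith
  rw [step_succ] at h1
  have h7 : step T r N (k + 1 + 1) = node T r N (k + 2) - node T r N (k + 1) := rfl
  have h8 : step T r N (k + 2) = node T r N (k + 2) - node T r N (k + 1) := rfl
  have h9 := mul_le_mul_of_nonneg_left h6 (by linarith : 0 ≤ r)
  have e : (2 * r * 4 ^ r) * (node T r N k / (k + 1)) =
      2 * (r * (4 ^ r * node T r N k / (k + 1))) := by ring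
  rw [e]
  linarith

theorem window_rpow_le (hT : 0 < T) (hr : 1 ≤ r) (hN : 1 ≤ N) {k : ℕ} (hk : 1 ≤ k) {h J : ℝ}
    (hJ : 0 ≤ J) (h0 : 0 ≤ h) (hh : h ≤ node T r N (k + 2) - node T r N k) :
    (h / node T r N k) ^ J ≤ (2 * r * 4 ^ r) ^ J * ((k : ℝ) + 1) ^ (-J) := by
  have hp := node_pos (r := r) hT hN hk
  have h1 := hh.trans (node_add_two_sub_le (T := T) (r := r) hT hr hN hk)
  have hk' : (0 : ℝ) < k + 1 := by positivity
  rw [Real.rpow_neg hk'.le, ← div_eq_mul_inv, ← Real.div_rpow (by positivity) hk'.le]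
  refine Real.rpow_le_rpow (by positivity) ?_ hJ
  rw [div_le_iff₀ hp]
  refine h1.trans_eq ?_
  ring

/-- The integral over step k of a remainder of order J. The condition m ≤ rβ extracts N^(−m) from
t^β, and m ≤ J − β leaves the weight (k + 1)^(−β) that the history sum can absorb. -/
theorem node_rpow_mul_window_le (hT : 0 < T) (hr : 1 ≤ r) (hN : 1 ≤ N) (hβ : 0 < β) {m : ℝ} {k : ℕ}
    (hk : 1 ≤ k) (hkN : k + 1 ≤ N) {h J : ℝ} (hm : m ≤ r * β) (hmJ : m ≤ J - β)
    (hJ : 0 ≤ J) (h0 : 0 ≤ h) (hh : h ≤ node T r N (k + 2) - node T r N k) :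
    node T r N k ^ β * (h / node T r N k) ^ J ≤
      (2 * r * 4 ^ r) ^ J * (T ^ β * (N : ℝ) ^ (-m)) * ((k : ℝ) + 1) ^ (-β) := by
  have hp := node_pos (r := r) hT hN hk
  have h1 := window_rpow_le hT hr hN hk hJ h0 hh
  have h2 := node_rpow_mul_le (r := r) hT hN J hm (k := k + 1) (by omega) hkN
  have h3 : node T r N k ^ β ≤ node T r N (k + 1) ^ β :=
    Real.rpow_le_rpow hp.le (node_le hT hr hN (by omega)) hβ.le
  have h4 : ((k + 1 : ℕ) : ℝ) ^ (-(J - m)) ≤ ((k + 1 : ℕ) : ℝ) ^ (-β) :=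
    Real.rpow_le_rpow_of_exponent_le (by push_cast; linarith [k.cast_nonneg (α := ℝ)])
      (by linarith)
  have hN' : (0 : ℝ) < N := by positivity
  have hr0 : 0 < r := by linarith
  have hp' := node_pos (r := r) hT hN (k := k + 1) (by omega)
  push_cast at h2 h4
  calc _ ≤ node T r N (k + 1) ^ β * ((2 * r * 4 ^ r) ^ J * ((k : ℝ) + 1) ^ (-J)) := by gcongr
    _ = (2 * r * 4 ^ r) ^ J * (node T r N (k + 1) ^ β * ((k : ℝ) + 1) ^ (-J)) := by ring
    _ ≤ (2 * r * 4 ^ r) ^ J * (T ^ β * (N : ℝ) ^ (-m) * ((k : ℝ) + 1) ^ (-(J - m))) := by gcongr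
    _ ≤ (2 * r * 4 ^ r) ^ J * (T ^ β * (N : ℝ) ^ (-m) * ((k : ℝ) + 1) ^ (-β)) := by gcongr
    _ = _ := by ring

theorem rpow_neg_le_node_rpow (hT : 0 < T) (hN : 1 ≤ N) {m J : ℝ} {k : ℕ} (hkN : k + 1 ≤ N)
    (hm : m ≤ r * β) (hmJ : m ≤ J) :
    ((k : ℝ) + 1) ^ (-J) ≤ (T ^ β * (N : ℝ) ^ (-m)) * node T r N (k + 1) ^ (-β) := by
  have hp := node_pos (r := r) hT hN (k := k + 1) (by omega)
  have h2 := node_rpow_mul_le (r := r) hT hN J hm (k := k + 1) (by omega) hkN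
  have h4 : ((k + 1 : ℕ) : ℝ) ^ (-(J - m)) ≤ 1 :=
    Real.rpow_le_one_of_one_le_of_nonpos (by push_cast; linarith [k.cast_nonneg (α := ℝ)])
      (by linarith)
  have hN' : (0 : ℝ) < N := by positivity
  have h5 : 0 < T ^ β * (N : ℝ) ^ (-m) := by positivity
  have h6 := h2.trans (mul_le_mul_of_nonneg_left h4 h5.le)
  push_cast at h6
  rw [Real.rpow_neg hp.le β, ← div_eq_mul_inv, le_div_iff₀ (Real.rpow_pos_of_pos hp _)]
  linarith

theorem node_one_rpow_le (hT : 0 < T) (hN : 1 ≤ N) {m : ℝ} (hm : m ≤ r * β) :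
    node T r N 1 ^ β ≤ T ^ β * (N : ℝ) ^ (-m) := by
  have h2 := node_rpow_mul_le (r := r) hT hN 0 hm (k := 1) le_rfl hN
  simpa using h2

end Mesh

/-! ### First, past and last steps, and the truncation error of the L1 scheme -/

section Truncation

variable {T r β θ : ℝ} {N : ℕ}

/-- It shows that at t_1 a residual of size O(1) already has the admissible form t_1^(−β) N^(−m). -/
theorem one_le_node_rpow (hT : 0 < T) (hN : 1 ≤ N) {m : ℝ} (hm : m ≤ r * β) :
    1 ≤ (T ^ β * (N : ℝ) ^ (-m)) * node T r N 1 ^ (-β) := by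
  have hp := node_pos (r := r) hT hN (k := 1) le_rfl
  rw [Real.rpow_neg hp.le, ← div_eq_mul_inv, le_div_iff₀ (Real.rpow_pos_of_pos hp _), one_mul]
  exact node_one_rpow_le hT hN hm

/-- The kernel integrated against a bounded function over the last, incomplete, step. -/
theorem norm_integral_last_le (hT : 0 < T) (hr : 1 ≤ r) (hN : 1 ≤ N) (hβ1 : β < 1)
    (hθ0 : 0 ≤ θ) (hθ1 : θ < 1) {n : ℕ} {q : ℝ → ℂ} {M : ℝ} (hM : 0 ≤ M)
    (hq : ∀ s ∈ Icc (node T r N n) (offsetNode T r θ N (n + 1)), ‖q s‖ ≤ M) :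
    ‖∫ s in node T r N n..offsetNode T r θ N (n + 1),
      omega (1 - β) (offsetNode T r θ N (n + 1) - s) • q s‖ ≤
      M * (step T r N (n + 1) ^ (1 - β) / Real.Gamma (2 - β)) := by
  have hG := Real.Gamma_pos_of_pos (by linarith : 0 < 2 - β)
  have h0 := node_lt_offsetNode (T := T) (r := r) hT hr hN hθ1 n
  have h1 := offsetNode_le_node (T := T) (r := r) hT hr hN hθ0 n
  set x := offsetNode T r θ N (n + 1)
  have hω : IntervalIntegrable (fun s => omega (1 - β) (x - s)) volume (node T r N n) x := by
    have hn := node_nonneg (T := T) (r := r) (N := N) hT n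
    have hx0 : 0 < x := by linarith
    have : IntervalIntegrable (fun s => omega (1 - β) (x - s)) volume 0 x := by
      simpa using intervalIntegrable_omega_mul_rpow (γ := 1 - β) (by linarith) one_pos hx0
    refine this.mono_set ?_
    rw [uIcc_of_le h0.le, uIcc_of_le hx0.le]
    exact Icc_subset_Icc_left hn
  refine (intervalIntegral.norm_integral_le_of_norm_le h0.le
    (Filter.Eventually.of_forall fun s hs => ?_) (hω.const_mul M)).trans ?_
  · have h2 : 0 ≤ omega (1 - β) (x - s) := omega_nonneg (by linarith) (by linarith [hs.2])
    rw [norm_smul, Real.norm_of_nonneg h2, mul_comm]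
    exact mul_le_mul_of_nonneg_right (hq s (Ioc_subset_Icc_self hs)) h2
  · rw [intervalIntegral.integral_const_mul, integral_omega_sub_right (by linarith) h0,
      show 1 + (1 - β) = 2 - β by ring]
    have : (x - node T r N n) ^ (1 - β) ≤ step T r N (n + 1) ^ (1 - β) :=
      Real.rpow_le_rpow (by linarith) (by rw [step_succ]; linarith) (by linarith)
    gcongr

/-- A remainder of order `J` on the last step. -/
theorem last_step_weight_le (hT : 0 < T) (hr : 1 ≤ r) (hN : 1 ≤ N) (hβ1 : β < 1)
    {m J : ℝ} (hm : m ≤ r * β) (hmJ : m ≤ J - β) (hJ : 1 ≤ J) {n : ℕ} (hn : 1 ≤ n)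
    (hnN : n + 1 ≤ N) :
    node T r N n ^ (β - J) * step T r N (n + 1) ^ (J - 1) * step T r N (n + 1) ^ (1 - β) ≤
      (2 * r * 4 ^ r) ^ (J - β) *
        (T ^ β * (N : ℝ) ^ (-m) * node T r N (n + 1) ^ (-β)) := by
  have hp := node_pos (r := r) hT hN hn
  have hs := step_pos (T := T) (r := r) hT hr hN (k := n + 1) (by omega)
  have hs2 := step_pos (T := T) (r := r) hT hr hN (k := n + 2) (by omega)
  have e : node T r N n ^ (β - J) * step T r N (n + 1) ^ (J - 1) * step T r N (n + 1) ^ (1 - β)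
      = (step T r N (n + 1) / node T r N n) ^ (J - β) := by
    rw [mul_assoc, ← Real.rpow_add hs, Real.div_rpow hs.le hp.le,
      show β - J = -(J - β) by ring, Real.rpow_neg hp.le, show J - 1 + (1 - β) = J - β by ring]
    ring
  rw [e]
  refine (window_rpow_le hT hr hN hn (by linarith) hs.le ?_).trans ?_
  · have : step T r N (n + 2) = node T r N (n + 2) - node T r N (n + 1) := rfl
    rw [step_succ]
    linarith
  · have := rpow_neg_le_node_rpow (r := r) hT hN hnN hm hmJ
    have hr0 : 0 < r := by linarith
    gcongr

/-- At the initial singularity there is no cancellation to exploit. The derivative contributes KΓ(β)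
through the beta integral, and the slope is bounded by the total variation K t_1^β/β. -/
theorem HasSingularDerivs.norm_integral_first_le {K : ℝ} {v : ℕ → ℝ → ℂ}
    (h : HasSingularDerivs β T K v) (hT : 0 < T) (hr : 1 ≤ r) (hN : 1 ≤ N) (hβ0 : 0 < β)
    (hβ1 : β < 1) (hθ0 : 0 ≤ θ) (hθ1 : θ < 1) :
    ‖∫ s in node T r N 0..offsetNode T r θ N 1, omega (1 - β) (offsetNode T r θ N 1 - s) •
      (v 1 s - (step T r N 1)⁻¹ • (v 0 (node T r N 1) - v 0 (node T r N 0)))‖ ≤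
      K * (Real.Gamma β + 1 / (β * Real.Gamma (2 - β))) := by
  have hG := Real.Gamma_pos_of_pos (by linarith : 0 < 2 - β)
  have h0 := node_lt_offsetNode (T := T) (r := r) hT hr hN hθ1 0
  have h1 := offsetNode_le_node (T := T) (r := r) hT hr hN hθ0 0
  have h2 := node_le_T (T := T) (r := r) hT hr hN hN
  have hp := node_pos (T := T) (r := r) hT hN (k := 1) le_rfl
  simp only [zero_add] at h0 h1
  have hl := norm_integral_last_le (T := T) (r := r) hT hr hN hβ1 hθ0 hθ1 (n := 0)
    (q := fun _ => (step T r N 1)⁻¹ • (v 0 (node T r N 1) - v 0 (node T r N 0)))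
    (norm_nonneg _) (fun s _ => le_rfl)
  have h3 := h.norm_sub_le hβ0 le_rfl hp.le hp h2
  have hs : step T r N 1 = node T r N 1 := by
    have := step_succ (T := T) (r := r) (N := N) 0
    rw [node_zero hr] at this
    simpa using this
  rw [node_zero hr] at h0 hl ⊢
  simp only [zero_add] at hl
  set x := offsetNode T r θ N 1
  have hi := h.intervalIntegrable_omega_smul hβ0 hβ1 h0 (h1.trans h2)
  have hω : IntervalIntegrable (fun s => omega (1 - β) (x - s)) volume 0 x := by
    simpa using intervalIntegrable_omega_mul_rpow (γ := 1 - β) (by linarith) one_pos h0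
  have hωp := intervalIntegrable_omega_mul_rpow (γ := 1 - β) (by linarith) hβ0 h0
  simp_rw [smul_sub (omega _ _)]
  rw [intervalIntegral.integral_sub hi (hω.smul_continuousOn continuousOn_const)]
  have h4 : ‖∫ s in (0 : ℝ)..x, omega (1 - β) (x - s) • v 1 s‖ ≤ K * Real.Gamma β := by
    refine (intervalIntegral.norm_integral_le_of_norm_le h0.le
      (Filter.Eventually.of_forall fun s hs => h.norm_omega_smul_le hβ1 (h1.trans h2) hs)
      (hωp.const_mul K)).trans_eq ?_
    rw [intervalIntegral.integral_const_mul, integral_omega_mul_rpow (by linarith) hβ0 h0]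
    simp
  refine (_root_.norm_sub_le _ _).trans ?_
  rw [mul_add]
  refine add_le_add h4 (hl.trans ?_)
  rw [hs, norm_smul, norm_inv, Real.norm_of_nonneg hp.le]
  set y := node T r N 1
  have e : K * (1 / (β * Real.Gamma (2 - β))) =
      y⁻¹ * (K * (y ^ β / β)) * (y ^ (1 - β) / Real.Gamma (2 - β)) := by
    rw [Real.rpow_sub hp, Real.rpow_one]
    have := Real.rpow_pos_of_pos hp β
    field_simp
  rw [e]
  gcongr

theorem HasSingularDerivs.integral_norm_sub_first_le {K : ℝ} {v : ℕ → ℝ → ℂ}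
    (h : HasSingularDerivs β T K v) (hβ0 : 0 < β) {b M : ℝ} (hb0 : 0 < b) (hbT : b ≤ T)
    {p : ℝ → ℂ} (hp : Continuous p) (hM : ∀ s ∈ Icc 0 b, ‖p s‖ ≤ M) :
    ∫ s in (0 : ℝ)..b, ‖v 1 s - p s‖ ≤ K * (b ^ β / β) + M * b := by
  have hi := h.intervalIntegrable hβ0 hb0 hbT
  have hpi : IntervalIntegrable p volume 0 b := hp.intervalIntegrable _ _
  have h1 : ∫ s in (0 : ℝ)..b, ‖v 1 s - p s‖ ≤ ∫ s in (0 : ℝ)..b, (‖v 1 s‖ + M) :=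
    intervalIntegral.integral_mono_on hb0.le (hi.sub hpi).norm (hi.norm.add (by simp)) fun s hs =>
      (_root_.norm_sub_le _ _).trans (by gcongr; exact hM s hs)
  rw [intervalIntegral.integral_add hi.norm (by simp), intervalIntegral.integral_const] at h1
  have h2 := h.integral_norm_le hβ0 hb0 hbT
  rw [sub_zero, smul_eq_mul, mul_comm] at h1
  linarith

/-- A remainder of order `J` on a past step. -/
theorem integral_norm_step_le (hT : 0 < T) (hr : 1 ≤ r) (hN : 1 ≤ N) (hβ : 0 < β) {m : ℝ} {k : ℕ}
    (hk : 1 ≤ k) (hkN : k + 1 ≤ N) {h J : ℝ} (hm : m ≤ r * β) (hmJ : m ≤ J - β) (hJ : 1 ≤ J)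
    (hh : h ≤ node T r N (k + 2) - node T r N k) (hτ : step T r N (k + 1) ≤ h)
    {M : ℝ} (hM0 : 0 ≤ M) {q : ℝ → ℂ}
    (hq : ∀ s ∈ Icc (node T r N k) (node T r N (k + 1)),
      ‖q s‖ ≤ M * (node T r N k ^ (β - J) * h ^ (J - 1))) :
    ∫ s in node T r N k..node T r N (k + 1), ‖q s‖ ≤
      M * ((2 * r * 4 ^ r) ^ J * (T ^ β * (N : ℝ) ^ (-m)) * ((k : ℝ) + 1) ^ (-β)) := by
  have hp := node_pos (r := r) hT hN hk
  have hs := step_pos (T := T) (r := r) hT hr hN (k := k + 1) (by omega)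
  have hh0 : 0 < h := hs.trans_le hτ
  have hle := (node_lt (T := T) (r := r) hT hr hN (Nat.lt_succ_self k)).le
  have h1 := intervalIntegral.norm_integral_le_of_norm_le_const (f := fun s => ‖q s‖)
    (a := node T r N k) (b := node T r N (k + 1))
    (C := M * (node T r N k ^ (β - J) * h ^ (J - 1))) (fun s hs => by
      rw [uIoc_of_le hle] at hs
      rw [norm_norm]
      exact hq s (Ioc_subset_Icc_self hs))
  refine (le_abs_self _).trans (h1.trans ?_)
  rw [← step_succ, abs_of_pos hs, mul_assoc]
  refine mul_le_mul_of_nonneg_left ?_ hM0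
  refine le_trans ?_ (node_rpow_mul_window_le hT hr hN hβ hk hkN hm hmJ (by linarith) hh0.le hh)
  rw [Real.div_rpow hh0.le hp.le, Real.rpow_sub hp, Real.rpow_sub_one hh0.ne']
  have := Real.rpow_pos_of_pos hh0 J
  have := Real.rpow_pos_of_pos hp J
  have := Real.rpow_pos_of_pos hp β
  calc _ ≤ node T r N k ^ β / node T r N k ^ J * (h ^ J / h) * h := by gcongr
    _ = _ := by field_simp

theorem l1Kernel_smul (n k : ℕ) (d : ℂ) :
    l1Kernel T r β N (n + 1) (k + 1) • d = ∫ s in node T r N k..node T r N (k + 1),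
      omega (1 - β) (node T r N (n + 1) - s) • ((step T r N (k + 1))⁻¹ • d) := by
  rw [intervalIntegral.integral_smul_const, l1Kernel, mul_comm, mul_smul]
  rfl

/-- The L1 derivative integrates the kernel against piecewise constant slopes. These approximate the
derivative with remainder order J = 2, hence the cap 2 − β. -/
theorem exists_l1_truncation_le (hT : 0 < T) (hr : 1 ≤ r) (hβ0 : 0 < β) (hβ1 : β < 1) {m : ℝ}
    (hm : m ≤ r * β) (hmJ : m ≤ 2 - β) :
    ∃ C, 0 ≤ C ∧ ∀ (N : ℕ), 1 ≤ N → ∀ (v : ℕ → ℝ → ℂ) (K : ℝ), 0 ≤ K →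
      HasSingularDerivs β T K v → ∀ n < N,
      ‖fracInt (1 - β) (v 1) (node T r N (n + 1)) - ∑ k ∈ Finset.range (n + 1),
        l1Kernel T r β N (n + 1) (k + 1) • (v 0 (node T r N (k + 1)) - v 0 (node T r N k))‖ ≤
      C * (K * (N : ℝ) ^ (-m) * node T r N (n + 1) ^ (-β)) := by
  have hG := Real.Gamma_pos_of_pos (by linarith : 0 < 2 - β)
  have hGβ := Real.Gamma_pos_of_pos hβ0
  have hr0 : 0 < r := by linarith
  obtain ⟨C, hC0, hC⟩ := exists_sum_omega_increment_le (θ := 0) hβ0 hβ1 le_rfl (by norm_num)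
  refine ⟨((2 / β + 2 * (2 * r * 4 ^ r) ^ (2 : ℝ)) * C + ((Real.Gamma β + 1 / (β * Real.Gamma (2 - β)))
    + 2 * (2 * r * 4 ^ r) ^ (2 - β) / Real.Gamma (2 - β))) * T ^ β, by positivity,
    fun N hN v K hK h n hn => ?_⟩
  set t := node T r N with ht
  have hlt : ∀ k, t k < t (k + 1) := fun k => node_lt hT hr hN (Nat.lt_succ_self k)
  have ht0 : ∀ k, 0 ≤ t k := fun k => node_nonneg hT k
  have htp : ∀ {k}, 1 ≤ k → 0 < t k := fun hk => node_pos hT hN hk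
  have htT : ∀ {k}, k ≤ N → t k ≤ T := fun hk => node_le_T hT hr hN hk
  have hN' : (0 : ℝ) < N := by positivity
  set δ : ℕ → ℂ := fun k => (step T r N (k + 1))⁻¹ • (v 0 (t (k + 1)) - v 0 (t k)) with hδ
  have hx : offsetNode T r 0 N (n + 1) = t (n + 1) := by rw [offsetNode_succ]; simp [ht]
  have hosc : ∀ k, 1 ≤ k → k + 1 ≤ N → ∀ s ∈ Icc (t k) (t (k + 1)),
      ‖v 1 s - δ k‖ ≤ 2 * (K * t k ^ (β - 2) * step T r N (k + 1)) := fun k hk hkN s hs =>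
    h.norm_sub_slope_le hK hβ1 (htp hk) (htT hkN) hs (hlt k)
  have main := norm_fracInt_sub_le (θ := 0) (w := v 1) (p := fun k _ => δ k)
    (c := (2 / β + 2 * (2 * r * 4 ^ r) ^ (2 : ℝ)) * (K * (T ^ β * (N : ℝ) ^ (-m))))
    (e := ((Real.Gamma β + 1 / (β * Real.Gamma (2 - β)))
    + 2 * (2 * r * 4 ^ r) ^ (2 - β) / Real.Gamma (2 - β)) *
      (K * (T ^ β * (N : ℝ) ^ (-m) * t (n + 1) ^ (-β)))) hβ0 hβ1 one_pos hT hr hN (n := n)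
    (by rw [hx]; exact h.intervalIntegrable hβ0 (htp (by omega)) (htT hn))
    (by rw [hx]; exact h.intervalIntegrable_omega_smul hβ0 hβ1 (htp (by omega)) (htT hn))
    (fun k _ => continuous_const) ?_ ?_ ?_
  · rw [hx] at main
    refine (le_of_eq ?_).trans (main.trans ?_)
    · congr 2
      rw [Finset.sum_range_succ, l1Kernel_smul]
      congr 1
      exact Finset.sum_congr rfl fun k _ => l1Kernel_smul n k _
    · have h1 := hC T r hT hr N hN n
      rw [hx] at h1
      have h2 := mul_le_mul_of_nonneg_left h1 (show 0 ≤ (2 / β + 2 * (2 * r * 4 ^ r) ^ (2 : ℝ)) *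
        (K * (T ^ β * (N : ℝ) ^ (-m))) by positivity)
      refine (add_le_add_left h2 _).trans_eq ?_
      ring
  · intro k hk
    rw [intervalIntegral.integral_sub _ (by simp), h.integral_eq_sub hβ0 (ht0 k) (hlt k).le
      (htp (by omega)) (htT (by omega)), intervalIntegral.integral_const, hδ]
    · have := (sub_pos.2 (hlt k)).ne'
      simp only [step_succ]
      rw [smul_inv_smul₀ this, sub_self]
    · refine (h.intervalIntegrable hβ0 (htp (k := k + 1) (by omega)) (htT (by omega))).mono_set ?_
      rw [uIcc_of_le (hlt k).le, uIcc_of_le (ht0 _)]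
      exact Icc_subset_Icc_left (ht0 k)
  · intro k hk
    have hpos : 0 ≤ (K * (T ^ β * (N : ℝ) ^ (-m))) * ((k : ℝ) + 1) ^ (-β) := by positivity
    rcases Nat.eq_zero_or_pos k with rfl | hk1
    · have hδ0 : ‖δ 0‖ * t 1 ≤ K * (t 1 ^ β / β) := by
        have h1 := h.norm_sub_le hβ0 le_rfl (htp le_rfl).le (htp le_rfl) (htT hN)
        have h2 : t 0 = 0 := node_zero hr
        have h3 := htp (k := 1) le_rfl
        simp only [hδ, zero_add, step_succ]
        rw [show node T r N 0 = 0 from node_zero hr, h2, sub_zero, norm_smul, norm_inv,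
          Real.norm_of_nonneg h3.le]
        change (t 1)⁻¹ * _ * t 1 ≤ _
        rw [mul_right_comm, inv_mul_cancel₀ h3.ne', one_mul]
        exact h1
      have h1 := h.integral_norm_sub_first_le hβ0 (htp le_rfl) (htT hN) (p := fun _ => δ 0)
        continuous_const (fun _ _ => le_rfl)
      have h2 := node_one_rpow_le (r := r) (β := β) hT hN hm
      have h3 : 0 ≤ 2 * (2 * r * 4 ^ r) ^ (2 : ℝ) * (K * (T ^ β * (N : ℝ) ^ (-m))) := by positivity
      rw [show node T r N 0 = 0 from node_zero hr, zero_add]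
      have h4 : K * (t 1 ^ β / β) ≤ 1 / β * (K * (T ^ β * (N : ℝ) ^ (-m))) := by
        rw [mul_div_assoc', one_div_mul_eq_div]
        gcongr
      simp only [Nat.cast_zero, zero_add, Real.one_rpow, mul_one]
      have e : 2 / β = 1 / β + 1 / β := by ring
      rw [e]
      refine h1.trans ?_
      linarith
    · have h1 := integral_norm_step_le (q := fun s => v 1 s - δ k) (M := 2 * K) (J := 2)
        (h := step T r N (k + 1)) hT hr hN hβ0 hk1 (by omega) hm hmJ (by norm_num)
        (by
          have := hlt (k + 1)
          rw [step_succ]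
          simp only [ht] at this
          linarith) le_rfl (by positivity) (fun s hs => by
          refine (hosc k hk1 (by omega) s hs).trans_eq ?_
          rw [show (2 : ℝ) - 1 = 1 by norm_num, Real.rpow_one]
          ring)
      refine h1.trans ?_
      have h2 : 0 ≤ 2 / β * (K * (T ^ β * (N : ℝ) ^ (-m))) * ((k : ℝ) + 1) ^ (-β) := by positivity
      linarith
  · have h1 : 0 ≤ K * (T ^ β * (N : ℝ) ^ (-m) * t (n + 1) ^ (-β)) := by
      have := htp (k := n + 1) (by omega)
      positivity
    rcases Nat.eq_zero_or_pos n with rfl | hn1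
    · refine (h.norm_integral_first_le (θ := 0) hT hr hN hβ0 hβ1 le_rfl one_pos).trans ?_
      have h2 := one_le_node_rpow (r := r) (β := β) hT hN hm
      have h3 : 0 ≤ 2 * (2 * r * 4 ^ r) ^ (2 - β) / Real.Gamma (2 - β) := by positivity
      have h4 : 0 ≤ Real.Gamma β + 1 / (β * Real.Gamma (2 - β)) := by positivity
      have h5 := mul_nonneg h3 h1
      have h6 := mul_le_mul_of_nonneg_left (mul_le_mul_of_nonneg_left h2 hK) h4
      rw [add_mul]
      simp only [zero_add, ht] at h5 ⊢
      linarith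
    · have hs := step_pos (T := T) (r := r) hT hr hN (k := n + 1) (by omega)
      have hp := htp hn1
      refine (norm_integral_last_le (M := 2 * (K * t n ^ (β - 2) * step T r N (n + 1))) hT hr hN hβ1
        le_rfl one_pos (by positivity) (fun s hs => ?_)).trans ?_
      · rw [hx] at hs
        exact hosc n hn1 hn s hs
      · have h2 := last_step_weight_le (J := 2) hT hr hN hβ1 hm hmJ (by norm_num) hn1 hn
        rw [show (2 : ℝ) - 1 = 1 by norm_num, Real.rpow_one] at h2
        have h3 := mul_le_mul_of_nonneg_left h2
          (show 0 ≤ 2 * K / Real.Gamma (2 - β) by positivity)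
        have h4 : 0 ≤ Real.Gamma β + 1 / (β * Real.Gamma (2 - β)) := by positivity
        have h5 := mul_nonneg h4 h1
        calc _ = 2 * K / Real.Gamma (2 - β) * (t n ^ (β - 2) * step T r N (n + 1) *
              step T r N (n + 1) ^ (1 - β)) := by ring
          _ ≤ 2 * K / Real.Gamma (2 - β) * ((2 * r * 4 ^ r) ^ (2 - β) *
              (T ^ β * (N : ℝ) ^ (-m) * t (n + 1) ^ (-β))) := h3
          _ = 2 * (2 * r * 4 ^ r) ^ (2 - β) / Real.Gamma (2 - β) *
              (K * (T ^ β * (N : ℝ) ^ (-m) * t (n + 1) ^ (-β))) := by ring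
          _ ≤ _ := by rw [add_mul]; linarith

end Truncation

/-! ### Alikhanov's kernel as quadratic interpolation -/

section Alikhanov

variable {T r β : ℝ} {N : ℕ}

theorem alikhanovKernel_of_lt {n k : ℕ} (hk : k < n) :
    alikhanovKernel T r β N (n + 1) (k + 1) = alikhanovA T r β N (n + 1) (k + 1)
      + (if k = 0 then 0 else stepRatio T r N k * alikhanovB T r β N (n + 1) k)
      - alikhanovB T r β N (n + 1) (k + 1) := by
  rw [alikhanovKernel, if_neg (by omega), if_neg (by omega)]
  rcases k with _ | k
  · simp
  · rw [if_neg (by omega), if_neg (by omega)]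
    rfl

theorem alikhanovKernel_self (n : ℕ) :
    alikhanovKernel T r β N (n + 1) (n + 1) = alikhanovA T r β N (n + 1) (n + 1)
      + (if n = 0 then 0 else stepRatio T r N n * alikhanovB T r β N (n + 1) n) := by
  rw [alikhanovKernel]
  rcases n with _ | n
  · simp
  · rw [if_neg (by omega), if_pos rfl, if_neg (by omega)]
    rfl

/-- The discrete derivative of Alikhanov integrates the derivatives of the piecewise quadratic
interpolants against the kernel. -/
theorem sum_alikhanovKernel_smul (hT : 0 < T) (hr : 1 ≤ r) (hN : 1 ≤ N) (hβ0 : 0 < β)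
    (hβ1 : β < 1) (n : ℕ) (d : ℕ → ℂ) :
    ∑ k ∈ Finset.range (n + 1), alikhanovKernel T r β N (n + 1) (k + 1) • d k =
      ∑ k ∈ Finset.range n, (∫ s in node T r N k..node T r N (k + 1),
        omega (1 - β) (offsetNode T r (β / 2) N (n + 1) - s) •
          ((step T r N (k + 1))⁻¹ • d k +
            ((s - (node T r N k + node T r N (k + 1)) / 2) *
              (2 / (node T r N (k + 2) - node T r N k))) •
            ((step T r N (k + 2))⁻¹ • d (k + 1) - (step T r N (k + 1))⁻¹ • d k))) +
      ∫ s in node T r N n..offsetNode T r (β / 2) N (n + 1),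
        omega (1 - β) (offsetNode T r (β / 2) N (n + 1) - s) • ((step T r N (n + 1))⁻¹ • d n) := by
  have hlast : ∫ s in node T r N n..offsetNode T r (β / 2) N (n + 1),
        omega (1 - β) (offsetNode T r (β / 2) N (n + 1) - s) • ((step T r N (n + 1))⁻¹ • d n) =
      alikhanovA T r β N (n + 1) (n + 1) • d n := by
    rw [intervalIntegral.integral_smul_const, alikhanovA, if_pos rfl, mul_comm, mul_smul]
    rfl
  have hpiece : ∀ k ∈ Finset.range n, (∫ s in node T r N k..node T r N (k + 1),
        omega (1 - β) (offsetNode T r (β / 2) N (n + 1) - s) •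
          ((step T r N (k + 1))⁻¹ • d k +
            ((s - (node T r N k + node T r N (k + 1)) / 2) *
              (2 / (node T r N (k + 2) - node T r N k))) •
            ((step T r N (k + 2))⁻¹ • d (k + 1) - (step T r N (k + 1))⁻¹ • d k))) =
      (alikhanovA T r β N (n + 1) (k + 1) - alikhanovB T r β N (n + 1) (k + 1)) • d k +
        (stepRatio T r N (k + 1) * alikhanovB T r β N (n + 1) (k + 1)) • d (k + 1) := by
    -- The constant slope yields the coefficient a, and the linear term of zero mean yields b,
    -- shared between the increments over steps k + 1 and k + 2.
    intro k hk
    have hkn := Finset.mem_range.1 hk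
    set x := offsetNode T r (β / 2) N (n + 1) with hx
    have hlt := node_lt (T := T) (r := r) hT hr hN (Nat.lt_succ_self k)
    have htx : node T r N (k + 1) < x :=
      (node_le hT hr hN hkn).trans_lt (node_lt_offsetNode hT hr hN (by linarith) n)
    have hc : ContinuousOn (fun s => omega (1 - β) (x - s)) (Icc (node T r N k) (node T r N (k + 1))) :=
      continuousOn_omega_sub.mono fun y hy => hy.2.trans_lt htx
    simp_rw [smul_add, smul_smul]
    rw [intervalIntegral.integral_add
      (intervalIntegrable_of_continuousOn_Icc hlt.le (by fun_prop))
      (intervalIntegrable_of_continuousOn_Icc hlt.le (by fun_prop)),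
      intervalIntegral.integral_smul_const, intervalIntegral.integral_smul_const,
      intervalIntegral.integral_mul_const]
    have e1 : ∀ s, omega (1 - β) (x - s) * ((s - (node T r N k + node T r N (k + 1)) / 2) *
              (2 / (node T r N (k + 2) - node T r N k))) =
        (s - (node T r N k + node T r N (k + 1)) / 2) * omega (1 - β) (x - s) *
        (2 / (node T r N (k + 2) - node T r N k)) := fun s => by ring
    simp_rw [e1]
    rw [intervalIntegral.integral_mul_const, alikhanovA, if_neg (by omega), alikhanovB, stepRatio,
      Nat.add_sub_cancel]
    have h1 := step_pos (T := T) (r := r) hT hr hN (k := k + 1) (by omega)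
    have h2 := step_pos (T := T) (r := r) hT hr hN (k := k + 2) (by omega)
    have e2 : node T r N (k + 2) - node T r N k = step T r N (k + 1) + step T r N (k + 2) := by
      have : step T r N (k + 2) = node T r N (k + 2) - node T r N (k + 1) := rfl
      rw [step_succ, this]; ring
    have e3 : step T r N (k + 1 + 1) = step T r N (k + 2) := rfl
    rw [e2, e3]
    set I₀ := ∫ s in node T r N k..node T r N (k + 1), omega (1 - β) (x - s)
    set I₁ := ∫ s in node T r N k..node T r N (k + 1),
      (s - (node T r N k + node T r N (k + 1)) / 2) * omega (1 - β) (x - s)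
    set p := step T r N (k + 1)
    set q := step T r N (k + 2)
    match_scalars
    · field_simp
      ring
    · field_simp
  rw [hlast, Finset.sum_congr rfl hpiece, Finset.sum_add_distrib, Finset.sum_range_succ,
    alikhanovKernel_self, Finset.sum_congr rfl fun k hk => by
      rw [alikhanovKernel_of_lt (T := T) (r := r) (β := β) (N := N) (Finset.mem_range.1 hk)]]
  -- Peeling the same sum from either end moves each ρb term to the increment of the following step;
  -- the summand at k = 0 is zero by definition.
  have h3 := Finset.sum_range_succ' (fun k => (if k = 0 then 0 else
    stepRatio T r N k * alikhanovB T r β N (n + 1) k) • d k) n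
  have h4 := Finset.sum_range_succ (fun k => (if k = 0 then 0 else
    stepRatio T r N k * alikhanovB T r β N (n + 1) k) • d k) n
  rw [h3] at h4
  simp only [Nat.add_eq_zero_iff, one_ne_zero, and_false, if_false, if_true, zero_smul,
    add_zero] at h4
  rw [h4]
  simp only [add_smul, sub_smul, Finset.sum_add_distrib, Finset.sum_sub_distrib]
  abel

/-- The offset of the scheme is chosen so that the kernel has zero moment on the last step. -/
theorem integral_offset_moment (hT : 0 < T) (hr : 1 ≤ r) (hN : 1 ≤ N) (hβ1 : β < 1)
    (n : ℕ) :
    ∫ s in node T r N n..offsetNode T r (β / 2) N (n + 1),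
      omega (1 - β) (offsetNode T r (β / 2) N (n + 1) - s) *
        (s - (node T r N n + node T r N (n + 1)) / 2) = 0 := by
  have hlt := node_lt_offsetNode (T := T) (r := r) (θ := β / 2) hT hr hN (by linarith) n
  have hG := Real.Gamma_pos_of_pos (by linarith : 0 < 1 - β)
  have hG2 := Real.Gamma_pos_of_pos (by linarith : 0 < 2 - β)
  have hx : offsetNode T r (β / 2) N (n + 1)
      = node T r N n + (1 - β / 2) * (node T r N (n + 1) - node T r N n) := by
    rw [offsetNode_succ]; ring
  have hτ := sub_pos.2 (node_lt (T := T) (r := r) hT hr hN (Nat.lt_succ_self n))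
  simp only [Nat.succ_eq_add_one] at hτ
  set x := offsetNode T r (β / 2) N (n + 1)
  set a := node T r N n
  set b := node T r N (n + 1)
  have e1 : Real.Gamma (2 - β) = (1 - β) * Real.Gamma (1 - β) := by
    rw [show 2 - β = 1 - β + 1 by ring, Real.Gamma_add_one (by linarith)]
  have e2 : Real.Gamma (3 - β) = (2 - β) * Real.Gamma (2 - β) := by
    rw [show 3 - β = 2 - β + 1 by ring, Real.Gamma_add_one (by linarith)]
  have h1b : 0 < 1 - β := by linarith
  have h2b : 0 < 2 - β := by linarith
  -- Write s − (a + b)/2 = (x − (a + b)/2) − (x − s) and use (x − s) ω_{1−β}(x − s) = (1 − β)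
  -- ω_{2−β}(x − s); both integrals are then powers of x − a, and they cancel for θ = β/2.
  have e3 : ∀ s ∈ Ioo a x, omega (1 - β) (x - s) * (s - (a + b) / 2) =
      (x - (a + b) / 2) * omega (1 - β) (x - s) - (1 - β) * omega (2 - β) (x - s) := by
    intro s hs
    have hs' : 0 < x - s := sub_pos.2 hs.2
    have e4 : omega (2 - β) (x - s) = (x - s) * omega (1 - β) (x - s) / (1 - β) := by
      rw [omega, omega, e1, show 2 - β - 1 = (1 - β - 1) + 1 by ring, Real.rpow_add_one hs'.ne']
      field_simp
    rw [e4]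
    field_simp
    ring
  rw [intervalIntegral.integral_congr_Ioo_of_le hlt.le e3]
  have hi : ∀ {γ : ℝ}, 0 < γ → IntervalIntegrable (fun s => omega γ (x - s)) volume a x := by
    intro γ hγ
    have ha := node_nonneg (T := T) (r := r) (N := N) hT n
    have hx0 : 0 < x := by linarith
    have : IntervalIntegrable (fun s => omega γ (x - s)) volume 0 x := by
      simpa using intervalIntegrable_omega_mul_rpow hγ one_pos hx0
    refine this.mono_set ?_
    rw [uIcc_of_le hlt.le, uIcc_of_le hx0.le]
    exact Icc_subset_Icc_left ha
  rw [intervalIntegral.integral_sub ((hi h1b).const_mul _) ((hi h2b).const_mul _),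
    intervalIntegral.integral_const_mul, intervalIntegral.integral_const_mul,
    integral_omega_sub_right h1b hlt, integral_omega_sub_right h2b hlt,
    show 1 + (1 - β) = 2 - β by ring, show 1 + (2 - β) = 3 - β by ring, e2,
    show (2 - β) = (1 - β) + 1 by ring, Real.rpow_add_one (sub_pos.2 hlt).ne', hx]
  field_simp
  ring

end Alikhanov

/-! ### Truncation error of the L2-1_σ scheme -/

section AlikhanovTruncation

variable {T r β : ℝ} {N : ℕ}

/-- The derivative of the quadratic interpolant of `v 0` at `a < b < d`, on `[a, b]`. -/
theorem HasSingularDerivs.norm_sub_quadratic_slope_le {K : ℝ} {v : ℕ → ℝ → ℂ}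
    (h : HasSingularDerivs β T K v) (hK : 0 ≤ K) (hβ1 : β < 1) {a b d : ℝ} (ha : 0 < a)
    (hab : a < b) (hbd : b < d) (hdT : d ≤ T) {s : ℝ} (hs : s ∈ Icc a b) :
    ‖v 1 s - ((b - a)⁻¹ • (v 0 b - v 0 a) + ((s - (a + b) / 2) * (2 / (d - a))) •
      ((d - b)⁻¹ • (v 0 d - v 0 b) - (b - a)⁻¹ • (v 0 b - v 0 a)))‖ ≤
      4 * (K * a ^ (β - 3) * (d - a) ^ 2) := by
  have hda : 0 < d - a := by linarith
  have haI : a ∈ Icc a d := ⟨le_rfl, by linarith⟩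
  have hbI : b ∈ Icc a d := ⟨hab.le, hbd.le⟩
  have hdI : d ∈ Icc a d := ⟨by linarith, le_rfl⟩
  have hsI : s ∈ Icc a d := ⟨hs.1, by linarith [hs.2]⟩
  have h1 := h.norm_taylor_one_le hK hβ1 ha hdT hsI
  have h2 := h.norm_slope_sub_taylor_le hK hβ1 ha hdT haI hbI hab
  have h3 := h.norm_slope_sub_taylor_le hK hβ1 ha hdT hbI hdI hbd
  set M := K * a ^ (β - 3) * (d - a) ^ 2
  set δ₁ := (b - a)⁻¹ • (v 0 b - v 0 a)
  set δ₂ := (d - b)⁻¹ • (v 0 d - v 0 b)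
  set w := (s - (a + b) / 2) * (2 / (d - a)) with hw
  have hw1 : |w| ≤ 1 := by
    rw [hw, mul_div_assoc', abs_div, abs_of_pos hda, div_le_one hda, abs_le]
    constructor <;> linarith [hs.1, hs.2]
  -- The two slopes belong to the midpoints (a + b)/2 and (b + d)/2. Extrapolating linearly between
  -- them is exact for the linear Taylor term, which therefore cancels.
  have hwe : w * ((b + d) / 2 - (a + b) / 2) = s - (a + b) / 2 := by
    rw [hw]
    field_simp
    ring
  set e₀ := v 1 s - (s - a) • v 2 a - v 1 a
  set e₁ := δ₁ - ((a + b) / 2 - a) • v 2 a - v 1 a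
  set e₂ := δ₂ - ((b + d) / 2 - a) • v 2 a - v 1 a
  have e : v 1 s - (δ₁ + w • (δ₂ - δ₁)) = e₀ - e₁ - w • (e₂ - e₁) := by
    have : w • (δ₂ - δ₁) = w • (e₂ - e₁) + (w * ((b + d) / 2 - (a + b) / 2)) • v 2 a := by
      simp only [e₁, e₂]
      module
    rw [this, hwe]
    simp only [e₀, e₁]
    module
  rw [e]
  have h4 : ‖w • (e₂ - e₁)‖ ≤ 1 * (M + M) := by
    rw [norm_smul]
    exact mul_le_mul hw1 ((_root_.norm_sub_le _ _).trans (add_le_add h3 h2)) (norm_nonneg _)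
      zero_le_one
  have h5 := _root_.norm_sub_le (e₀ - e₁) (w • (e₂ - e₁))
  have h6 := _root_.norm_sub_le e₀ e₁
  linarith

/-- Quadratic interpolation has remainder order J = 3 on past steps. On the last step the
interpolant is only linear, but the kernel has zero moment there, so the linear Taylor term of the
derivative may be subtracted for free and order 3 is restored. -/
theorem exists_alikhanov_truncation_le (hT : 0 < T) (hr : 1 ≤ r) (hβ0 : 0 < β) (hβ1 : β < 1)
    {m : ℝ} (hm : m ≤ r * β) (hmJ : m ≤ 3 - β) :
    ∃ C, 0 ≤ C ∧ ∀ (N : ℕ), 1 ≤ N → ∀ (v : ℕ → ℝ → ℂ) (K : ℝ), 0 ≤ K →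
      HasSingularDerivs β T K v → ∀ n < N,
      ‖fracInt (1 - β) (v 1) (offsetNode T r (β / 2) N (n + 1)) - ∑ k ∈ Finset.range (n + 1),
        alikhanovKernel T r β N (n + 1) (k + 1) •
          (v 0 (node T r N (k + 1)) - v 0 (node T r N k))‖ ≤
      C * (K * (N : ℝ) ^ (-m) * node T r N (n + 1) ^ (-β)) := by
  have hG := Real.Gamma_pos_of_pos (by linarith : 0 < 2 - β)
  have hGβ := Real.Gamma_pos_of_pos hβ0
  have hr0 : 0 < r := by linarith
  have hθ0 : 0 ≤ β / 2 := by linarith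
  have hθ1 : β / 2 < 1 := by linarith
  obtain ⟨C, hC0, hC⟩ := exists_sum_omega_increment_le (θ := β / 2) hβ0 hβ1 hθ0 (by linarith)
  refine ⟨(((3 + (2 ^ r) ^ β) / β + 4 * (2 * r * 4 ^ r) ^ (3 : ℝ)) * C +
    ((Real.Gamma β + 1 / (β * Real.Gamma (2 - β)))
    + 2 * (2 * r * 4 ^ r) ^ (3 - β) / Real.Gamma (2 - β))) * T ^ β, by positivity,
    fun N hN v K hK h n hn => ?_⟩
  set t := node T r N with ht
  have hlt : ∀ k, t k < t (k + 1) := fun k => node_lt hT hr hN (Nat.lt_succ_self k)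
  have ht0 : ∀ k, 0 ≤ t k := fun k => node_nonneg hT k
  have htp : ∀ {k}, 1 ≤ k → 0 < t k := fun hk => node_pos hT hN hk
  have htT : ∀ {k}, k ≤ N → t k ≤ T := fun hk => node_le_T hT hr hN hk
  have hN' : (0 : ℝ) < N := by positivity
  set δ : ℕ → ℂ := fun k => (step T r N (k + 1))⁻¹ • (v 0 (t (k + 1)) - v 0 (t k)) with hδ
  set x := offsetNode T r (β / 2) N (n + 1) with hx
  have htx : t n < x := node_lt_offsetNode hT hr hN hθ1 n
  have hxt : x ≤ t (n + 1) := offsetNode_le_node hT hr hN hθ0 n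
  have hx0 : 0 < x := (ht0 n).trans_lt htx
  have hxT : x ≤ T := hxt.trans (htT hn)
  -- The parabola on step k uses the node t_{k+2}, which is not available on the last step.
  set p : ℕ → ℝ → ℂ := fun k s => if k < n then
    δ k + ((s - (t k + t (k + 1)) / 2) * (2 / (t (k + 2) - t k))) • (δ (k + 1) - δ k)
    else δ n with hp
  have hpn : p n = fun _ => δ n := by simp [hp]
  have hpk : ∀ {k}, k < n → p k = fun s => δ k +
      ((s - (t k + t (k + 1)) / 2) * (2 / (t (k + 2) - t k))) • (δ (k + 1) - δ k) :=
    fun {k} hk => by simp [hp, hk]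
  have hpc : ∀ k ≤ n, Continuous (p k) := by
    intro k hk
    rcases hk.lt_or_eq with hk | rfl
    · rw [hpk hk]; fun_prop
    · rw [hpn]; exact continuous_const
  have main := norm_fracInt_sub_le (θ := β / 2) (w := v 1) (p := p)
    (c := ((3 + (2 ^ r) ^ β) / β + 4 * (2 * r * 4 ^ r) ^ (3 : ℝ)) * (K * (T ^ β * (N : ℝ) ^ (-m))))
    (e := ((Real.Gamma β + 1 / (β * Real.Gamma (2 - β)))
    + 2 * (2 * r * 4 ^ r) ^ (3 - β) / Real.Gamma (2 - β)) *
      (K * (T ^ β * (N : ℝ) ^ (-m) * t (n + 1) ^ (-β)))) hβ0 hβ1 hθ1 hT hr hN (n := n)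
    (h.intervalIntegrable hβ0 hx0 hxT)
    (h.intervalIntegrable_omega_smul hβ0 hβ1 hx0 hxT) hpc ?_ ?_ ?_
  · refine (le_of_eq ?_).trans (main.trans ?_)
    · congr 2
      rw [sum_alikhanovKernel_smul hT hr hN hβ0 hβ1 n (fun k => v 0 (t (k + 1)) - v 0 (t k)), hpn]
      congr 1
      refine Finset.sum_congr rfl fun k hk => ?_
      rw [hpk (Finset.mem_range.1 hk)]
    · have h1 := hC T r hT hr N hN n
      have h2 := mul_le_mul_of_nonneg_left h1
        (show 0 ≤ ((3 + (2 ^ r) ^ β) / β + 4 * (2 * r * 4 ^ r) ^ (3 : ℝ)) *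
        (K * (T ^ β * (N : ℝ) ^ (-m))) by positivity)
      refine (add_le_add_left h2 _).trans_eq ?_
      ring
  · intro k hk
    change ∫ s in t k..t (k + 1), (v 1 s - p k s) = 0
    have hsl : (t (k + 1) - t k) • δ k = v 0 (t (k + 1)) - v 0 (t k) :=
      smul_inv_smul₀ (sub_pos.2 (hlt k)).ne' _
    have hi : IntervalIntegrable (v 1) volume (t k) (t (k + 1)) := by
      refine (h.intervalIntegrable hβ0 (htp (k := k + 1) (by omega)) (htT (by omega))).mono_set ?_
      rw [uIcc_of_le (hlt k).le, uIcc_of_le (ht0 _)]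
      exact Icc_subset_Icc_left (ht0 k)
    rw [intervalIntegral.integral_sub hi ((hpc k hk.le).intervalIntegrable _ _),
      h.integral_eq_sub hβ0 (ht0 k) (hlt k).le (htp (by omega)) (htT (by omega)), hpk hk,
      intervalIntegral.integral_add (by simp) (Continuous.intervalIntegrable (by fun_prop) _ _),
      intervalIntegral.integral_const, hsl, intervalIntegral.integral_smul_const,
      intervalIntegral.integral_mul_const, integral_sub_mid, zero_mul, zero_smul, add_zero, sub_self]
  · intro k hk
    have hpos : 0 ≤ (K * (T ^ β * (N : ℝ) ^ (-m))) * ((k : ℝ) + 1) ^ (-β) := by positivity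
    rcases Nat.eq_zero_or_pos k with rfl | hk1
    · have h01 : t 0 = 0 := node_zero hr
      have hs1 : step T r N 1 = t 1 := by
        have := step_succ (T := T) (r := r) (N := N) 0
        rw [show node T r N 0 = 0 from h01, sub_zero] at this
        exact this
      have h1p := htp (k := 1) le_rfl
      have hs2 := step_pos (T := T) (r := r) hT hr hN (k := 2) (by omega)
      have hs12 : t 1 ≤ step T r N 2 := by
        rw [← hs1]; exact step_le_step_succ hT hr hN le_rfl
      have hδ0 : ‖δ 0‖ * t 1 ≤ K * (t 1 ^ β / β) := by
        have h1 := h.norm_sub_le hβ0 le_rfl h1p.le h1p (htT hN)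
        simp only [hδ, zero_add]
        rw [hs1, h01, norm_smul, norm_inv,
          Real.norm_of_nonneg h1p.le, mul_right_comm, inv_mul_cancel₀ h1p.ne', one_mul]
        exact h1
      -- The parabola on the first step also involves the slope over the second; t_2 ≤ 2^r t_1 and
      -- t_1 ≤ τ_2 bring it back to t_1, whence (2^r)^β in the constant.
      have hδ1 : ‖δ 1‖ * t 1 ≤ K * ((2 ^ r * t 1) ^ β / β) := by
        have h1 := h.norm_sub_le hβ0 (ht0 1) (hlt 1).le (htp (by omega)) (htT (by omega))
        have h2 : t (1 + 1) ≤ 2 ^ r * t 1 := node_succ_le hT hr hN le_rfl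
        have h3 := Real.rpow_le_rpow (ht0 _) h2 hβ0.le
        calc ‖δ 1‖ * t 1 ≤ ‖δ 1‖ * step T r N 2 := by gcongr
          _ = ‖v 0 (t (1 + 1)) - v 0 (t 1)‖ := by
            simp only [hδ]
            rw [norm_smul, norm_inv, Real.norm_of_nonneg hs2.le, mul_right_comm,
              inv_mul_cancel₀ hs2.ne', one_mul]
          _ ≤ _ := h1.trans (by gcongr)
      have hM : ∀ s ∈ Icc 0 (t 1), ‖p 0 s‖ ≤ ‖δ 0‖ + (‖δ 1‖ + ‖δ 0‖) := by
        intro s hs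
        rw [hpk hk]
        refine (norm_add_le _ _).trans (add_le_add le_rfl ?_)
        have h02 : 0 < t 2 := htp (by omega)
        have h12 : t 1 < t 2 := hlt 1
        rw [norm_smul, zero_add, zero_add, h01, zero_add, sub_zero]
        refine (mul_le_mul (b := 1) ?_ (_root_.norm_sub_le _ _) (norm_nonneg _) zero_le_one).trans_eq
          (one_mul _)
        rw [Real.norm_eq_abs, mul_div_assoc', abs_div, abs_of_pos h02, div_le_one h02, abs_le]
        constructor <;> linarith [hs.1, hs.2]
      have h1 := h.integral_norm_sub_first_le hβ0 h1p (htT hN) (hpc 0 hk.le) hM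
      have h2 := node_one_rpow_le (r := r) (β := β) hT hN hm
      have h3 : 0 ≤ 4 * (2 * r * 4 ^ r) ^ (3 : ℝ) * (K * (T ^ β * (N : ℝ) ^ (-m))) := by positivity
      rw [show node T r N 0 = 0 from node_zero hr, zero_add]
      have h4 : K * (t 1 ^ β) ≤ K * (T ^ β * (N : ℝ) ^ (-m)) := by gcongr
      have h5 := mul_le_mul_of_nonneg_left h4 (show 0 ≤ (3 + (2 ^ r) ^ β) / β by positivity)
      rw [Real.mul_rpow (by positivity) h1p.le] at hδ1
      simp only [Nat.cast_zero, zero_add, Real.one_rpow, mul_one]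
      refine h1.trans ?_
      have e : (3 + (2 ^ r) ^ β) / β * (K * t 1 ^ β) = K * (t 1 ^ β / β) +
          (2 * (K * (t 1 ^ β / β)) + K * ((2 ^ r) ^ β * t 1 ^ β / β)) := by ring
      linarith
    · have h1 := integral_norm_step_le (q := fun s => v 1 s - p k s) (M := 4 * K) (J := 3)
        (h := t (k + 2) - t k) hT hr hN hβ0 hk1 (by omega) hm hmJ (by norm_num) le_rfl
        (by
          have := hlt (k + 1)
          rw [step_succ]
          simp only [ht] at this ⊢
          linarith) (by positivity) (fun s hs => by
          rw [hpk hk]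
          refine (h.norm_sub_quadratic_slope_le hK hβ1 (htp hk1) (hlt k) (hlt (k + 1))
            (htT (by omega)) hs).trans_eq ?_
          rw [show (3 : ℝ) - 1 = (2 : ℕ) by norm_num, Real.rpow_natCast]
          ring)
      refine h1.trans ?_
      have h2 : 0 ≤ (3 + (2 ^ r) ^ β) / β * (K * (T ^ β * (N : ℝ) ^ (-m))) * ((k : ℝ) + 1) ^ (-β) := by
        positivity
      linarith
  · have h1 : 0 ≤ K * (T ^ β * (N : ℝ) ^ (-m) * t (n + 1) ^ (-β)) := by
      have := htp (k := n + 1) (by omega)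
      positivity
    rw [hpn]
    rcases Nat.eq_zero_or_pos n with rfl | hn1
    · refine (h.norm_integral_first_le hT hr hN hβ0 hβ1 hθ0 hθ1).trans ?_
      have h2 := one_le_node_rpow (r := r) (β := β) hT hN hm
      have h3 : 0 ≤ 2 * (2 * r * 4 ^ r) ^ (3 - β) / Real.Gamma (2 - β) := by positivity
      have h4 : 0 ≤ Real.Gamma β + 1 / (β * Real.Gamma (2 - β)) := by positivity
      have h5 := mul_nonneg h3 h1
      have h6 := mul_le_mul_of_nonneg_left (mul_le_mul_of_nonneg_left h2 hK) h4
      rw [add_mul]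
      simp only [zero_add, ht] at h5 ⊢
      linarith
    · have hs := step_pos (T := T) (r := r) hT hr hN (k := n + 1) (by omega)
      have hp := htp hn1
      have hmom := integral_offset_moment (T := T) (r := r) (β := β) hT hr hN hβ1 n
      have hsub : ∀ {f : ℝ → ℂ}, IntervalIntegrable f volume 0 x →
          IntervalIntegrable f volume (t n) x := fun {f} hf => hf.mono_set (by
        rw [uIcc_of_le htx.le, uIcc_of_le hx0.le]; exact Icc_subset_Icc_left (ht0 n))
      have hω : IntervalIntegrable (fun s => omega (1 - β) (x - s)) volume 0 x := by
        simpa using intervalIntegrable_omega_mul_rpow (γ := 1 - β) (by linarith) one_pos hx0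
      -- Zero moment of the kernel: a multiple of s − midpoint is subtracted without changing the
      -- integral.
      have e1 : ∫ s in t n..x, omega (1 - β) (x - s) • (v 1 s - δ n) =
          ∫ s in t n..x, omega (1 - β) (x - s) •
            (v 1 s - δ n - (s - (t n + t (n + 1)) / 2) • v 2 (t n)) := by
        simp_rw [smul_sub (omega _ _)]
        rw [intervalIntegral.integral_sub (f := fun s => omega (1 - β) (x - s) • v 1 s -
            omega (1 - β) (x - s) • δ n)
          (g := fun s => omega (1 - β) (x - s) • (s - (t n + t (n + 1)) / 2) • v 2 (t n))]
        · simp_rw [smul_smul]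
          rw [intervalIntegral.integral_smul_const, hmom, zero_smul, sub_zero]
        · exact hsub ((h.intervalIntegrable_omega_smul hβ0 hβ1 hx0 hxT).sub
            (hω.smul_continuousOn continuousOn_const))
        · exact hsub (hω.smul_continuousOn (by fun_prop))
      change ‖∫ s in t n..x, omega (1 - β) (x - s) • (v 1 s - δ n)‖ ≤ _
      rw [e1]
      refine (norm_integral_last_le (M := 2 * (K * t n ^ (β - 3) * step T r N (n + 1) ^ 2)) hT hr hN
        hβ1 hθ0 hθ1 (by positivity) (fun s hs => ?_)).trans ?_
      · have hsI : s ∈ Icc (t n) (t (n + 1)) := ⟨hs.1, hs.2.trans hxt⟩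
        have h2 := h.norm_taylor_one_le hK hβ1 hp (htT hn) hsI
        have h3 := h.norm_slope_sub_taylor_le hK hβ1 hp (htT hn) (left_mem_Icc.2 (hlt n).le)
          (right_mem_Icc.2 (hlt n).le) (hlt n)
        have e2 : v 1 s - δ n - (s - (t n + t (n + 1)) / 2) • v 2 (t n) =
            (v 1 s - (s - t n) • v 2 (t n) - v 1 (t n)) -
            (δ n - ((t n + t (n + 1)) / 2 - t n) • v 2 (t n) - v 1 (t n)) := by
          module
        rw [e2, two_mul]
        exact (_root_.norm_sub_le _ _).trans (add_le_add h2 h3)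
      · have h2 := last_step_weight_le (J := 3) hT hr hN hβ1 hm hmJ (by norm_num) hn1 hn
        rw [show (3 : ℝ) - 1 = (2 : ℕ) by norm_num, Real.rpow_natCast] at h2
        have h3 := mul_le_mul_of_nonneg_left h2
          (show 0 ≤ 2 * K / Real.Gamma (2 - β) by positivity)
        have h4 : 0 ≤ Real.Gamma β + 1 / (β * Real.Gamma (2 - β)) := by positivity
        have h5 := mul_nonneg h4 h1
        calc _ = 2 * K / Real.Gamma (2 - β) * (t n ^ (β - 3) * step T r N (n + 1) ^ 2 *
              step T r N (n + 1) ^ (1 - β)) := by ring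
          _ ≤ 2 * K / Real.Gamma (2 - β) * ((2 * r * 4 ^ r) ^ (3 - β) *
              (T ^ β * (N : ℝ) ^ (-m) * t (n + 1) ^ (-β))) := h3
          _ = 2 * (2 * r * 4 ^ r) ^ (3 - β) / Real.Gamma (2 - β) *
              (K * (T ^ β * (N : ℝ) ^ (-m) * t (n + 1) ^ (-β))) := by ring
          _ ≤ _ := by rw [add_mul]; linarith

end AlikhanovTruncation

/-! ### The error of the scheme for a single mode -/

section ModeError

variable {T r β θ : ℝ} {N : ℕ}

/-- Linear interpolation at an interior point is of second order, which caps the rate at 2. The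
error carries no singular weight; the factor t_{n+1}^(−β) is inserted by t_{n+1} ≤ T, which accounts
for the second T^β in the constant. -/
theorem exists_offset_le (hT : 0 < T) (hr : 1 ≤ r) (hβ0 : 0 < β) (hβ1 : β < 1) (hθ0 : 0 ≤ θ)
    (hθ1 : θ < 1) {m : ℝ} (hm : m ≤ r * β) (hm2 : m ≤ 2) :
    ∃ C, 0 ≤ C ∧ ∀ (N : ℕ), 1 ≤ N → ∀ (v : ℕ → ℝ → ℂ) (K : ℝ), 0 ≤ K →
      HasSingularDerivs β T K v → ∀ n < N,
      ‖v 0 (offsetNode T r θ N (n + 1)) -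
        (θ • v 0 (node T r N n) + (1 - θ) • v 0 (node T r N (n + 1)))‖ ≤
      C * (K * (N : ℝ) ^ (-m) * node T r N (n + 1) ^ (-β)) := by
  have hr0 : 0 < r := by linarith
  refine ⟨(2 / β + 2 * (2 * r * 4 ^ r) ^ (2 : ℝ)) * T ^ β * T ^ β, by positivity,
    fun N hN v K hK h n hn => ?_⟩
  have hN' : (0 : ℝ) < N := by positivity
  have hlt := node_lt (T := T) (r := r) hT hr hN (Nat.lt_succ_self n)
  have hp1 := node_pos (T := T) (r := r) hT hN (k := n + 1) (by omega)
  have hT1 := node_le_T (T := T) (r := r) hT hr hN (k := n + 1) hn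
  have htx := node_lt_offsetNode (T := T) (r := r) hT hr hN hθ1 n
  have hxt := offsetNode_le_node (T := T) (r := r) hT hr hN hθ0 n
  have hxe : offsetNode T r θ N (n + 1) - node T r N n
      = (1 - θ) * (node T r N (n + 1) - node T r N n) := by
    rw [offsetNode_succ]; ring
  have hn0 := node_nonneg (T := T) (r := r) (N := N) hT n
  simp only [Nat.succ_eq_add_one] at hlt
  have key : ‖v 0 (offsetNode T r θ N (n + 1)) -
        (θ • v 0 (node T r N n) + (1 - θ) • v 0 (node T r N (n + 1)))‖ ≤
      (2 / β + 2 * (2 * r * 4 ^ r) ^ (2 : ℝ)) * (K * (T ^ β * (N : ℝ) ^ (-m))) := by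
    set x := offsetNode T r θ N (n + 1)
    -- Both values are compared with the tangent at t_n. At t_0 = 0 no derivative is available, so a
    -- constant is used instead.
    set c : ℂ := if n = 0 then 0 else v 1 (node T r N n) with hc
    have e : v 0 x - (θ • v 0 (node T r N n) + (1 - θ) • v 0 (node T r N (n + 1))) =
        (v 0 x - v 0 (node T r N n) - (x - node T r N n) • c) - (1 - θ) •
        (v 0 (node T r N (n + 1)) - v 0 (node T r N n) - (node T r N (n + 1) - node T r N n) • c) := by
      rw [hxe]
      module
    have habs : ∀ M, ‖v 0 x - v 0 (node T r N n) - (x - node T r N n) • c‖ ≤ M →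
        ‖v 0 (node T r N (n + 1)) - v 0 (node T r N n) - (node T r N (n + 1) - node T r N n) • c‖ ≤ M →
        ‖v 0 x - (θ • v 0 (node T r N n) + (1 - θ) • v 0 (node T r N (n + 1)))‖ ≤ 2 * M := by
      intro M h1 h2
      have h3 := norm_nonneg
        (v 0 (node T r N (n + 1)) - v 0 (node T r N n) - (node T r N (n + 1) - node T r N n) • c)
      rw [e, two_mul]
      refine (_root_.norm_sub_le _ _).trans (add_le_add h1 ?_)
      rw [norm_smul, Real.norm_of_nonneg (by linarith)]
      nlinarith
    have hA : 0 ≤ 2 / β * (K * (T ^ β * (N : ℝ) ^ (-m))) := by positivity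
    have hB : 0 ≤ 2 * (2 * r * 4 ^ r) ^ (2 : ℝ) * (K * (T ^ β * (N : ℝ) ^ (-m))) := by positivity
    rcases Nat.eq_zero_or_pos n with rfl | hn1
    · have h1 := h.norm_sub_le hβ0 hn0 htx.le (hn0.trans_lt htx) (hxt.trans hT1)
      have h2 := h.norm_sub_le hβ0 hn0 hlt.le hp1 hT1
      have h3 := Real.rpow_le_rpow (hn0.trans htx.le) hxt hβ0.le
      have h4 := node_one_rpow_le (r := r) (β := β) hT hN hm
      simp only [hc, if_true, smul_zero, sub_zero] at habs
      simp only [zero_add] at *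
      refine (habs (K * (node T r N 1 ^ β / β)) (h1.trans (by gcongr)) h2).trans ?_
      have h5 : K * (node T r N 1 ^ β / β) ≤ K * (T ^ β * (N : ℝ) ^ (-m) / β) := by gcongr
      have e2 : 2 / β * (K * (T ^ β * (N : ℝ) ^ (-m))) =
        2 * (K * (T ^ β * (N : ℝ) ^ (-m) / β)) := by ring
      linarith
    · have hp := node_pos (T := T) (r := r) hT hN hn1
      have hτ := step_pos (T := T) (r := r) hT hr hN (k := n + 1) (by omega)
      have hτ2 := step_pos (T := T) (r := r) hT hr hN (k := n + 2) (by omega)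
      have hmv : ∀ {y}, y ∈ Icc (node T r N n) (node T r N (n + 1)) →
          ‖v 0 y - v 0 (node T r N n) - (y - node T r N n) • c‖ ≤
          K * (node T r N n ^ (β - 2) * step T r N (n + 1) ^ (2 : ℝ)) := by
        intro y hy
        rw [hc, if_neg (by omega)]
        refine (norm_sub_sub_smul_le (f := v 0)
          (fun z (hz : z ∈ Icc (node T r N n) (node T r N (n + 1))) =>
            h.deriv 0 z (hp.trans_le hz.1))
          (fun z hz => h.norm_one_sub_le hK hβ1 hp hT1 hz) (left_mem_Icc.2 hlt.le) hy hy.1).trans ?_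
        rw [← step_succ, show (2 : ℝ) = (2 : ℕ) by norm_num, Real.rpow_natCast, pow_two,
          ← mul_assoc, ← mul_assoc]
        have : y - node T r N n ≤ step T r N (n + 1) := by rw [step_succ]; linarith [hy.2]
        push_cast
        gcongr
      refine (habs _ (hmv ⟨htx.le, hxt⟩) (hmv ⟨hlt.le, le_rfl⟩)).trans ?_
      have h1 := window_rpow_le (J := 2) hT hr hN hn1 (by norm_num) hτ.le
        (by
          have : step T r N (n + 2) = node T r N (n + 2) - node T r N (n + 1) := rfl
          rw [step_succ]
          linarith)
      have h2 := node_rpow_mul_le (r := r) hT hN 2 hm (k := n + 1) (by omega) hn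
      have h3 : ((n + 1 : ℕ) : ℝ) ^ (-(2 - m)) ≤ 1 :=
        Real.rpow_le_one_of_one_le_of_nonpos (by push_cast; linarith [n.cast_nonneg (α := ℝ)])
          (by linarith)
      have h4 : node T r N n ^ β ≤ node T r N (n + 1) ^ β :=
        Real.rpow_le_rpow hp.le hlt.le hβ0.le
      have h5 : node T r N n ^ (β - 2) * step T r N (n + 1) ^ (2 : ℝ) ≤
          (2 * r * 4 ^ r) ^ (2 : ℝ) * (T ^ β * (N : ℝ) ^ (-m)) := by
        push_cast at h2 h3
        calc _ = node T r N n ^ β * (step T r N (n + 1) / node T r N n) ^ (2 : ℝ) := by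
              rw [Real.rpow_sub hp, Real.div_rpow hτ.le hp.le]
              ring
          _ ≤ node T r N (n + 1) ^ β * ((2 * r * 4 ^ r) ^ (2 : ℝ) * ((n : ℝ) + 1) ^ (-(2 : ℝ))) := by
            gcongr
          _ = (2 * r * 4 ^ r) ^ (2 : ℝ) * (node T r N (n + 1) ^ β * ((n : ℝ) + 1) ^ (-(2 : ℝ))) := by
            ring
          _ ≤ (2 * r * 4 ^ r) ^ (2 : ℝ) * (T ^ β * (N : ℝ) ^ (-m) * ((n : ℝ) + 1) ^ (-(2 - m))) := by
            gcongr
          _ ≤ (2 * r * 4 ^ r) ^ (2 : ℝ) * (T ^ β * (N : ℝ) ^ (-m) * 1) := by gcongr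
          _ = _ := by ring
      have h6 := mul_le_mul_of_nonneg_left h5 (by positivity : 0 ≤ 2 * K)
      linarith
  refine key.trans ?_
  have h1 : 1 ≤ T ^ β * node T r N (n + 1) ^ (-β) := by
    rw [Real.rpow_neg hp1.le, ← div_eq_mul_inv, one_le_div (Real.rpow_pos_of_pos hp1 _)]
    exact Real.rpow_le_rpow hp1.le hT1 hβ0.le
  have h2 := mul_le_mul_of_nonneg_left h1
    (show 0 ≤ (2 / β + 2 * (2 * r * 4 ^ r) ^ (2 : ℝ)) * (K * (T ^ β * (N : ℝ) ^ (-m))) by positivity)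
  linarith

/-- The solution of a mode, with all its derivatives. -/
def modeSolDerivs (β μ a g : ℝ) : ℕ → ℝ → ℂ
  | 0 => modeSol β μ a g
  | j + 1 => modeSolDeriv β μ a g j

theorem exists_hasSingularDerivs (hT : 0 < T) (hβ0 : 0 < β) (hβ1 : β < 1) :
    ∃ C, 0 ≤ C ∧ ∀ μ a g : ℝ, 0 ≤ μ →
      HasSingularDerivs β T (C * (μ ^ 2 * |a| + μ * |g|)) (modeSolDerivs β μ a g) := by
  choose C hC0 hC using fun j => exists_norm_modeSolDeriv_le hβ0 hβ1 T j
  refine ⟨C 0 + C 1 + C 2, by linarith [hC0 0, hC0 1, hC0 2], fun μ a g hμ => ⟨?_, ?_, ?_⟩⟩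
  · exact continuousOn_modeSol hβ0 hT.le
  · intro l t ht
    rcases l with _ | j
    · exact hasDerivAt_modeSol hβ0 ht
    · exact hasDerivAt_modeSolDeriv hβ0 j ht
  · intro l hl1 hl3 t ht
    obtain ⟨j, rfl⟩ := Nat.exists_eq_add_of_le' hl1
    have h1 := hC j μ a g hμ t ht
    have h2 : 0 ≤ (μ ^ 2 * |a| + μ * |g|) * t ^ (β - (j + 1)) := by
      have := ht.1
      positivity
    have h3 : C j ≤ C 0 + C 1 + C 2 := by
      have : j < 3 := by omega
      interval_cases j <;> linarith [hC0 0, hC0 1, hC0 2]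
    push_cast
    rw [mul_assoc] at h1 ⊢
    exact h1.trans (mul_le_mul_of_nonneg_right h3 h2)

/-- `w` solves the scheme for the mode of frequency `μ`. -/
structure IsModeScheme (T r β θ : ℝ) (N : ℕ) (A : ℕ → ℕ → ℝ) (μ a g : ℝ) (w : ℕ → ℂ) : Prop where
  zero : w 0 = μ * a
  eq : ∀ n < N, ∑ k ∈ Finset.range (n + 1), A (n + 1) (k + 1) • (w (k + 1) - w k) =
    -(μ * Complex.I) * (θ • w n + (1 - θ) • w (n + 1)) +
      μ * g * (omega (2 - β) (offsetNode T r θ N (n + 1)) : ℂ)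

/-- The error solves the scheme with a residual made of the truncation error and −iμ times the
offset error. In the real inner product of ℂ, −iμE^{n−θ} is orthogonal to E^{n−θ} and disappears, so
μ enters only through the residual. The condition `first` turns t^(−β) into A n 1. -/
theorem IsStableKernel.norm_modeSol_sub_le {A : ℕ → ℕ → ℝ} (hA : IsStableKernel T r β θ N A)
    (hT : 0 < T) (hr : 1 ≤ r) (hN : 1 ≤ N) (hβ0 : 0 < β) (hβ1 : β < 1) (hθ0 : 0 ≤ θ)
    (hθ1 : θ < 1 / 2) {μ a g B : ℝ} (hμ : 0 ≤ μ) {w : ℕ → ℂ}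
    (hw : IsModeScheme T r β θ N A μ a g w)
    (hB : ∀ n < N, ‖fracInt (1 - β) (modeSolDeriv β μ a g 0) (offsetNode T r θ N (n + 1)) -
      ∑ k ∈ Finset.range (n + 1), A (n + 1) (k + 1) •
        (modeSol β μ a g (node T r N (k + 1)) - modeSol β μ a g (node T r N k))‖ +
      μ * ‖modeSol β μ a g (offsetNode T r θ N (n + 1)) -
        (θ • modeSol β μ a g (node T r N n) + (1 - θ) • modeSol β μ a g (node T r N (n + 1)))‖ ≤
      B * node T r N (n + 1) ^ (-β)) {n : ℕ} (hn : n ≤ N) :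
    ‖modeSol β μ a g (node T r N n) - w n‖ ≤ 2 * (B * Real.Gamma (1 - β)) := by
  have hG := Real.Gamma_pos_of_pos (by linarith : 0 < 1 - β)
  set V : ℕ → ℂ := fun k => modeSol β μ a g (node T r N k) with hV
  set F : ℕ → ℂ := fun n => fracInt (1 - β) (modeSolDeriv β μ a g 0) (offsetNode T r θ N n) with hF
  set D : ℕ → ℂ := fun n => ∑ k ∈ Finset.range n, A n (k + 1) • (V (k + 1) - V k) with hD
  set O : ℕ → ℂ := fun n => modeSol β μ a g (offsetNode T r θ N n) -
    (θ • V (n - 1) + (1 - θ) • V n) with hO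
  refine hA.norm_le hβ1 hT hN hθ0 hθ1 (E := fun k => V k - w k)
    (R := fun n => -(F n - D n) + -(μ * Complex.I) * O n) ?_ ?_ ?_ hn
  · simp only [hV]
    rw [node_zero hr, modeSol_zero hβ0, hw.zero, sub_self]
  · intro n hn
    have hp := node_pos (T := T) (r := r) hT hN (k := n + 1) (by omega)
    have hBn := hB n hn
    have hB0 : 0 ≤ B := by
      refine nonneg_of_mul_nonneg_left (le_trans ?_ hBn) (Real.rpow_pos_of_pos hp (-β))
      positivity
    have h1 := hA.first (n + 1) (by omega) hn
    have h2 : omega (1 - β) (node T r N (n + 1)) * Real.Gamma (1 - β)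
        = node T r N (n + 1) ^ (-β) := by
      rw [omega, show 1 - β - 1 = -β by ring]
      field_simp
    calc _ ≤ ‖F (n + 1) - D (n + 1)‖ + μ * ‖O (n + 1)‖ := by
          refine (norm_add_le _ _).trans_eq ?_
          rw [norm_neg, norm_mul, norm_neg, norm_mul, Complex.norm_I, Complex.norm_real,
            Real.norm_of_nonneg hμ, mul_one]
      _ ≤ B * node T r N (n + 1) ^ (-β) := hBn
      _ = B * Real.Gamma (1 - β) * omega (1 - β) (node T r N (n + 1)) := by rw [← h2]; ring
      _ ≤ _ := by gcongr
  · intro n hn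
    have hx : 0 < offsetNode T r θ N (n + 1) := (node_nonneg hT n).trans_lt
      (node_lt_offsetNode (T := T) (r := r) hT hr hN (by linarith) n)
    have h1 : F (n + 1) = _ := fracInt_modeSolDeriv (μ := μ) (a := a) (g := g) hβ0 hβ1 hx
    have h2 := hw.eq n hn
    have h3 : ∑ k ∈ Finset.range (n + 1), A (n + 1) (k + 1) • (V (k + 1) - w (k + 1) - (V k - w k)) =
        (-(F (n + 1) - D (n + 1)) + -(μ * Complex.I) * O (n + 1)) +
        -(μ * Complex.I) * (θ • (V n - w n) + (1 - θ) • (V (n + 1) - w (n + 1))) := by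
      have e : ∀ k, A (n + 1) (k + 1) • (V (k + 1) - w (k + 1) - (V k - w k)) =
          A (n + 1) (k + 1) • (V (k + 1) - V k) - A (n + 1) (k + 1) • (w (k + 1) - w k) :=
        fun k => by module
      simp only [e, Finset.sum_sub_distrib]
      rw [h2, h1]
      simp only [hO, hD, Nat.add_sub_cancel, Complex.real_smul]
      ring
    have h4 : ∀ z : ℂ, inner ℝ z (-(μ * Complex.I) * z) = (0 : ℝ) := by
      intro z
      simp [Complex.inner]
      ring
    simp only [h3, inner_add_right, h4, add_zero]

theorem exists_l1_mode_error_le (hT : 0 < T) (hr : 1 ≤ r) (hβ0 : 0 < β) (hβ1 : β < 1) {m : ℝ}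
    (hm : m ≤ r * β) (hm2 : m ≤ 2 - β) :
    ∃ C, 0 ≤ C ∧ ∀ N : ℕ, 1 ≤ N → ∀ (μ a g : ℝ) (w : ℕ → ℂ), 0 ≤ μ →
      IsModeScheme T r β 0 N (l1Kernel T r β N) μ a g w → ∀ n ≤ N,
      ‖modeSol β μ a g (node T r N n) - w n‖ ≤ C * (N : ℝ) ^ (-m) * (μ ^ 2 * |a| + μ * |g|) := by
  have hG := Real.Gamma_pos_of_pos (by linarith : 0 < 1 - β)
  obtain ⟨C₁, h₁0, h₁⟩ := exists_hasSingularDerivs hT hβ0 hβ1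
  obtain ⟨C₂, h₂0, h₂⟩ := exists_l1_truncation_le hT hr hβ0 hβ1 hm hm2
  refine ⟨2 * C₂ * C₁ * Real.Gamma (1 - β), by positivity, fun N hN μ a g w hμ hw n hn => ?_⟩
  have h := (isStableKernel_l1Kernel hT hr hN hβ0 hβ1).norm_modeSol_sub_le hT hr hN hβ0 hβ1 le_rfl
    (by norm_num) hμ hw (B := C₂ * (C₁ * (μ ^ 2 * |a| + μ * |g|) * (N : ℝ) ^ (-m))) ?_ hn
  · refine h.trans_eq ?_
    ring
  · intro n hn
    have hx : offsetNode T r 0 N (n + 1) = node T r N (n + 1) := by rw [offsetNode_succ]; ring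
    have h3 := h₂ N hN _ _ (by positivity) (h₁ μ a g hμ) n hn
    rw [hx, zero_smul, sub_zero, one_smul, zero_add, sub_self, norm_zero, mul_zero, add_zero,
      mul_assoc C₂]
    exact h3

/-- The offset error comes multiplied by μ, hence one power of the frequency more than for L1, where
θ = 0 and there is no offset error. -/
theorem exists_alikhanov_mode_error_le (hT : 0 < T) (hr : 1 ≤ r) (hβ0 : 0 < β) (hβ1 : β < 1)
    {m μ₀ : ℝ} (hm : m ≤ r * β) (hm2 : m ≤ 2) (hμ₀ : 0 < μ₀) :
    ∃ C, 0 ≤ C ∧ ∀ N : ℕ, 1 ≤ N → ∀ (μ a g : ℝ) (w : ℕ → ℂ), μ₀ ≤ μ →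
      IsModeScheme T r β (β / 2) N (alikhanovKernel T r β N) μ a g w → ∀ n ≤ N,
      ‖modeSol β μ a g (node T r N n) - w n‖ ≤ C * (N : ℝ) ^ (-m) * (μ ^ 3 * |a| + μ ^ 2 * |g|) := by
  have hG := Real.Gamma_pos_of_pos (by linarith : 0 < 1 - β)
  obtain ⟨C₁, h₁0, h₁⟩ := exists_hasSingularDerivs hT hβ0 hβ1
  obtain ⟨C₂, h₂0, h₂⟩ := exists_alikhanov_truncation_le hT hr hβ0 hβ1 hm (by linarith)
  obtain ⟨C₃, h₃0, h₃⟩ := exists_offset_le (θ := β / 2) hT hr hβ0 hβ1 (by linarith) (by linarith)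
    hm hm2
  refine ⟨2 * (C₂ / μ₀ + C₃) * C₁ * Real.Gamma (1 - β), by positivity,
    fun N hN μ a g w hμ' hw n hn => ?_⟩
  have hμ : 0 ≤ μ := hμ₀.le.trans hμ'
  have h := (isStableKernel_alikhanovKernel hT hr hN hβ0 hβ1).norm_modeSol_sub_le hT hr hN hβ0 hβ1
    (by linarith) (by linarith) hμ hw
    (B := (C₂ / μ₀ + C₃) * μ * (C₁ * (μ ^ 2 * |a| + μ * |g|) * (N : ℝ) ^ (-m))) ?_ hn
  · refine h.trans_eq ?_
    ring
  · intro n hn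
    have hp := node_pos (T := T) (r := r) hT hN (k := n + 1) (by omega)
    have hK : 0 ≤ C₁ * (μ ^ 2 * |a| + μ * |g|) := by positivity
    have h4 := h₂ N hN _ _ hK (h₁ μ a g hμ) n hn
    have h5 := mul_le_mul_of_nonneg_left (h₃ N hN _ _ hK (h₁ μ a g hμ) n hn) hμ
    refine (add_le_add h4 h5).trans ?_
    set X := C₁ * (μ ^ 2 * |a| + μ * |g|) * (N : ℝ) ^ (-m) * node T r N (n + 1) ^ (-β)
    have hX : 0 ≤ X := by positivity
    -- Frequencies are bounded below, so the truncation error fits under the same power of μ.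
    have h6 : C₂ ≤ C₂ / μ₀ * μ := by
      rw [div_mul_eq_mul_div, le_div_iff₀ hμ₀]
      gcongr
    have h7 := mul_le_mul_of_nonneg_right h6 hX
    calc C₂ * X + μ * (C₃ * X) ≤ C₂ / μ₀ * μ * X + μ * (C₃ * X) := by linarith
      _ = (C₂ / μ₀ + C₃) * μ * X := by ring
      _ = _ := by simp only [X]; ring

end ModeError

/-! ### Sine and cosine bases of `L²(0, L)` -/

section Trigonometric

variable {L : ℝ}

theorem integral_cos_int (hL : 0 < L) (m : ℤ) :
    ∫ x in (0 : ℝ)..L, Real.cos (m * Real.pi / L * x) = if m = 0 then L else 0 := by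
  split_ifs with h
  · simp [h]
  · have hc : (m : ℝ) * Real.pi / L ≠ 0 := by
      have : (m : ℝ) ≠ 0 := by exact_mod_cast h
      have := Real.pi_ne_zero
      positivity
    rw [intervalIntegral.integral_comp_mul_left (fun x => Real.cos x) hc, integral_cos,
      div_mul_cancel₀ _ hL.ne', mul_zero, Real.sin_zero, Real.sin_int_mul_pi]
    simp

theorem integral_sin_mul_sin (hL : 0 < L) (j k : ℕ) :
    ∫ x in (0 : ℝ)..L, Real.sin ((j + 1 : ℕ) * Real.pi / L * x) *
      Real.sin ((k + 1 : ℕ) * Real.pi / L * x) = if j = k then L / 2 else 0 := by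
  have e : ∀ x, Real.sin ((j + 1 : ℕ) * Real.pi / L * x) * Real.sin ((k + 1 : ℕ) * Real.pi / L * x)
      = (Real.cos (((j : ℤ) - k : ℤ) * Real.pi / L * x) -
        Real.cos (((j : ℤ) + k + 2 : ℤ) * Real.pi / L * x)) / 2 := by
    intro x
    have h1 : (((j : ℤ) - k : ℤ) : ℝ) * Real.pi / L * x =
        (j + 1 : ℕ) * Real.pi / L * x - (k + 1 : ℕ) * Real.pi / L * x := by push_cast; ring
    have h2 : (((j : ℤ) + k + 2 : ℤ) : ℝ) * Real.pi / L * x =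
        (j + 1 : ℕ) * Real.pi / L * x + (k + 1 : ℕ) * Real.pi / L * x := by push_cast; ring
    rw [h1, h2, Real.cos_sub, Real.cos_add]
    ring
  simp_rw [e]
  rw [intervalIntegral.integral_div, intervalIntegral.integral_sub
    (Continuous.intervalIntegrable (by fun_prop) _ _)
    (Continuous.intervalIntegrable (by fun_prop) _ _), integral_cos_int hL, integral_cos_int hL]
  have h3 : ((j : ℤ) + k + 2) ≠ 0 := by omega
  have h4 : ((j : ℤ) - k = 0) ↔ j = k := by omega
  simp only [h3, h4, if_false]
  split_ifs <;> simp

theorem integral_cos_mul_cos (hL : 0 < L) (j k : ℕ) :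
    ∫ x in (0 : ℝ)..L, Real.cos ((j + 1 : ℕ) * Real.pi / L * x) *
      Real.cos ((k + 1 : ℕ) * Real.pi / L * x) = if j = k then L / 2 else 0 := by
  have e : ∀ x, Real.cos ((j + 1 : ℕ) * Real.pi / L * x) * Real.cos ((k + 1 : ℕ) * Real.pi / L * x)
      = (Real.cos (((j : ℤ) - k : ℤ) * Real.pi / L * x) +
        Real.cos (((j : ℤ) + k + 2 : ℤ) * Real.pi / L * x)) / 2 := by
    intro x
    have h1 : (((j : ℤ) - k : ℤ) : ℝ) * Real.pi / L * x =
        (j + 1 : ℕ) * Real.pi / L * x - (k + 1 : ℕ) * Real.pi / L * x := by push_cast; ring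
    have h2 : (((j : ℤ) + k + 2 : ℤ) : ℝ) * Real.pi / L * x =
        (j + 1 : ℕ) * Real.pi / L * x + (k + 1 : ℕ) * Real.pi / L * x := by push_cast; ring
    rw [h1, h2, Real.cos_sub, Real.cos_add]
    ring
  simp_rw [e]
  rw [intervalIntegral.integral_div, intervalIntegral.integral_add
    (Continuous.intervalIntegrable (by fun_prop) _ _)
    (Continuous.intervalIntegrable (by fun_prop) _ _), integral_cos_int hL, integral_cos_int hL]
  have h3 : ((j : ℤ) + k + 2) ≠ 0 := by omega
  have h4 : ((j : ℤ) - k = 0) ↔ j = k := by omega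
  simp only [h3, h4, if_false]
  split_ifs <;> simp

theorem integral_omegaMeasure (hL : 0 ≤ L) (f : ℝ → ℝ) :
    ∫ x, f x ∂(omegaMeasure L) = ∫ x in (0 : ℝ)..L, f x := by
  rw [intervalIntegral.integral_of_le hL, ← integral_Icc_eq_integral_Ioc]

/-- A square-integrable function orthogonal to all sines vanishes. -/
theorem ae_eq_zero_of_integral_sin (hL : 0 < L) {f : ℝ → ℝ} (hf : MemLp f 2 (omegaMeasure L))
    (h0 : ∀ k : ℕ, ∫ x, f x * Real.sin ((k + 1 : ℕ) * Real.pi / L * x) ∂(omegaMeasure L) = 0) :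
    f =ᵐ[omegaMeasure L] 0 := by
  -- The odd extension W of f to (−L, L) has only sine components, all zero by hypothesis. Its
  -- Fourier coefficients then vanish, and so does W by Parseval.
  set F : ℝ → ℝ := indicator (Icc 0 L) f with hF
  have hF2 : MemLp F 2 volume := (memLp_indicator_iff_restrict measurableSet_Icc).2 hf
  have hFn2 : MemLp (fun x => F (-x)) 2 volume :=
    hF2.comp_measurePreserving (Measure.measurePreserving_neg volume)
  set W : ℝ → ℂ := fun x => ((F x - F (-x) : ℝ) : ℂ) with hW
  have hW2 : MemLp W 2 volume := (hF2.sub hFn2).ofReal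
  have hLL : -L < L := by linarith
  have hsin : ∀ n : ℤ, ∫ x in (0 : ℝ)..L, f x * Real.sin (n * Real.pi / L * x) = 0 := by
    intro n
    rcases lt_trichotomy n 0 with hn | rfl | hn
    · obtain ⟨k, hk⟩ : ∃ k : ℕ, n = -((k + 1 : ℕ) : ℤ) := ⟨(-n).toNat - 1, by omega⟩
      have h1 := h0 k
      rw [integral_omegaMeasure hL.le] at h1
      rw [hk]
      have e : ∀ x, f x * Real.sin ((-((k + 1 : ℕ) : ℤ) : ℤ) * Real.pi / L * x) =
          -(f x * Real.sin ((k + 1 : ℕ) * Real.pi / L * x)) := by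
        intro x
        rw [← mul_neg, ← Real.sin_neg]
        congr 2
        push_cast
        ring
      simp_rw [e]
      rw [intervalIntegral.integral_neg, h1, neg_zero]
    · simp
    · obtain ⟨k, hk⟩ : ∃ k : ℕ, n = ((k + 1 : ℕ) : ℤ) := ⟨n.toNat - 1, by omega⟩
      have h1 := h0 k
      rw [integral_omegaMeasure hL.le] at h1
      rw [hk]
      exact_mod_cast h1
  have hcoeff : ∀ n : ℤ, fourierCoeffOn hLL W n = 0 := by
    intro n
    rw [fourierCoeffOn_eq_integral]
    set e : ℝ → ℂ := fun x => fourier (-n) (x : AddCircle (L - -L)) with he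
    have hec : Continuous e := by
      rw [he]
      exact (fourier (-n)).continuous.comp (AddCircle.continuous_mk' _)
    have hi : ∀ {c : ℝ → ℂ} {G : ℝ → ℝ}, Continuous c → MemLp G 2 volume →
        IntervalIntegrable (fun x => c x * (G x : ℂ)) volume (-L) L := by
      intro c G hc hG
      have h1 : IntervalIntegrable (fun x => (G x : ℂ)) volume (-L) L := by
        rw [intervalIntegrable_iff_integrableOn_Ioc_of_le hLL.le]
        exact ((hG.restrict (Ioc (-L) L)).integrable (by norm_num)).ofReal
      exact h1.continuousOn_mul hc.continuousOn
    have h1 : ∫ x in (-L)..L, e x • W x = ∫ x in (-L)..L, (e x - e (-x)) * (F x : ℂ) := by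
      have e1 : ∀ x, e x • W x = e x * (F x : ℂ) - e x * (F (-x) : ℂ) := fun x => by
        simp only [hW, smul_eq_mul]; push_cast; ring
      simp_rw [e1, sub_mul]
      rw [intervalIntegral.integral_sub (hi hec hF2) (hi hec hFn2)]
      have h2 : ∫ x in (-L)..L, e x * (F (-x) : ℂ) = ∫ x in (-L)..L, e (-x) * (F x : ℂ) := by
        have h3 := intervalIntegral.integral_comp_neg (a := -L) (b := L)
          (fun x => e (-x) * (F x : ℂ))
        simpa using h3
      have h3 : IntervalIntegrable (fun x => e (-x) * (F x : ℂ)) volume (-L) L :=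
        hi (hec.comp continuous_neg) hF2
      rw [h2, intervalIntegral.integral_sub (hi hec hF2) h3]
    have e2 : ∀ x : ℝ, (e x - e (-x)) * (F x : ℂ) =
        indicator (Icc 0 L) (fun x => -2 * Complex.I *
          ((f x * Real.sin (n * Real.pi / L * x) : ℝ) : ℂ)) x := by
      intro x
      have h3 : e x - e (-x) = -2 * Complex.I * (Real.sin (n * Real.pi / L * x) : ℂ) := by
        simp only [he, fourier_coe_apply]
        rw [Complex.ofReal_sin, Complex.sin]
        have h5 : 2 * (Real.pi : ℂ) * Complex.I * ((-n : ℤ) : ℂ) * (x : ℂ) / ((L - -L : ℝ) : ℂ)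
            = -((n * Real.pi / L * x : ℝ) : ℂ) * Complex.I := by
          have : (L : ℂ) ≠ 0 := by exact_mod_cast hL.ne'
          push_cast
          field_simp
          ring
        have h6 : 2 * (Real.pi : ℂ) * Complex.I * ((-n : ℤ) : ℂ) * ((-x : ℝ) : ℂ) / ((L - -L : ℝ) : ℂ)
            = ((n * Real.pi / L * x : ℝ) : ℂ) * Complex.I := by
          have : (L : ℂ) ≠ 0 := by exact_mod_cast hL.ne'
          push_cast
          field_simp
          ring
        rw [h5, h6]
        linear_combination (Complex.exp (-((n * Real.pi / L * x : ℝ) : ℂ) * Complex.I) -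
          Complex.exp (((n * Real.pi / L * x : ℝ) : ℂ) * Complex.I)) * Complex.I_sq
      rw [h3, hF]
      by_cases hx : x ∈ Icc 0 L
      · rw [indicator_of_mem hx, indicator_of_mem hx]; push_cast; ring
      · rw [indicator_of_notMem hx, indicator_of_notMem hx]; simp
    have h4 : ∫ x in (-L)..L, e x • W x = 0 := by
      rw [h1]
      simp_rw [e2]
      rw [intervalIntegral.integral_of_le hLL.le, integral_indicator measurableSet_Icc,
        Measure.restrict_restrict measurableSet_Icc]
      have h5 : Icc 0 L ∩ Ioc (-L) L = Icc 0 L := by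
        ext x
        simp only [mem_inter_iff, mem_Icc, mem_Ioc]
        constructor
        · exact fun h => h.1
        · exact fun h => ⟨h, by linarith [h.1], h.2⟩
      rw [h5, integral_const_mul, integral_complex_ofReal, integral_omegaMeasure hL.le, hsin n]
      simp
    rw [h4, smul_zero]
  have hpar := hasSum_sq_fourierCoeffOn hLL (hW2.restrict _)
  simp only [hcoeff, norm_zero, ne_eq, OfNat.ofNat_ne_zero, not_false_eq_true, zero_pow] at hpar
  have hz := hpar.unique hasSum_zero
  rw [smul_eq_zero] at hz
  have hz2 : ∫ x in Ioc (-L) L, ‖W x‖ ^ 2 = 0 := by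
    rw [← intervalIntegral.integral_of_le hLL.le]
    refine hz.resolve_left ?_
    have : L - -L ≠ 0 := by linarith
    exact inv_ne_zero this
  have hint : IntegrableOn (fun x => ‖W x‖ ^ 2) (Ioc (-L) L) :=
    (hW2.restrict _).integrable_norm_pow (by norm_num)
  rw [setIntegral_eq_zero_iff_of_nonneg_ae (Filter.Eventually.of_forall fun x => by positivity)
    hint] at hz2
  have h5 : ∀ᵐ x ∂volume.restrict (Ioc 0 L), f x = 0 := by
    have h6 := ae_restrict_of_ae_restrict_of_subset
      (show Ioc 0 L ⊆ Ioc (-L) L from Ioc_subset_Ioc_left (by linarith)) hz2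
    filter_upwards [h6, ae_restrict_mem measurableSet_Ioc] with x hx hxL
    have h7 : W x = 0 := by simpa using hx
    have h8 : F x - F (-x) = 0 := Complex.ofReal_eq_zero.1 h7
    rw [hF, indicator_of_mem (Ioc_subset_Icc_self hxL),
      indicator_of_notMem (by simp only [mem_Icc, not_and]; intro; linarith [hxL.1])] at h8
    simpa using h8
  rw [omegaMeasure, Measure.restrict_congr_set Ioc_ae_eq_Icc.symm]
  exact h5

end Trigonometric

/-! ### The sine basis and weak derivatives as cosine series -/

section Basis

variable {L : ℝ}

theorem memLp_omegaMeasure {f : ℝ → ℝ} (hf : Continuous f) : MemLp f 2 (omegaMeasure L) := by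
  obtain ⟨C, hC⟩ := (isCompact_Icc (a := (0 : ℝ)) (b := L)).exists_bound_of_continuousOn
    hf.continuousOn
  refine MemLp.of_bound hf.aestronglyMeasurable C ?_
  exact (ae_restrict_iff' measurableSet_Icc).2 (Filter.Eventually.of_forall hC)

/-- The class in `L²(0, L)` of a continuous function. -/
def toL2 (L : ℝ) (f : ℝ → ℝ) (hf : Continuous f) : L2 L := (memLp_omegaMeasure hf).toLp f

theorem inner_toL2 {f : ℝ → ℝ} (hf : Continuous f) (ψ : L2 L) :
    inner ℝ (toL2 L f hf) ψ = ∫ x, ψ x * f x ∂(omegaMeasure L) := by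
  rw [L2.inner_def]
  refine integral_congr_ae ?_
  filter_upwards [MemLp.coeFn_toLp (memLp_omegaMeasure (L := L) hf)] with x hx
  rw [toL2, hx]
  simp

theorem inner_toL2_toL2 (hL : 0 ≤ L) {f g : ℝ → ℝ} (hf : Continuous f) (hg : Continuous g) :
    inner ℝ (toL2 L f hf) (toL2 L g hg) = ∫ x in (0 : ℝ)..L, f x * g x := by
  rw [inner_toL2, ← integral_omegaMeasure hL]
  refine integral_congr_ae ?_
  filter_upwards [MemLp.coeFn_toLp (memLp_omegaMeasure (L := L) hg)] with x hx
  rw [toL2, hx, mul_comm]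

theorem integrable_mul_omegaMeasure {f : ℝ → ℝ} (hf : Continuous f) (ψ : L2 L) :
    Integrable (fun x => ψ x * f x) (omegaMeasure L) :=
  (Lp.memLp ψ).integrable_mul (memLp_omegaMeasure hf)

/-- The frequency `(k + 1) π / L`. -/
def freq (L : ℝ) (k : ℕ) : ℝ := (k + 1 : ℕ) * Real.pi / L

theorem freq_pos (hL : 0 < L) (k : ℕ) : 0 < freq L k := by
  have := Real.pi_pos
  unfold freq
  positivity

theorem freq_zero_le (hL : 0 < L) (k : ℕ) : freq L 0 ≤ freq L k := by
  have := Real.pi_pos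
  unfold freq
  gcongr
  simp

theorem eigenvalue_succ (k : ℕ) : eigenvalue L (k + 1) = freq L k ^ 2 := rfl

def sineFun (L : ℝ) (k : ℕ) (x : ℝ) : ℝ := Real.sqrt (2 / L) * Real.sin (freq L k * x)

def cosineFun (L : ℝ) (k : ℕ) (x : ℝ) : ℝ := Real.sqrt (2 / L) * Real.cos (freq L k * x)

theorem continuous_sineFun (k : ℕ) : Continuous (sineFun L k) := by
  unfold sineFun; fun_prop

theorem continuous_cosineFun (k : ℕ) : Continuous (cosineFun L k) := by
  unfold cosineFun; fun_prop

theorem hasDerivAt_sineFun (k : ℕ) (x : ℝ) :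
    HasDerivAt (sineFun L k) (freq L k * cosineFun L k x) x := by
  have h1 : HasDerivAt (fun x => freq L k * x) (freq L k) x := by
    simpa using (hasDerivAt_id x).const_mul (freq L k)
  refine (h1.sin.const_mul (Real.sqrt (2 / L))).congr_deriv ?_
  rw [cosineFun]
  ring

theorem hasDerivAt_cosineFun (k : ℕ) (x : ℝ) :
    HasDerivAt (cosineFun L k) (-(freq L k * sineFun L k x)) x := by
  have h1 : HasDerivAt (fun x => freq L k * x) (freq L k) x := by
    simpa using (hasDerivAt_id x).const_mul (freq L k)
  refine (h1.cos.const_mul (Real.sqrt (2 / L))).congr_deriv ?_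
  rw [sineFun]
  ring

theorem eigenfun_succ (k : ℕ) : eigenfun L (k + 1) = sineFun L k := by
  ext x
  rw [eigenfun, sineFun, freq]
  congr 2
  ring

def sineVec (L : ℝ) (k : ℕ) : L2 L := toL2 L (sineFun L k) (continuous_sineFun k)

def cosineVec (L : ℝ) (k : ℕ) : L2 L := toL2 L (cosineFun L k) (continuous_cosineFun k)

theorem coeff_succ (ψ : L2 L) (k : ℕ) : coeff L ψ (k + 1) = inner ℝ (sineVec L k) ψ := by
  rw [sineVec, inner_toL2, coeff, eigenfun_succ]

theorem orthonormal_sineVec (hL : 0 < L) : Orthonormal ℝ (sineVec L) := by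
  rw [orthonormal_iff_ite]
  intro j k
  rw [sineVec, sineVec, inner_toL2_toL2 hL.le]
  have e : ∀ x, sineFun L j x * sineFun L k x =
      2 / L * (Real.sin ((j + 1 : ℕ) * Real.pi / L * x) *
      Real.sin ((k + 1 : ℕ) * Real.pi / L * x)) := fun x => by
    rw [sineFun, sineFun, mul_mul_mul_comm, Real.mul_self_sqrt (by positivity)]
    rfl
  simp_rw [e]
  rw [intervalIntegral.integral_const_mul, integral_sin_mul_sin hL]
  split_ifs
  · field_simp
  · simp

theorem orthonormal_cosineVec (hL : 0 < L) : Orthonormal ℝ (cosineVec L) := by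
  rw [orthonormal_iff_ite]
  intro j k
  rw [cosineVec, cosineVec, inner_toL2_toL2 hL.le]
  have e : ∀ x, cosineFun L j x * cosineFun L k x =
      2 / L * (Real.cos ((j + 1 : ℕ) * Real.pi / L * x) *
      Real.cos ((k + 1 : ℕ) * Real.pi / L * x)) := fun x => by
    rw [cosineFun, cosineFun, mul_mul_mul_comm, Real.mul_self_sqrt (by positivity)]
    rfl
  simp_rw [e]
  rw [intervalIntegral.integral_const_mul, integral_cos_mul_cos hL]
  split_ifs
  · field_simp
  · simp

theorem span_sineVec_orthogonal (hL : 0 < L) :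
    (Submodule.span ℝ (Set.range (sineVec L)))ᗮ = ⊥ := by
  rw [Submodule.eq_bot_iff]
  intro ψ hψ
  rw [Submodule.mem_orthogonal] at hψ
  have h0 : ∀ k, inner ℝ (sineVec L k) ψ = (0 : ℝ) := fun k =>
    hψ _ (Submodule.subset_span ⟨k, rfl⟩)
  have h1 := ae_eq_zero_of_integral_sin hL (Lp.memLp ψ) fun k => by
    have h2 := h0 k
    rw [sineVec, inner_toL2] at h2
    have e : ∀ x, ψ x * sineFun L k x =
        Real.sqrt (2 / L) * (ψ x * Real.sin ((k + 1 : ℕ) * Real.pi / L * x)) := fun x => by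
      rw [sineFun, freq]; ring
    simp_rw [e] at h2
    rw [integral_const_mul] at h2
    exact (mul_eq_zero.1 h2).resolve_left (Real.sqrt_pos.2 (by positivity)).ne'
  exact (Lp.eq_zero_iff_ae_eq_zero).2 h1

/-- The sines as a Hilbert basis of `L²(0, L)`. -/
def sineBasis (hL : 0 < L) : HilbertBasis ℕ ℝ (L2 L) :=
  HilbertBasis.mkOfOrthogonalEqBot (orthonormal_sineVec hL) (span_sineVec_orthogonal hL)

theorem sineBasis_apply (hL : 0 < L) (k : ℕ) : sineBasis hL k = sineVec L k := by
  simp [sineBasis]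

theorem hasSum_coeff_sq (hL : 0 < L) (ψ : L2 L) :
    HasSum (fun k => coeff L ψ (k + 1) ^ 2) (‖ψ‖ ^ 2) := by
  have h := (sineBasis hL).hasSum_inner_mul_inner ψ ψ
  rw [real_inner_self_eq_norm_sq] at h
  refine h.congr_fun fun k => ?_
  rw [coeff_succ, sineBasis_apply, real_inner_comm ψ, pow_two]

theorem integral_sineFun_mul_deriv {φ : ℝ → ℝ} (hφ : ContDiff ℝ ∞ φ)
    (hs : tsupport φ ⊆ Ioo 0 L) (k : ℕ) :
    ∫ x in (0 : ℝ)..L, sineFun L k x * deriv φ x =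
      -(freq L k * ∫ x in (0 : ℝ)..L, cosineFun L k x * φ x) := by
  have hd : Differentiable ℝ φ := hφ.differentiable (by simp)
  have hc : Continuous (deriv φ) := hφ.continuous_deriv (by simp)
  have h0 : φ 0 = 0 := image_eq_zero_of_notMem_tsupport fun h => lt_irrefl _ (hs h).1
  have hL0 : φ L = 0 := image_eq_zero_of_notMem_tsupport fun h => lt_irrefl _ (hs h).2
  rw [intervalIntegral.integral_mul_deriv_eq_deriv_mul (u := sineFun L k) (v := φ)
    (fun x _ => hasDerivAt_sineFun k x) (fun x _ => (hd x).hasDerivAt)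
    ((continuous_const.mul (continuous_cosineFun k)).intervalIntegrable _ _)
    (hc.intervalIntegrable _ _), h0, hL0]
  simp_rw [mul_assoc]
  rw [intervalIntegral.integral_const_mul]
  ring

/-- A function whose sine coefficients decay like those of an `H¹₀` function has a weak
derivative. -/
theorem exists_hasWeakDeriv (hL : 0 < L) (ψ : L2 L)
    (hs : Summable fun k => (freq L k * coeff L ψ (k + 1)) ^ 2) :
    ∃ g : L2 L, HasWeakDeriv L ψ g ∧ ‖g‖ ^ 2 = ∑' k, (freq L k * coeff L ψ (k + 1)) ^ 2 := by
  have hO := (orthonormal_cosineVec hL).orthogonalFamily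
  -- The weak derivative is the term by term derivative of the sine series. Orthonormality of the
  -- cosines suffices; they need not be complete.
  have hsum : Summable fun k => (freq L k * coeff L ψ (k + 1)) • cosineVec L k := by
    refine (hO.summable_iff_norm_sq_summable (fun k => freq L k * coeff L ψ (k + 1))).2 ?_
    simpa [mul_pow] using hs
  obtain ⟨g, hg⟩ := hsum
  have hinner : ∀ χ : L2 L, HasSum (fun k => freq L k * coeff L ψ (k + 1) *
      inner ℝ (cosineVec L k) χ) (inner ℝ g χ) := by
    intro χ
    have := (hg.mapL (innerSL ℝ χ))
    simp only [innerSL_apply_apply, inner_smul_right] at this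
    rw [real_inner_comm]
    refine this.congr_fun fun k => ?_
    rw [real_inner_comm]
  refine ⟨g, fun φ hφ hφc hφs => ?_, ?_⟩
  · have hd : Continuous (deriv φ) := hφ.continuous_deriv (by simp)
    -- Parseval for ψ and φ' in the sine basis; integrating by parts in each coefficient of φ'
    -- produces the cosine coefficients of φ.
    have h1 := (sineBasis hL).hasSum_inner_mul_inner ψ (toL2 L (deriv φ) hd)
    have h2 := (hinner (toL2 L φ hφ.continuous)).neg
    have h3 := HasSum.unique (f := fun k => inner ℝ ψ (sineBasis hL k) *
      inner ℝ (sineBasis hL k) (toL2 L (deriv φ) hd)) h1 (h2.congr_fun fun k => ?_)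
    · rw [real_inner_comm, inner_toL2, real_inner_comm, inner_toL2] at h3
      exact h3
    · rw [sineBasis_apply, real_inner_comm, ← coeff_succ, sineVec, inner_toL2_toL2 hL.le,
        integral_sineFun_mul_deriv hφ hφs, cosineVec, inner_toL2_toL2 hL.le]
      ring
  · have h1 := hinner g
    rw [real_inner_self_eq_norm_sq] at h1
    rw [← h1.tsum_eq]
    refine tsum_congr fun k => ?_
    have h2 := hg.mapL (innerSL ℝ (cosineVec L k))
    simp only [innerSL_apply_apply, inner_smul_right] at h2
    have h3 := h2.unique (hasSum_single k fun j hj => by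
      rw [(orthonormal_cosineVec hL).2 hj.symm, mul_zero])
    rw [h3, real_inner_self_eq_norm_sq, (orthonormal_cosineVec hL).1 k]
    ring

end Basis

/-! ### The Dirichlet Laplacian in terms of sine coefficients -/

section Cutoff

open Real (smoothTransition)
open Filter Topology

theorem exists_abs_deriv_smoothTransition_le : ∃ C, 0 ≤ C ∧ ∀ x, |deriv smoothTransition x| ≤ C := by
  have hc : Continuous (deriv smoothTransition) :=
    (Real.smoothTransition.contDiff (n := 1)).continuous_deriv (by simp)
  obtain ⟨C, hC⟩ := (isCompact_Icc (a := (-1 : ℝ)) (b := 2)).exists_bound_of_continuousOn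
    hc.continuousOn
  refine ⟨max C 0, le_max_right _ _, fun x => ?_⟩
  by_cases hx : x ∈ Icc (-1 : ℝ) 2
  · exact (hC x hx).trans (le_max_left _ _)
  · have h0 : deriv smoothTransition x = 0 := by
      rcases lt_or_ge x (-1) with h | h
      · have : smoothTransition =ᶠ[𝓝 x] fun _ => 0 := by
          filter_upwards [Iio_mem_nhds h] with y hy
          exact Real.smoothTransition.zero_of_nonpos (by linarith [mem_Iio.1 hy])
        rw [this.deriv_eq, deriv_const]
      · have h2 : 2 < x := by
          by_contra h2
          exact hx ⟨h, not_lt.1 h2⟩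
        have : smoothTransition =ᶠ[𝓝 x] fun _ => 1 := by
          filter_upwards [Ioi_mem_nhds h2] with y hy
          exact Real.smoothTransition.one_of_one_le (by linarith [mem_Ioi.1 hy])
        rw [this.deriv_eq, deriv_const]
    rw [h0, abs_zero]
    exact le_max_right _ _

/-- A smooth cut-off function for `(0, L)`, which rises over steps of length `1 / n`. -/
def cutoff (L : ℝ) (n : ℕ) (x : ℝ) : ℝ :=
  smoothTransition (n * x - 1) * smoothTransition (n * (L - x) - 1)

variable {L : ℝ} {n : ℕ}

theorem contDiff_cutoff {m : ℕ∞} : ContDiff ℝ m (cutoff L n) := by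
  unfold cutoff
  exact (Real.smoothTransition.contDiff.comp (by fun_prop)).mul
    (Real.smoothTransition.contDiff.comp (by fun_prop))

theorem tsupport_cutoff_subset (hn : 1 ≤ n) :
    tsupport (cutoff L n) ⊆ Icc (1 / (n : ℝ)) (L - 1 / n) := by
  have hn' : (0 : ℝ) < n := by positivity
  refine closure_minimal (fun x hx => ?_) isClosed_Icc
  have h1 : n * x - 1 > 0 := by
    by_contra h
    exact hx (by rw [cutoff, Real.smoothTransition.zero_of_nonpos (not_lt.1 h), zero_mul])
  have h2 : n * (L - x) - 1 > 0 := by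
    by_contra h
    exact hx (by rw [cutoff, Real.smoothTransition.zero_of_nonpos (not_lt.1 h), mul_zero])
  have h3 : 1 / (n : ℝ) ≤ x := by rw [div_le_iff₀ hn']; linarith
  have h4 : 1 / (n : ℝ) ≤ L - x := by rw [div_le_iff₀ hn']; linarith
  exact ⟨h3, by linarith⟩

theorem cutoff_nonneg (x : ℝ) : 0 ≤ cutoff L n x :=
  mul_nonneg (Real.smoothTransition.nonneg _) (Real.smoothTransition.nonneg _)

theorem cutoff_le_one (x : ℝ) : cutoff L n x ≤ 1 :=
  mul_le_one₀ (Real.smoothTransition.le_one _) (Real.smoothTransition.nonneg _)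
    (Real.smoothTransition.le_one _)

theorem cutoff_eq_one {x : ℝ} (h1 : 2 ≤ n * x) (h2 : 2 ≤ n * (L - x)) : cutoff L n x = 1 := by
  rw [cutoff, Real.smoothTransition.one_of_one_le (by linarith),
    Real.smoothTransition.one_of_one_le (by linarith), one_mul]

theorem eventually_lt_mul {y : ℝ} (hy : 0 < y) : ∀ᶠ n : ℕ in atTop, 2 < n * y :=
  (tendsto_natCast_atTop_atTop.atTop_mul_const hy).eventually_gt_atTop 2

theorem tendsto_cutoff {x : ℝ} (hx : x ∈ Ioo 0 L) :
    Tendsto (fun n => cutoff L n x) atTop (𝓝 1) := by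
  refine tendsto_const_nhds.congr' ?_
  filter_upwards [eventually_lt_mul hx.1, eventually_lt_mul (sub_pos.2 hx.2)] with n h1 h2
  exact (cutoff_eq_one h1.le h2.le).symm

theorem deriv_cutoff_eq_zero {x : ℝ} (h1 : 2 < n * x) (h2 : 2 < n * (L - x)) :
    deriv (cutoff L n) x = 0 := by
  have : cutoff L n =ᶠ[𝓝 x] fun _ => 1 := by
    have c1 : Continuous fun y : ℝ => n * y := by fun_prop
    have c2 : Continuous fun y : ℝ => n * (L - y) := by fun_prop
    filter_upwards [c1.continuousAt.eventually_const_lt h1, c2.continuousAt.eventually_const_lt h2]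
      with y hy1 hy2
    exact cutoff_eq_one hy1.le hy2.le
  rw [this.deriv_eq, deriv_const]

theorem exists_abs_deriv_cutoff_le : ∃ C, 0 ≤ C ∧ ∀ (L : ℝ) (n : ℕ) (x : ℝ),
    |deriv (cutoff L n) x| ≤ C * n := by
  obtain ⟨C, hC0, hC⟩ := exists_abs_deriv_smoothTransition_le
  refine ⟨2 * C, by positivity, fun L n x => ?_⟩
  have hd : ∀ y, HasDerivAt smoothTransition (deriv smoothTransition y) y := fun y =>
    ((Real.smoothTransition.contDiff (n := 1)).differentiable (by simp) y).hasDerivAt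
  have h1 : HasDerivAt (fun x : ℝ => n * x - 1) (n : ℝ) x := by
    simpa using ((hasDerivAt_id x).const_mul (n : ℝ)).sub_const 1
  have h2 : HasDerivAt (fun x : ℝ => n * (L - x) - 1) (-(n : ℝ)) x := by
    simpa using (((hasDerivAt_id x).const_sub L).const_mul (n : ℝ)).sub_const 1
  have h3 := ((hd _).comp x h1).mul ((hd _).comp x h2)
  have h4 : deriv (cutoff L n) x = _ := h3.deriv
  rw [h4]
  refine (abs_add_le _ _).trans ?_
  simp only [Function.comp_apply, abs_mul, abs_neg, Nat.abs_cast,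
    abs_of_nonneg (Real.smoothTransition.nonneg _)]
  have a1 := hC (n * x - 1)
  have a2 := hC (n * (L - x) - 1)
  have b1 := Real.smoothTransition.le_one (n * x - 1)
  have b2 := Real.smoothTransition.le_one (n * (L - x) - 1)
  have c1 := Real.smoothTransition.nonneg (n * x - 1)
  have c2 := Real.smoothTransition.nonneg (n * (L - x) - 1)
  calc _ ≤ C * n * 1 + 1 * (C * n) := by gcongr
    _ = _ := by ring

theorem ae_mem_Ioo_omegaMeasure : ∀ᵐ x ∂(omegaMeasure L), x ∈ Ioo 0 L := by
  rw [omegaMeasure, Measure.restrict_congr_set Ioo_ae_eq_Icc.symm]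
  exact ae_restrict_mem measurableSet_Ioo

theorem tendsto_integral_mul_cutoff {f : ℝ → ℝ} (hf : Integrable f (omegaMeasure L)) :
    Tendsto (fun n => ∫ x, f x * cutoff L n x ∂(omegaMeasure L)) atTop
      (𝓝 (∫ x, f x ∂(omegaMeasure L))) := by
  refine tendsto_integral_of_dominated_convergence (fun x => ‖f x‖)
    (fun n => hf.aestronglyMeasurable.mul
      (contDiff_cutoff (m := 0)).continuous.aestronglyMeasurable) hf.norm ?_ ?_
  · intro n
    refine Eventually.of_forall fun x => ?_
    rw [norm_mul, Real.norm_of_nonneg (cutoff_nonneg x)]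
    exact mul_le_of_le_one_right (norm_nonneg _) (cutoff_le_one x)
  · filter_upwards [ae_mem_Ioo_omegaMeasure] with x hx
    simpa using (tendsto_cutoff hx).const_mul (f x)

/-- Integration by parts against a φ that need not vanish near the ends. Test with φ times the
cut-off: the product rule leaves the boundary-layer term in `h0`, and the other terms converge by
dominated convergence. -/
theorem HasWeakDeriv.integral_mul_deriv {w g : L2 L} (h : HasWeakDeriv L w g) {φ : ℝ → ℝ}
    (hφ : ContDiff ℝ ∞ φ)
    (h0 : Tendsto (fun n => ∫ x, w x * (φ x * deriv (cutoff L n) x) ∂(omegaMeasure L)) atTop (𝓝 0)) :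
    ∫ x, w x * deriv φ x ∂(omegaMeasure L) = -∫ x, g x * φ x ∂(omegaMeasure L) := by
  have hφ' : Continuous (deriv φ) := hφ.continuous_deriv (by simp)
  have hχ' : ∀ n, Continuous (deriv (cutoff L n)) := fun n =>
    (contDiff_cutoff (m := 1)).continuous_deriv (by simp)
  have hχ : ∀ n, Continuous (cutoff L n) := fun n => (contDiff_cutoff (m := 0)).continuous
  have h1 := (tendsto_integral_mul_cutoff (integrable_mul_omegaMeasure hφ' w)).add h0
  have h2 := (tendsto_integral_mul_cutoff (integrable_mul_omegaMeasure hφ.continuous g)).neg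
  rw [add_zero] at h1
  refine tendsto_nhds_unique (h1.congr' ?_) h2
  filter_upwards [eventually_ge_atTop 1] with n hn
  have hn' : (0 : ℝ) < n := by positivity
  have hsub : tsupport (fun x => φ x * cutoff L n x) ⊆ Icc (1 / (n : ℝ)) (L - 1 / n) :=
    (tsupport_mul_subset_right).trans (tsupport_cutoff_subset hn)
  have hn1 : 0 < 1 / (n : ℝ) := by positivity
  have h3 := h (fun x => φ x * cutoff L n x) (hφ.mul contDiff_cutoff)
    (isCompact_Icc.of_isClosed_subset (isClosed_tsupport _) hsub)
    (hsub.trans fun x hx => ⟨by linarith [hx.1], by linarith [hx.2]⟩)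
  have h4 : ∀ x, deriv (fun x => φ x * cutoff L n x) x =
      deriv φ x * cutoff L n x + φ x * deriv (cutoff L n) x := fun x =>
    deriv_fun_mul (hφ.differentiable (by simp) x)
      ((contDiff_cutoff (m := 1)).differentiable (by simp) x)
  rw [← integral_add]
  · simp_rw [mul_assoc]
    rw [← h3]
    refine integral_congr_ae (Eventually.of_forall fun x => ?_)
    simp only [h4]
    ring
  · simp_rw [mul_assoc]
    exact integrable_mul_omegaMeasure (hφ'.mul (hχ n)) w
  · exact integrable_mul_omegaMeasure (hφ.continuous.mul (hχ' n)) w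

/-- The derivative of the cut-off is O(n) on a set of measure at most 4/n, where f is small by
continuity and its boundary values. -/
theorem tendsto_integral_boundary_layer (hL : 0 < L) {f : ℝ → ℝ} (hf : ContinuousOn f (Icc 0 L))
    (h0 : f 0 = 0) (hfL : f L = 0) :
    Tendsto (fun n => ∫ x, f x * deriv (cutoff L n) x ∂(omegaMeasure L)) atTop (𝓝 0) := by
  obtain ⟨C, hC0, hC⟩ := exists_abs_deriv_cutoff_le
  rw [Metric.tendsto_atTop]
  intro ε hε
  set η := ε / (4 * C + 1) / 2 with hη
  have hη0 : 0 < η := by positivity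
  obtain ⟨δ₁, hδ₁, h1⟩ := Metric.continuousWithinAt_iff.1 (hf 0 ⟨le_rfl, hL.le⟩) η hη0
  obtain ⟨δ₂, hδ₂, h2⟩ := Metric.continuousWithinAt_iff.1 (hf L ⟨hL.le, le_rfl⟩) η hη0
  obtain ⟨n₀, hn₀⟩ := eventually_atTop.1 ((eventually_lt_mul hδ₁).and (eventually_lt_mul hδ₂))
  refine ⟨max n₀ 1, fun n hn => ?_⟩
  obtain ⟨hn1, hn2⟩ := hn₀ n ((le_max_left _ _).trans hn)
  have hn' : (0 : ℝ) < n := by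
    have : 1 ≤ n := (le_max_right _ _).trans hn
    positivity
  set S : Set ℝ := Icc 0 L ∩ (Icc 0 (2 / (n : ℝ)) ∪ Icc (L - 2 / n) L) with hS
  have hSm : MeasurableSet S := measurableSet_Icc.inter (measurableSet_Icc.union measurableSet_Icc)
  have e : ∫ x, f x * deriv (cutoff L n) x ∂(omegaMeasure L) =
      ∫ x in S, f x * deriv (cutoff L n) x := by
    refine setIntegral_eq_of_subset_of_forall_sdiff_eq_zero measurableSet_Icc inter_subset_left
      fun x hx => ?_
    have hx1 : 2 < n * x := by
      by_contra h
      exact hx.2 ⟨hx.1, Or.inl ⟨hx.1.1, by rw [le_div_iff₀ hn']; linarith⟩⟩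
    have hx2 : 2 < n * (L - x) := by
      by_contra h
      have : L - x ≤ 2 / n := by rw [le_div_iff₀ hn']; linarith
      exact hx.2 ⟨hx.1, Or.inr ⟨by linarith, hx.1.2⟩⟩
    rw [deriv_cutoff_eq_zero hx1 hx2, mul_zero]
  have hfS : ∀ x ∈ S, |f x| ≤ η := by
    rintro x ⟨hx, hx1 | hx1⟩
    · have h3 := h1 hx (by
        rw [Real.dist_eq, sub_zero, abs_of_nonneg hx.1]
        refine hx1.2.trans_lt ?_
        rw [div_lt_iff₀ hn']
        linarith)
      rw [h0, Real.dist_eq, sub_zero] at h3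
      exact h3.le
    · have h3 := h2 hx (by
        rw [Real.dist_eq, abs_sub_comm, abs_of_nonneg (by linarith [hx.2])]
        have : 2 / (n : ℝ) < δ₂ := by
          rw [div_lt_iff₀ hn']
          linarith
        linarith [hx1.1])
      rw [hfL, Real.dist_eq, sub_zero] at h3
      exact h3.le
  have hvol : volume.real S ≤ 4 / n := by
    have h3 : volume.real S ≤ volume.real (Icc 0 (2 / (n : ℝ)) ∪ Icc (L - 2 / n) L) :=
      measureReal_mono inter_subset_right
        ((measure_union_le _ _).trans_lt (by simp)).ne
    refine h3.trans ((measureReal_union_le _ _).trans_eq ?_)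
    rw [Real.volume_real_Icc_of_le (by positivity),
      Real.volume_real_Icc_of_le (by
        have : 0 < 2 / (n : ℝ) := by positivity
        linarith)]
    ring
  have hSfin : volume S < ⊤ :=
    (measure_mono inter_subset_left).trans_lt (by simp : volume (Icc 0 L) < ⊤)
  have h3 := norm_setIntegral_le_of_norm_le_const hSfin
    (f := fun x => f x * deriv (cutoff L n) x) (C := η * (C * n)) fun x hx => by
      rw [norm_mul]
      exact mul_le_mul (hfS x hx) (hC L n x) (abs_nonneg _) hη0.le
  rw [dist_zero_right, e]
  refine h3.trans_lt ?_
  have h4 : η * (C * n) * volume.real S ≤ η * (C * n) * (4 / n) := by gcongr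
  refine h4.trans_lt ?_
  have h5 : η * (C * n) * (4 / n) = η * (4 * C) := by field_simp
  have h6 : η * (4 * C + 1) * 2 = ε := by rw [hη]; field_simp
  rw [h5]
  nlinarith

/-- Here g has no boundary values, so the test function must pay: its linear vanishing at the ends
keeps its product with the O(n) derivative bounded, and dominated convergence applies. -/
theorem tendsto_integral_boundary_layer_of_le (g : L2 L) {φ : ℝ → ℝ} {K : ℝ}
    (hφ : Continuous φ) (hK : ∀ x ∈ Icc 0 L, |φ x| ≤ K * x ∧ |φ x| ≤ K * (L - x)) :
    Tendsto (fun n => ∫ x, g x * (φ x * deriv (cutoff L n) x) ∂(omegaMeasure L)) atTop (𝓝 0) := by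
  obtain ⟨C, hC0, hC⟩ := exists_abs_deriv_cutoff_le
  have hχ' : ∀ n, Continuous (deriv (cutoff L n)) := fun n =>
    (contDiff_cutoff (m := 1)).continuous_deriv (by simp)
  have hg : Integrable g (omegaMeasure L) := (Lp.memLp g).integrable (by norm_num)
  rw [← integral_zero ℝ ℝ (μ := omegaMeasure L)]
  refine tendsto_integral_of_dominated_convergence (fun x => ‖g x‖ * (2 * |K| * C))
    (fun n => (integrable_mul_omegaMeasure (hφ.mul (hχ' n)) g).aestronglyMeasurable)
    (hg.norm.mul_const _) ?_ ?_
  · intro n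
    refine (ae_restrict_iff' measurableSet_Icc).2 (Eventually.of_forall fun x hx => ?_)
    rw [norm_mul]
    refine mul_le_mul_of_nonneg_left ?_ (norm_nonneg _)
    rw [norm_mul, Real.norm_eq_abs, Real.norm_eq_abs]
    obtain ⟨h1, h2⟩ := hK x hx
    have h0 : 0 ≤ 2 * |K| * C := by positivity
    have key : ∀ y : ℝ, 0 ≤ y → |φ x| ≤ K * y → n * y ≤ 2 →
        |φ x| * |deriv (cutoff L n) x| ≤ 2 * |K| * C := by
      intro y hy h3 h4
      have h5 : K * y ≤ |K| * y := mul_le_mul_of_nonneg_right (le_abs_self K) hy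
      calc |φ x| * |deriv (cutoff L n) x| ≤ |K| * y * (C * n) :=
            mul_le_mul (h3.trans h5) (hC L n x) (abs_nonneg _) (by positivity)
        _ = |K| * C * (n * y) := by ring
        _ ≤ |K| * C * 2 := by gcongr
        _ = _ := by ring
    rcases le_or_gt (n * x) 2 with h3 | h3
    · exact key x hx.1 h1 h3
    rcases le_or_gt (n * (L - x)) 2 with h4 | h4
    · exact key (L - x) (by linarith [hx.2]) h2 h4
    · rw [deriv_cutoff_eq_zero h3 h4, abs_zero, mul_zero]
      exact h0
  · filter_upwards [ae_mem_Ioo_omegaMeasure] with x hx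
    refine tendsto_const_nhds.congr' ?_
    filter_upwards [eventually_lt_mul hx.1, eventually_lt_mul (sub_pos.2 hx.2)] with n h1 h2
    rw [deriv_cutoff_eq_zero h1 h2, mul_zero, mul_zero]

/-- Two integrations by parts: w against a cosine, where w vanishes on the boundary, and its
derivative against a sine, where the sine does. -/
theorem HasDirichletLaplacian.coeff_eq (hL : 0 < L) {w h : L2 L} (hw : HasDirichletLaplacian L w h)
    (k : ℕ) : coeff L h (k + 1) = -(freq L k ^ 2 * coeff L w (k + 1)) := by
  obtain ⟨⟨g, hwg, hgh⟩, c, hc, hc0, hcL, hwc⟩ := hw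
  have hsd : deriv (sineFun L k) = fun x => freq L k * cosineFun L k x :=
    funext fun x => (hasDerivAt_sineFun k x).deriv
  have hcd : deriv (cosineFun L k) = fun x => -(freq L k * sineFun L k x) :=
    funext fun x => (hasDerivAt_cosineFun k x).deriv
  have hss : ContDiff ℝ ∞ (sineFun L k) := by unfold sineFun; fun_prop
  have hcs : ContDiff ℝ ∞ (cosineFun L k) := by unfold cosineFun; fun_prop
  have h1 := hwg.integral_mul_deriv hcs (by
    have h2 := tendsto_integral_boundary_layer hL (f := fun x => c x * cosineFun L k x)
      (hc.mul (continuous_cosineFun k).continuousOn) (by rw [hc0, zero_mul]) (by rw [hcL, zero_mul])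
    refine h2.congr fun n => integral_congr_ae ?_
    filter_upwards [hwc] with x hx
    rw [hx, mul_assoc])
  have h2 := hgh.integral_mul_deriv hss (tendsto_integral_boundary_layer_of_le g
    (K := freq L k * Real.sqrt (2 / L)) (continuous_sineFun k) fun x hx => by
      have hb : ∀ y ∈ Icc 0 L, ‖freq L k * cosineFun L k y - 0‖ ≤ freq L k * Real.sqrt (2 / L) := by
        intro y _
        rw [sub_zero, norm_mul, Real.norm_of_nonneg (freq_pos hL k).le, cosineFun, norm_mul,
          Real.norm_of_nonneg (Real.sqrt_nonneg _)]
        have := Real.abs_cos_le_one (freq L k * y)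
        have := (freq_pos hL k).le
        gcongr
        exact mul_le_of_le_one_right (Real.sqrt_nonneg _) (Real.abs_cos_le_one _)
      have h0 : sineFun L k 0 = 0 := by simp [sineFun]
      have hLz : sineFun L k L = 0 := by
        rw [sineFun, freq, div_mul_cancel₀ _ hL.ne', Real.sin_nat_mul_pi, mul_zero]
      have h3 := norm_sub_sub_smul_le (fun y (_ : y ∈ Icc 0 L) => hasDerivAt_sineFun k y) hb
        (left_mem_Icc.2 hL.le) hx hx.1
      have h4 := norm_sub_sub_smul_le (fun y (_ : y ∈ Icc 0 L) => hasDerivAt_sineFun k y) hb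
        hx (right_mem_Icc.2 hL.le) hx.2
      rw [h0, smul_zero, sub_zero, sub_zero, sub_zero] at h3
      rw [hLz, smul_zero, sub_zero, zero_sub, norm_neg] at h4
      exact ⟨h3, h4⟩)
  rw [hcd] at h1
  rw [hsd] at h2
  have e1 : ∀ x, w x * -(freq L k * sineFun L k x) = -freq L k * (w x * sineFun L k x) :=
    fun x => by ring
  have e2 : ∀ x, g x * (freq L k * cosineFun L k x) = freq L k * (g x * cosineFun L k x) :=
    fun x => by ring
  simp_rw [e1] at h1
  simp_rw [e2] at h2
  rw [integral_const_mul] at h1 h2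
  rw [coeff, coeff, eigenfun_succ]
  linear_combination h2 - freq L k * h1

end Cutoff

/-! ### Reduction to modes -/

section Modes

variable {L T β : ℝ}

/-- Cut at t/2: the kernel is singular only at t, where f is continuous, and near 0, where f is
merely integrable, the kernel is continuous. -/
theorem intervalIntegrable_omega_sub_smul {E : Type*} [NormedAddCommGroup E] [NormedSpace ℝ E]
    (hβ1 : β < 1) {f : ℝ → E} (hi : IntegrableOn f (Ioo 0 T)) (hc : ContinuousOn f (Ioo 0 T))
    {t : ℝ} (ht : t ∈ Ioo 0 T) :
    IntervalIntegrable (fun s => omega (1 - β) (t - s) • f s) volume 0 t := by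
  have ht0 := ht.1
  have h1 : IntervalIntegrable (fun s => omega (1 - β) (t - s) • f s) volume 0 (t / 2) := by
    have hf : IntervalIntegrable f volume 0 (t / 2) := by
      rw [intervalIntegrable_iff_integrableOn_Ioc_of_le (by linarith)]
      exact hi.mono_set fun s hs => ⟨hs.1, by linarith [hs.2, ht.2]⟩
    refine hf.continuousOn_smul (continuousOn_omega_sub.mono ?_)
    rw [uIcc_of_le (by linarith)]
    exact fun s hs => by simp only [mem_Iio]; linarith [hs.2]
  have h2 : IntervalIntegrable (fun s => omega (1 - β) (t - s) • f s) volume (t / 2) t := by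
    have hω : IntervalIntegrable (fun s => omega (1 - β) (t - s)) volume 0 t := by
      simpa using intervalIntegrable_omega_mul_rpow (γ := 1 - β) (by linarith) one_pos ht0
    have hω2 : IntervalIntegrable (fun s => omega (1 - β) (t - s)) volume (t / 2) t := by
      refine hω.mono_set ?_
      rw [uIcc_of_le ht0.le, uIcc_of_le (by linarith)]
      exact Icc_subset_Icc_left (by linarith)
    refine hω2.smul_continuousOn (hc.mono ?_)
    rw [uIcc_of_le (by linarith)]
    exact fun s hs => ⟨by linarith [hs.1], by linarith [hs.2, ht.2]⟩
  exact h1.trans h2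

/-- `ψ ↦ (ψ, φ_{k+1}) c`. -/
def modeMap (L : ℝ) (k : ℕ) (c : ℂ) : L2 L →L[ℝ] ℂ := (innerSL ℝ (sineVec L k)).smulRight c

theorem modeMap_apply (k : ℕ) (c : ℂ) (ψ : L2 L) : modeMap L k c ψ = coeff L ψ (k + 1) * c := by
  rw [modeMap, ContinuousLinearMap.smulRight_apply, innerSL_apply_apply, ← coeff_succ,
    Complex.real_smul]

theorem coeff_add (ψ χ : L2 L) (k : ℕ) :
    coeff L (ψ + χ) (k + 1) = coeff L ψ (k + 1) + coeff L χ (k + 1) := by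
  simp only [coeff_succ, inner_add_right]

theorem coeff_sub (ψ χ : L2 L) (k : ℕ) :
    coeff L (ψ - χ) (k + 1) = coeff L ψ (k + 1) - coeff L χ (k + 1) := by
  simp only [coeff_succ, inner_sub_right]

theorem coeff_smul (c : ℝ) (ψ : L2 L) (k : ℕ) :
    coeff L (c • ψ) (k + 1) = c * coeff L ψ (k + 1) := by
  simp only [coeff_succ, inner_smul_right]

/-- The complex mode `λ_k^(1/2) (u, φ_k) + i (z, φ_k)`. -/
def complexMode (L : ℝ) (k : ℕ) (u z : L2 L) : ℂ :=
  modeMap L k (freq L k) u + modeMap L k Complex.I z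

theorem complexMode_eq (k : ℕ) (u z : L2 L) : complexMode L k u z =
    (freq L k * coeff L u (k + 1) : ℝ) + (coeff L z (k + 1) : ℝ) * Complex.I := by
  rw [complexMode, modeMap_apply, modeMap_apply]
  push_cast
  ring

theorem norm_complexMode_sq (k : ℕ) (u z : L2 L) : ‖complexMode L k u z‖ ^ 2 =
    (freq L k * coeff L u (k + 1)) ^ 2 + coeff L z (k + 1) ^ 2 := by
  rw [complexMode_eq, Complex.sq_norm, Complex.normSq_add_mul_I]

theorem complexMode_sub (k : ℕ) (u z u' z' : L2 L) :
    complexMode L k u z - complexMode L k u' z' = complexMode L k (u - u') (z - z') := by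
  simp only [complexMode, map_sub]
  ring

theorem modeMap_caputo {w : ℝ → L2 L} (hβ1 : β < 1) (hw : IsTimeRegular L T w) {t : ℝ}
    (ht : t ∈ Ioo 0 T) (k : ℕ) (c : ℂ) :
    IntervalIntegrable (fun s => omega (1 - β) (t - s) • modeMap L k c (deriv w s)) volume 0 t ∧
    fracInt (1 - β) (fun s => modeMap L k c (deriv w s)) t = modeMap L k c (caputo β w t) := by
  have hi := intervalIntegrable_omega_sub_smul hβ1 hw.integrableOn_deriv hw.continuousOn_deriv ht
  constructor
  · exact intervalIntegrable_omega_sub_smul hβ1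
      ((modeMap L k c).integrable_comp hw.integrableOn_deriv)
      ((modeMap L k c).continuous.comp_continuousOn hw.continuousOn_deriv) ht
  · rw [fracInt, caputo, ← (modeMap L k c).intervalIntegral_comp_comm hi]
    simp_rw [map_smul]

/-- The modes of a solution of the continuous problem. -/
theorem IsSolution.complexMode_eq_modeSol {α : ℝ} {a₀ a₁ f : L2 L} {u z : ℝ → L2 L} (hL : 0 < L)
    (hT : 0 < T) (hα0 : 0 < α) (hα2 : α < 2) (h : IsSolution α L T a₀ a₁ f u z) (k : ℕ) {t : ℝ}
    (ht : t ∈ Icc 0 T) :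
    complexMode L k (u t) (z t) = modeSol (α / 2) (freq L k) (coeff L a₀ (k + 1))
      (coeff L (a₁ + Real.Gamma (2 - α) • f) (k + 1)) t := by
  have hβ1 : α / 2 < 1 := by linarith
  set μ := freq L k with hμ
  set W₁ : ℝ → ℂ := fun t => modeMap L k μ (deriv u t) + modeMap L k Complex.I (deriv z t) with hW₁
  refine eq_modeSol (W₁ := W₁) (W := fun t => complexMode L k (u t) (z t)) (by linarith) hβ1
    (freq_pos hL k).le hT ?_ ?_ ?_ ?_ ?_ t ht
  · exact ((modeMap L k μ).continuous.comp_continuousOn h.regular_u.continuousOn).add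
      ((modeMap L k Complex.I).continuous.comp_continuousOn h.regular_z.continuousOn)
  · intro t ht
    exact ((modeMap L k μ).hasFDerivAt.comp_hasDerivAt t
      (h.regular_u.differentiableAt t ht).hasDerivAt).add
      ((modeMap L k Complex.I).hasFDerivAt.comp_hasDerivAt t
      (h.regular_z.differentiableAt t ht).hasDerivAt)
  · exact ((modeMap L k μ).integrable_comp h.regular_u.integrableOn_deriv).add
      ((modeMap L k Complex.I).integrable_comp h.regular_z.integrableOn_deriv)
  · rw [h.initial_u, h.initial_z, complexMode, map_zero, add_zero, modeMap_apply, mul_comm]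
  · intro t ht
    obtain ⟨i1, e1⟩ := modeMap_caputo hβ1 h.regular_u ht k μ
    obtain ⟨i2, e2⟩ := modeMap_caputo hβ1 h.regular_z ht k Complex.I
    have h1 := (h.eq_one t ht).coeff_eq hL k
    have h2 := congrArg (fun ψ => coeff L ψ (k + 1)) (h.eq_two t ht)
    simp only [coeff_sub, coeff_smul] at h2
    have e3 : fracInt (1 - α / 2) W₁ t = modeMap L k μ (caputo (α / 2) u t) +
        modeMap L k Complex.I (caputo (α / 2) z t) := by
      rw [← e1, ← e2, fracInt, fracInt, fracInt, ← intervalIntegral.integral_add i1 i2]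
      simp only [hW₁, smul_add]
    rw [e3, complexMode_eq, modeMap_apply, modeMap_apply, h1]
    have h3 : coeff L (caputo (α / 2) u t) (k + 1) = coeff L (z t) (k + 1) + omega (2 - α / 2) t *
        coeff L (a₁ + Real.Gamma (2 - α) • f) (k + 1) := by linarith
    rw [h3, ← hμ]
    push_cast
    -- The system is scalar in disguise: μz − iμ²u = −iμ(μu + iz).
    linear_combination ((coeff L (z t) (k + 1) : ℂ) * μ) * Complex.I_sq

theorem discreteCaputo_succ (A : ℕ → ℕ → ℝ) (V : ℕ → L2 L) (n : ℕ) :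
    discreteCaputo A V (n + 1) =
      ∑ k ∈ Finset.range (n + 1), A (n + 1) (k + 1) • (V (k + 1) - V k) := by
  rw [discreteCaputo, show Finset.Icc 1 (n + 1) = Finset.Ico 1 (n + 2) by ext; simp; omega,
    Finset.sum_Ico_eq_sum_range]
  refine Finset.sum_congr rfl fun k _ => ?_
  rw [add_comm 1 k, Nat.add_sub_cancel]

/-- The modes of a solution of the scheme. -/
theorem IsSchemeSolution.isModeScheme {α r θ : ℝ} {N : ℕ} {A : ℕ → ℕ → ℝ} {a₀ a₁ f : L2 L}
    {U Z : ℕ → L2 L} (hL : 0 < L) (h : IsSchemeSolution α L T r θ N A a₀ a₁ f U Z) (k : ℕ) :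
    IsModeScheme T r (α / 2) θ N A (freq L k) (coeff L a₀ (k + 1))
      (coeff L (a₁ + Real.Gamma (2 - α) • f) (k + 1)) fun n => complexMode L k (U n) (Z n) := by
  refine ⟨?_, fun n hn => ?_⟩
  · simp only [h.initial_U, h.initial_Z, complexMode, map_zero, add_zero, modeMap_apply]
    rw [mul_comm]
  · have hm : n + 1 ∈ Finset.Icc 1 N := Finset.mem_Icc.2 ⟨by omega, hn⟩
    have h1 := (h.eq_one (n + 1) hm).coeff_eq hL k
    have h2 := congrArg (fun ψ => coeff L ψ (k + 1)) (h.eq_two (n + 1) hm)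
    simp only [coeff_sub, coeff_smul] at h2
    set μ := freq L k with hμ
    have e3 : ∑ j ∈ Finset.range (n + 1), A (n + 1) (j + 1) •
        (complexMode L k (U (j + 1)) (Z (j + 1)) - complexMode L k (U j) (Z j)) =
        modeMap L k μ (discreteCaputo A U (n + 1)) +
        modeMap L k Complex.I (discreteCaputo A Z (n + 1)) := by
      rw [discreteCaputo_succ, discreteCaputo_succ, map_sum, map_sum, ← Finset.sum_add_distrib]
      refine Finset.sum_congr rfl fun j _ => ?_
      rw [complexMode_sub, complexMode, smul_add, map_smul, map_smul]
    have e4 : θ • complexMode L k (U n) (Z n) + (1 - θ) • complexMode L k (U (n + 1)) (Z (n + 1)) =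
        complexMode L k (offsetValue θ U (n + 1)) (offsetValue θ Z (n + 1)) := by
      simp only [complexMode, offsetValue, Nat.add_sub_cancel, map_add, map_smul, smul_add]
      abel
    rw [e3, e4, complexMode_eq, modeMap_apply, modeMap_apply, h1]
    have h3 : coeff L (discreteCaputo A U (n + 1)) (k + 1) =
        coeff L (offsetValue θ Z (n + 1)) (k + 1) + omega (2 - α / 2) (offsetNode T r θ N (n + 1)) *
        coeff L (a₁ + Real.Gamma (2 - α) • f) (k + 1) := by linarith
    rw [h3, ← hμ]
    push_cast
    linear_combination ((coeff L (offsetValue θ Z (n + 1)) (k + 1) : ℂ) * μ) * Complex.I_sq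

end Modes

/-! ### Error bounds -/

section ErrorBounds

variable {α L T r θ : ℝ}

theorem fracNorm_nonneg (γ : ℝ) (ψ : L2 L) : 0 ≤ fracNorm L γ ψ := Real.sqrt_nonneg _

theorem hasSum_fracNorm_sq {γ : ℝ} {ψ : L2 L} (h : MemFracDomain L γ ψ) :
    HasSum (fun k => (eigenvalue L (k + 1) ^ γ * coeff L ψ (k + 1)) ^ 2) (fracNorm L γ ψ ^ 2) := by
  rw [fracNorm, Real.sq_sqrt (tsum_nonneg fun k => sq_nonneg _)]
  exact Summable.hasSum h

/-- The spectrum is bounded below by its first eigenvalue, so higher powers of the Laplacian control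
lower ones. -/
theorem eigenvalue_rpow_le (hL : 0 < L) {p s : ℝ} (hps : p ≤ s) (k : ℕ) :
    eigenvalue L (k + 1) ^ p ≤ (freq L 0 ^ 2) ^ (p - s) * eigenvalue L (k + 1) ^ s := by
  have h0 := freq_pos hL 0
  have hk := freq_pos hL k
  have hle := freq_zero_le hL k
  rw [eigenvalue_succ]
  have h1 : (freq L k ^ 2) ^ p = (freq L k ^ 2) ^ (p - s) * (freq L k ^ 2) ^ s := by
    rw [← Real.rpow_add (by positivity), sub_add_cancel]
  rw [h1]
  have h2 : (freq L k ^ 2) ^ (p - s) ≤ (freq L 0 ^ 2) ^ (p - s) :=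
    Real.rpow_le_rpow_of_nonpos (by positivity) (by gcongr) (by linarith)
  gcongr

/-- Parseval in both directions: squared mode errors are dominated termwise by squared coefficients
of the data. Summing gives the L² norm of the error in z, and also the existence and the norm of the
weak derivative of the error in u. -/
theorem exists_errorBound_of_mode (hL : 0 < L) (hT : 0 < T) (hr : 1 ≤ r) (hα0 : 0 < α)
    (hα2 : α < 2) {A : ℕ → ℕ → ℕ → ℝ} {s₀ s₁ p₀ p₁ C : ℝ} {R : ℕ → ℝ} (hs₀ : p₀ ≤ s₀) (hs₁ : p₁ ≤ s₁)
    (hC : 0 ≤ C) (hR : ∀ N, 0 ≤ R N)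
    (hmode : ∀ N : ℕ, 1 ≤ N → ∀ (μ a g : ℝ) (w : ℕ → ℂ), freq L 0 ≤ μ →
      IsModeScheme T r (α / 2) θ N (A N) μ a g w → ∀ n ≤ N,
      ‖modeSol (α / 2) μ a g (node T r N n) - w n‖ ≤
        C * R N * ((μ ^ 2) ^ p₀ * |a| + (μ ^ 2) ^ p₁ * |g|)) :
    ∃ C' : ℝ, 0 < C' ∧ ErrorBound α L T r θ A s₀ s₁ C' R := by
  have hμ0 := freq_pos hL 0
  have hG := Real.Gamma_pos_of_pos (by linarith : 0 < 2 - α)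
  set c₀ := (freq L 0 ^ 2) ^ (p₀ - s₀) with hc₀
  set c₁ := (freq L 0 ^ 2) ^ (p₁ - s₁) with hc₁
  have hc₀0 : 0 < c₀ := Real.rpow_pos_of_pos (by positivity) _
  have hc₁0 : 0 < c₁ := Real.rpow_pos_of_pos (by positivity) _
  set D := c₀ + c₁ + c₁ * Real.Gamma (2 - α) with hD
  have hD0 : 0 < D := by positivity
  -- Each of the two error norms is at most 2CD times data and rate, since (x + y + w)² ≤ 3(x² + y²
  -- + w²) and 3 ≤ 2². The summand 1 keeps the constant positive when C = 0.
  refine ⟨4 * C * D + 1, by positivity,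
    fun a₀ a₁ f h₀ h₁ hf u z hsol N hN U Z hsch n hn => ?_⟩
  have hnN := (Finset.mem_Icc.1 hn).2
  have htn : node T r N n ∈ Icc 0 T := ⟨node_nonneg hT n, node_le_T hT hr hN hnN⟩
  set e : ℕ → ℂ := fun k => complexMode L k (u (node T r N n) - U n) (z (node T r N n) - Z n) with he
  set x : ℕ → ℝ := fun k => eigenvalue L (k + 1) ^ s₀ * coeff L a₀ (k + 1) with hx
  set y : ℕ → ℝ := fun k => eigenvalue L (k + 1) ^ s₁ * coeff L a₁ (k + 1) with hy
  set w : ℕ → ℝ := fun k => eigenvalue L (k + 1) ^ s₁ * coeff L f (k + 1) with hw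
  set M := fracNorm L s₀ a₀ + fracNorm L s₁ a₁ + fracNorm L s₁ f with hM
  have hRN := hR N
  have he_le : ∀ k, ‖e k‖ ≤ C * R N * D * (|x k| + |y k| + |w k|) := by
    intro k
    have h1 := hmode N hN (freq L k) _ _ _ (freq_zero_le hL k) (hsch.isModeScheme hL k) n hnN
    rw [← hsol.complexMode_eq_modeSol hL hT hα0 hα2 k htn, complexMode_sub] at h1
    refine h1.trans ?_
    rw [mul_assoc (C * R N)]
    refine mul_le_mul_of_nonneg_left ?_ (by positivity)
    have e₀ := eigenvalue_rpow_le hL hs₀ k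
    have e₁ := eigenvalue_rpow_le hL hs₁ k
    have hpos : ∀ s : ℝ, 0 < eigenvalue L (k + 1) ^ s := fun s => by
      have := freq_pos hL k
      rw [eigenvalue_succ]
      positivity
    have hx' : |x k| = eigenvalue L (k + 1) ^ s₀ * |coeff L a₀ (k + 1)| := by
      rw [hx, abs_mul, abs_of_pos (hpos s₀)]
    have hy' : |y k| = eigenvalue L (k + 1) ^ s₁ * |coeff L a₁ (k + 1)| := by
      rw [hy, abs_mul, abs_of_pos (hpos s₁)]
    have hw' : |w k| = eigenvalue L (k + 1) ^ s₁ * |coeff L f (k + 1)| := by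
      rw [hw, abs_mul, abs_of_pos (hpos s₁)]
    have hg : |coeff L (a₁ + Real.Gamma (2 - α) • f) (k + 1)| ≤
        |coeff L a₁ (k + 1)| + Real.Gamma (2 - α) * |coeff L f (k + 1)| := by
      rw [coeff_add, coeff_smul]
      refine (abs_add_le _ _).trans_eq ?_
      rw [abs_mul, abs_of_pos hG]
    rw [eigenvalue_succ] at e₀ e₁ hx' hy' hw' hpos
    have hps := hpos s₁
    calc _ ≤ c₀ * (freq L k ^ 2) ^ s₀ * |coeff L a₀ (k + 1)| + c₁ * (freq L k ^ 2) ^ s₁ *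
          (|coeff L a₁ (k + 1)| + Real.Gamma (2 - α) * |coeff L f (k + 1)|) := by gcongr
      _ = c₀ * |x k| + c₁ * |y k| + c₁ * Real.Gamma (2 - α) * |w k| := by
        rw [hx', hy', hw']; ring
      _ ≤ D * |x k| + D * |y k| + D * |w k| := by
        have : 0 < c₁ * Real.Gamma (2 - α) := by positivity
        gcongr <;> linarith
      _ = _ := by ring
  have hsum := (((hasSum_fracNorm_sq h₀).add (hasSum_fracNorm_sq h₁)).add
    (hasSum_fracNorm_sq hf)).mul_left (3 * (C * R N * D) ^ 2)
  have he_sq : ∀ k, ‖e k‖ ^ 2 ≤ 3 * (C * R N * D) ^ 2 * (x k ^ 2 + y k ^ 2 + w k ^ 2) := by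
    intro k
    have h1 := pow_le_pow_left₀ (norm_nonneg _) (he_le k) 2
    refine h1.trans ?_
    rw [mul_pow]
    have h2 : (|x k| + |y k| + |w k|) ^ 2 ≤ 3 * (x k ^ 2 + y k ^ 2 + w k ^ 2) := by
      rw [← sq_abs (x k), ← sq_abs (y k), ← sq_abs (w k)]
      nlinarith [sq_nonneg (|x k| - |y k|), sq_nonneg (|x k| - |w k|), sq_nonneg (|y k| - |w k|)]
    have h3 := mul_le_mul_of_nonneg_left h2 (sq_nonneg (C * R N * D))
    linarith
  have hX := fracNorm_nonneg (L := L) s₀ a₀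
  have hY := fracNorm_nonneg (L := L) s₁ a₁
  have hW := fracNorm_nonneg (L := L) s₁ f
  have htot : 3 * (C * R N * D) ^ 2 * (fracNorm L s₀ a₀ ^ 2 + fracNorm L s₁ a₁ ^ 2 +
      fracNorm L s₁ f ^ 2) ≤ (2 * C * D * M * R N) ^ 2 := by
    have h1 : 3 * (fracNorm L s₀ a₀ ^ 2 + fracNorm L s₁ a₁ ^ 2 + fracNorm L s₁ f ^ 2) ≤
        (2 * M) ^ 2 := by
      rw [hM]
      nlinarith [mul_nonneg hX hY, mul_nonneg hX hW, mul_nonneg hY hW]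
    have h2 := mul_le_mul_of_nonneg_left h1 (sq_nonneg (C * R N * D))
    calc _ = (C * R N * D) ^ 2 *
          (3 * (fracNorm L s₀ a₀ ^ 2 + fracNorm L s₁ a₁ ^ 2 + fracNorm L s₁ f ^ 2)) := by ring
      _ ≤ _ := h2
      _ = _ := by ring
  have hB0 : 0 ≤ 2 * C * D * M * R N := by positivity
  have hu_sq : ∀ k, (freq L k * coeff L (u (node T r N n) - U n) (k + 1)) ^ 2 ≤
      3 * (C * R N * D) ^ 2 * (x k ^ 2 + y k ^ 2 + w k ^ 2) := fun k => by
    refine le_trans ?_ (he_sq k)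
    rw [he, norm_complexMode_sq]
    exact le_add_of_nonneg_right (sq_nonneg _)
  have hz_sq : ∀ k, coeff L (z (node T r N n) - Z n) (k + 1) ^ 2 ≤
      3 * (C * R N * D) ^ 2 * (x k ^ 2 + y k ^ 2 + w k ^ 2) := fun k => by
    refine le_trans ?_ (he_sq k)
    rw [he, norm_complexMode_sq]
    exact le_add_of_nonneg_left (sq_nonneg _)
  have hu_sum : Summable fun k => (freq L k * coeff L (u (node T r N n) - U n) (k + 1)) ^ 2 :=
    Summable.of_nonneg_of_le (fun k => sq_nonneg _) hu_sq hsum.summable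
  obtain ⟨g, hg, hgn⟩ := exists_hasWeakDeriv hL _ hu_sum
  refine ⟨g, hg, ?_⟩
  have hg_le : ‖g‖ ≤ 2 * C * D * M * R N := by
    refine (sq_le_sq₀ (norm_nonneg _) hB0).1 ?_
    rw [hgn]
    exact (hasSum_le hu_sq hu_sum.hasSum hsum).trans htot
  have hz_le : ‖z (node T r N n) - Z n‖ ≤ 2 * C * D * M * R N :=
    (sq_le_sq₀ (norm_nonneg _) hB0).1
      ((hasSum_le hz_sq (hasSum_coeff_sq hL _) hsum).trans htot)
  have hMR : 0 ≤ M * R N := by positivity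
  linarith

theorem ErrorBound.mono {A : ℕ → ℕ → ℕ → ℝ} {s₀ s₁ C : ℝ} {R R' : ℕ → ℝ} (hC : 0 ≤ C)
    (h : ErrorBound α L T r θ A s₀ s₁ C R) (hR : ∀ N, R N ≤ R' N) :
    ErrorBound α L T r θ A s₀ s₁ C R' := by
  intro a₀ a₁ f h₀ h₁ hf u z hsol N hN U Z hsch n hn
  obtain ⟨g, hg, hle⟩ := h a₀ a₁ f h₀ h₁ hf u z hsol N hN U Z hsch n hn
  refine ⟨g, hg, hle.trans (mul_le_mul_of_nonneg_left (hR N) (mul_nonneg hC ?_))⟩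
  have hX := fracNorm_nonneg (L := L) s₀ a₀
  have hY := fracNorm_nonneg (L := L) s₁ a₁
  have hW := fracNorm_nonneg (L := L) s₁ f
  positivity

theorem exists_l1_errorBound (hL : 0 < L) (hT : 0 < T) (hr : 1 ≤ r) (hα0 : 0 < α) (hα2 : α < 2)
    {s₀ s₁ m : ℝ} (hs₀ : 1 ≤ s₀) (hs₁ : 1 / 2 ≤ s₁) (hm : m ≤ r * (α / 2)) (hm2 : m ≤ 2 - α / 2) :
    ∃ C : ℝ, 0 < C ∧ ErrorBound α L T r 0 (l1Kernel T r (α / 2)) s₀ s₁ C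
      fun N => (N : ℝ) ^ (-m) := by
  obtain ⟨C, hC0, hC⟩ := exists_l1_mode_error_le hT hr (by linarith) (by linarith) hm hm2
  refine exists_errorBound_of_mode hL hT hr hα0 hα2 hs₀ hs₁ hC0 (fun N => by positivity) ?_
  intro N hN μ a g w hμ hw n hn
  have hμ0 : 0 ≤ μ := (freq_pos hL 0).le.trans hμ
  rw [Real.rpow_one, ← Real.sqrt_eq_rpow, Real.sqrt_sq hμ0]
  exact hC N hN μ a g w hμ0 hw n hn

theorem exists_alikhanov_errorBound (hL : 0 < L) (hT : 0 < T) (hr : 1 ≤ r) (hα0 : 0 < α)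
    (hα2 : α < 2) {s₀ s₁ m : ℝ} (hs₀ : 3 / 2 ≤ s₀) (hs₁ : 1 ≤ s₁) (hm : m ≤ r * (α / 2))
    (hm2 : m ≤ 2) :
    ∃ C : ℝ, 0 < C ∧ ErrorBound α L T r (α / 2 / 2) (alikhanovKernel T r (α / 2)) s₀ s₁ C
      fun N => (N : ℝ) ^ (-m) := by
  obtain ⟨C, hC0, hC⟩ := exists_alikhanov_mode_error_le hT hr (by linarith) (by linarith) hm hm2
    (freq_pos hL 0)
  refine exists_errorBound_of_mode hL hT hr hα0 hα2 hs₀ hs₁ hC0 (fun N => by positivity) ?_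
  intro N hN μ a g w hμ hw n hn
  have hμ0 : 0 < μ := (freq_pos hL 0).trans_le hμ
  have e : (μ ^ 2) ^ (3 / 2 : ℝ) = μ ^ 3 := by
    rw [← Real.rpow_natCast μ 2, ← Real.rpow_mul hμ0.le, ← Real.rpow_natCast μ 3]
    norm_num
  rw [Real.rpow_one, e]
  exact hC N hN μ a g w hμ hw n hn

end ErrorBounds

/-! ### Optimal grading -/

/-- Both exponents saturate exactly when m ≤ rp and m ≤ rq, that is when a ≤ r and b ≤ r. -/
theorem isLeast_grading {p q m a b : ℝ} (hp : 0 < p) (hq : 0 < q) (ha : a * p = m) (hb : b * q = m)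
    (h1 : 1 ≤ max a b) :
    IsLeast {r : ℝ | 1 ≤ r ∧ min (min (r * p) m) (min (r * q) m) = m} (max a b) := by
  have key : ∀ r : ℝ, min (min (r * p) m) (min (r * q) m) = m ↔ a ≤ r ∧ b ≤ r := by
    intro r
    have e : min (min (r * p) m) (min (r * q) m) = m ↔ m ≤ r * p ∧ m ≤ r * q := by
      constructor
      · intro h
        exact ⟨(h.ge.trans (min_le_left _ _)).trans (min_le_left _ _),
          (h.ge.trans (min_le_right _ _)).trans (min_le_left _ _)⟩
      · rintro ⟨h1, h2⟩
        rw [min_eq_right h1, min_eq_right h2, min_self]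
    rw [e]
    nth_rewrite 1 [← ha]
    rw [← hb, mul_le_mul_iff_left₀ hp, mul_le_mul_iff_left₀ hq]
  refine ⟨⟨h1, (key _).2 ⟨le_max_left _ _, le_max_right _ _⟩⟩, fun r hr => ?_⟩
  obtain ⟨h2, h3⟩ := (key r).1 hr.2
  exact max_le h2 h3

end SFOR


end

theorem theorem4p7 (α L T : ℝ) (hα₁ : 1 < α) (hα₂ : α < 2) (hL : 0 < L) (hT : 0 < T)
    (γ₁ γ₂ ε β : ℝ) (hγ₁ : γ₁ ∈ Set.Ioc (1 / α + 1 / 4) (3 / 2))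
    (hγ₂ : γ₂ ∈ Set.Ioc (1 / 4) 1) (hε : 0 < ε) (hβ : β = α / 2) :
    -- the `L1` scheme, `θ = 0`
    (∀ r : ℝ, 1 ≤ r → ∃ C : ℝ, 0 < C ∧
      SFOR.ErrorBound α L T r 0 (SFOR.l1Kernel T r β)
        (max (γ₁ + ε) 1) (max (γ₂ + ε) (1 / 2)) C
        (fun N => (N : ℝ) ^ (-min (r * β) (2 - β))
          + (N : ℝ) ^ (-min (r * (1 - β / 2)) (2 - β)))) ∧
    -- the `L2-1_σ` scheme, `θ = β / 2`
    (∀ r : ℝ, 1 ≤ r → ∃ C : ℝ, 0 < C ∧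
      SFOR.ErrorBound α L T r (β / 2) (SFOR.alikhanovKernel T r β)
        (max (γ₁ + ε) 1 + 1 / 2) (max (γ₂ + ε) (1 / 2) + 1 / 2) C
        (fun N => (N : ℝ) ^ (-min (r * β) 2)
          + (N : ℝ) ^ (-min (r * (1 - β / 2)) 2))) ∧
    -- the optimal mesh parameter of the `L1` scheme
    (∃ C : ℝ, 0 < C ∧
      SFOR.ErrorBound α L T (max ((4 - α) / α) 2) 0 (SFOR.l1Kernel T (max ((4 - α) / α) 2) β)
        (max (γ₁ + ε) 1) (max (γ₂ + ε) (1 / 2)) C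
        (fun N => (N : ℝ) ^ (-(2 - β)))) ∧
    IsLeast {r : ℝ | 1 ≤ r ∧
      min (min (r * β) (2 - β)) (min (r * (1 - β / 2)) (2 - β)) = 2 - β}
      (max ((4 - α) / α) 2) ∧
    -- the optimal mesh parameter of the `L2-1_σ` scheme
    (∃ C : ℝ, 0 < C ∧
      SFOR.ErrorBound α L T (max (4 / α) (8 / (4 - α))) (β / 2)
        (SFOR.alikhanovKernel T (max (4 / α) (8 / (4 - α))) β)
        (max (γ₁ + ε) 1 + 1 / 2) (max (γ₂ + ε) (1 / 2) + 1 / 2) C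
        (fun N => (N : ℝ) ^ (-(2 : ℝ)))) ∧
    IsLeast {r : ℝ | 1 ≤ r ∧
      min (min (r * β) 2) (min (r * (1 - β / 2)) 2) = 2}
      (max (4 / α) (8 / (4 - α))) := by
  subst hβ
  have hα0 : 0 < α := by linarith
  have h4 : 0 < 4 - α := by linarith
  have hs₀ : 1 ≤ max (γ₁ + ε) 1 := le_max_right _ _
  have hs₁ : 1 / 2 ≤ max (γ₂ + ε) (1 / 2) := le_max_right _ _
  have e₁ : (4 - α) / α * (α / 2) = 2 - α / 2 := by field_simp; ring
  have e₂ : 4 / α * (α / 2) = 2 := by field_simp; ring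
  have e₃ : 8 / (4 - α) * (1 - α / 2 / 2) = 2 := by field_simp; ring
  have hr₁ : 1 ≤ max ((4 - α) / α) 2 := le_max_of_le_right (by norm_num)
  have hr₂ : 1 ≤ max (4 / α) (8 / (4 - α)) :=
    le_max_of_le_left (by rw [le_div_iff₀ hα0]; linarith)
  refine ⟨fun r hr => ?_, fun r hr => ?_, ?_, ?_, ?_, ?_⟩
  · obtain ⟨C, hC, h⟩ := SFOR.exists_l1_errorBound hL hT hr hα0 hα₂ hs₀ hs₁
      (min_le_left (r * (α / 2)) (2 - α / 2)) (min_le_right _ _)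
    -- The bound with the first summand of the rate is already proved; the second is nonnegative.
    exact ⟨C, hC, h.mono hC.le fun N => le_add_of_nonneg_right (by positivity)⟩
  · obtain ⟨C, hC, h⟩ := SFOR.exists_alikhanov_errorBound hL hT hr hα0 hα₂
      (by linarith : 3 / 2 ≤ max (γ₁ + ε) 1 + 1 / 2)
      (by linarith : 1 ≤ max (γ₂ + ε) (1 / 2) + 1 / 2)
      (min_le_left (r * (α / 2)) 2) (min_le_right _ _)
    exact ⟨C, hC, h.mono hC.le fun N => le_add_of_nonneg_right (by positivity)⟩
  -- Only rβ ≥ 2 − β has to be checked, and (4 − α)/α is the value of r at which equality holds.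
  · refine SFOR.exists_l1_errorBound hL hT hr₁ hα0 hα₂ hs₀ hs₁ ?_ le_rfl
    rw [← e₁]
    gcongr
    exact le_max_left _ _
  · exact SFOR.isLeast_grading (by linarith) (by linarith) e₁ (by ring) hr₁
  · refine SFOR.exists_alikhanov_errorBound hL hT hr₂ hα0 hα₂ (by linarith) (by linarith) ?_ le_rfl
    refine e₂.ge.trans ?_
    gcongr
    exact le_max_left _ _
  · exact SFOR.isLeast_grading (by linarith) (by linarith) e₂ e₃ hr₂
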